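/- Let $p$ be a prime number, let $S$ be a regular scheme, and let $U$ be a regular integral scheme of finite type over $S$ with an action over $S$ of the group $G=\mathbf{Z}/p=\langle\sigma:\sigma^p=1\rangle$. Let $f\colon U\to U/G$ be the quotient; that is, $f$ is affine and $O_{U/G}=(f_*O_U)^G$, and $U/G$ is considered as a scheme over $S$. For a function $a$ on $U$, write $I(a)=\sigma(a)-a$, where $\sigma(a)=(\sigma^{-1})^*a$. Let $x_1\in O(U)$ be a nonzero function such that $E_1=\{x_1=0\}$ is a regular scheme, and suppose that the fixed point scheme $U^G$ is generically equal to $E_1$: the two closed subschemes coincide outside a closed subset of codimension at least $2$ in $U$. Suppose that $I(x_1)\in x_1^2O(U)$; for example, $I(x_1)=x_1^2\cdot(\text{unit})$. Then $U/G$ is integral and locally Noetherian, and $f$ is fiercely ramified along (every irreducible component of) $E_1$: its ramification index there is $1$ and the extension of residue fields at the generic point is purely inseparable of degree $p$. Moreover, let $F_1$ be the image of $E_1$ in $U/G$, viewed as a reduced Weil divisor. Then $F_1$ is $\mathbf{Q}$-Cartier, $f^*F_1=E_1$, and $$K_U=f^*K_{U/G}+(p-1)E_1 .$$ Here $K_U$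 and $K_{U/G}$ are the canonical divisors over $S$, and the last formula means the following. There are nonzero rational sections $\eta$ of the canonical sheaf $\omega_{(U/G)/S}$; each of them has a divisor and a pullback to a rational section $f^*\eta$ of $\omega_{U/S}$; and $\operatorname{div}(f^*\eta)=f^*\operatorname{div}(\eta)+(p-1)E_1$ as Weil divisors on $U$. (In codimension at most $1$, the canonical sheaf is $\omega_{X/S}=\omega_{\mathbf{A}^n_S/S}|_X\otimes\det(J/J^2)^*$ for a local embedding of $X$ in $\mathbf{A}^n_S$ with ideal sheaf $J$.) -/

import Mathlib

universe u

namespace QuotientRamification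

open AlgebraicGeometry CategoryTheory MvPolynomial

noncomputable section

/-! ### Regular schemes, group actions, quotients and fixed points -/

/-- A regular scheme: locally Noetherian with regular local rings. -/
class IsRegularScheme (X : Scheme.{u}) : Prop extends IsLocallyNoetherian X where
  isRegularLocalRing_stalk : ∀ x : X, IsRegularLocalRing (X.presheaf.stalk x)

/-- `f : U ⟶ X` is the quotient of `U` by the action `ρ` of `G`: it is affine and invariant,
and it identifies the sections of `O_X` over an open set `V` with the invariant sections of
`O_U` over `f⁻¹(V)`. So, over an affine open `V = Spec A`, the morphism is
`Spec B ⟶ Spec A` with `A = B^G`. -/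
structure IsQuotient {G : Type} [Group G] {U X : Scheme.{u}} (ρ : G →* Aut U) (f : U ⟶ X) :
    Prop where
  isAffineHom : IsAffineHom f
  invariant : ∀ g : G, (ρ g).hom ≫ f = f
  existsUnique_section : ∀ (V : X.Opens) (s : Γ(U, f ⁻¹ᵁ V)),
    (∀ (g : G) (h : f ⁻¹ᵁ V ≤ (ρ g).hom ⁻¹ᵁ (f ⁻¹ᵁ V)), (ρ g).hom.appLE _ _ h s = s) →
      ∃! t : Γ(X, V), f.app V t = s

/-- On the open subset `O` of `U`, the fixed point scheme `U^G` coincides, as a subscheme,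
with the zero scheme `{x = 0}` of the function `x`. Both subschemes are described by their
functors of points: a `T`-valued point `t` of `U` lies in `U^G` when it is fixed by `G`, and it
lies in `{x = 0}` when the pullback of `x` to `T` is zero. (On a `G`-invariant affine open set
`Spec B`, the first condition says that `t` lies in the closed subscheme whose ideal is generated
by the elements `g(b) - b`.) -/
def FixedSchemeEqZeroScheme {G : Type} [Group G] {U : Scheme.{u}} (ρ : G →* Aut U)
    (x : Γ(U, ⊤)) (O : U.Opens) : Prop :=
  ∀ (T : Scheme.{u}) (t : T ⟶ U), Set.range t ⊆ (O : Set U) →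
    ((∀ g : G, t ≫ (ρ g).hom = t) ↔ t.appTop x = 0)

/-- The effective Cartier divisor `{x = 0}` is a regular scheme: its local rings
`O_{U,y} / (x)`, for the points `y` where `x` vanishes, are regular. -/
def ZeroSchemeIsRegular {U : Scheme.{u}} (x : Γ(U, ⊤)) : Prop :=
  ∀ y : U, y ∈ U.zeroLocus {x} →
    IsRegularLocalRing
      (U.presheaf.stalk y ⧸ Ideal.span {(U.presheaf.germ ⊤ y trivial).hom x})

/-- The action of `σ` on functions, `σ(a) = (σ⁻¹)^* a`. -/
def actOnFunction {U : Scheme.{u}} (σ : Aut U) (a : Γ(U, ⊤)) : Γ(U, ⊤) :=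
  σ.inv.appTop a

/-! ### Weil divisors

A Weil divisor is written as the function which sends a point of codimension one to the
coefficient of its closure and which is zero at all other points. -/

/-- The sum, with coefficients one, of the prime divisors whose generic point lies in `Z`. For `Z`
closed of codimension at least one, this is the sum of the prime divisors contained in `Z`. -/
def reducedDivisor {X : Scheme.{u}} (Z : Set X) : X → ℤ :=
  open Classical in fun y => if Order.coheight y = 1 ∧ y ∈ Z then 1 else 0

/-- The ramification index of `f` at `y`, that is, the exponent `e` with
`m_{f(y)} O_{U,y} = m_y ^ e` when the local rings are discrete valuation rings. -/
def ramificationIndex {U X : Scheme.{u}} (f : U ⟶ X) (y : U) : ℕ :=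
  (Module.length (U.presheaf.stalk y)
    (U.presheaf.stalk y ⧸
      (IsLocalRing.maximalIdeal (X.presheaf.stalk (f y))).map (f.stalkMap y).hom)).toNat

/-- The pullback of a Weil divisor under a finite morphism of normal schemes. -/
def pullbackDivisor {U X : Scheme.{u}} (f : U ⟶ X) (D : X → ℤ) : U → ℤ :=
  open Classical in fun y => if Order.coheight y = 1 then ramificationIndex f y * D (f y) else 0

/-- Some positive multiple of the Weil divisor `D` is locally principal. -/
def IsQCartier {X : Scheme.{u}} [IsIntegral X] [IsLocallyNoetherian X] (D : X → ℤ) : Prop :=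
  ∃ m : ℕ, 0 < m ∧ ∀ x : X, ∃ V : X.Opens, x ∈ V ∧ ∃ g : X.functionField, g ≠ 0 ∧
    ∀ y ∈ V, Order.coheight y = 1 → X.ord g y = m * D y

/-- `f` is fiercely ramified, for a covering of prime degree `p`, along the prime divisor with
generic point `y`: the ramification index is one and the extension of residue fields is purely
inseparable of degree `p`. -/
def IsFiercelyRamifiedAt (p : ℕ) {U X : Scheme.{u}} (f : U ⟶ X) (y : U) : Prop :=
  letI := (f.residueFieldMap y).hom.toAlgebra
  ramificationIndex f y = 1 ∧
    IsPurelyInseparable (X.residueField (f y)) (U.residueField y) ∧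
    Module.finrank (X.residueField (f y)) (U.residueField y) = p

/-! ### The canonical sheaf

Let `X` be a normal integral scheme of finite type over a regular scheme `S`. At a point `x` where
`X` is regular (for example, at any point of codimension at most one), write the local ring
`O_{X,x}` as a local ring of a closed subscheme of an affine space over `O_{S,π(x)}`, with
coordinates `t_1, …, t_n` and ideal `I`. The conormal module `I/I²` is free over `O_{X,x}`. If
`f_1, …, f_c` is a basis of it, then the canonical sheaf
`ω_{X/S} = ω_{𝔸^n/S} ⊗ det(I/I²)^*` is free at `x` on the generator

  `[dt/f] = (dt_1 ∧ ⋯ ∧ dt_n) ⊗ (f_1 ∧ ⋯ ∧ f_c)^*`.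

The generators given by different embeddings are compared by `IsRatio` below. -/

section Algebra

variable {R A : Type u} [CommRing R] [CommRing A]

/-- The `R`-algebra `A` is a localization of its subalgebra generated by the elements `a i`. -/
def EssentiallyGenerates (φ : R →+* A) {ι : Type} (a : ι → A) : Prop :=
  ∀ z : A, ∃ p q : MvPolynomial ι R, IsUnit (eval₂ φ a q) ∧ z * eval₂ φ a q = eval₂ φ a p

/-- The ideal of polynomial relations over `R` between the elements `a i`. -/
def relations (φ : R →+* A) {ι : Type} (a : ι → A) : Ideal (MvPolynomial ι R) :=
  RingHom.ker (eval₂Hom φ a)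

/-- For a local ring `A` which is essentially generated by the elements `a i`, with ideal of
relations `I`: the polynomials `f j` lie in `I` and they give a basis of the `A`-module
`I/I² ⊗ A` (the localization of `I/I²` at the prime ideal of the point). -/
structure IsConormalFrame (φ : R →+* A) {ι κ : Type} [Fintype κ] (a : ι → A)
    (f : κ → MvPolynomial ι R) : Prop where
  mem : ∀ j, f j ∈ relations φ a
  span : ∀ g ∈ relations φ a, ∃ q : MvPolynomial ι R, IsUnit (eval₂ φ a q) ∧
    q * g ∈ Ideal.span (Set.range f) ⊔ relations φ a ^ 2
  indep : ∀ c : κ → MvPolynomial ι R, ∑ j, c j * f j ∈ relations φ a ^ 2 →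
    ∀ j, eval₂ φ a (c j) = 0

/-- An embedding of `Spec A` (as a local scheme) in an affine space over `R`, with a basis of the
conormal module. It determines the generator `[dt/f]` of the canonical module of `A` over `R`. -/
structure Presentation (φ : R →+* A) where
  /-- the number of coordinates -/
  n : ℕ
  /-- the codimension -/
  c : ℕ
  /-- the coordinates -/
  coord : Fin n → A
  /-- the basis of the conormal module -/
  rel : Fin c → MvPolynomial (Fin n) R
  essentiallyGenerates : EssentiallyGenerates φ coord
  isConormalFrame : IsConormalFrame φ coord rel

/-- The Jacobian determinant `det (∂ h_j / ∂ t_{s(i)})`, evaluated at the point `a`. -/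
def jacobian (φ : R →+* A) {τ ι : Type} [Fintype ι] [DecidableEq ι] (a : τ → A) (s : ι → τ)
    (h : ι → MvPolynomial τ R) : A :=
  (Matrix.of fun i j : ι => eval₂ φ a (pderiv (s i) (h j))).det

/-- `[da/f] = ± r [db/g]`, as rational canonical forms over a field `L`. Here `b` generates the
field `L` over `R`, and `a` generates a subfield `K` of `L` with `L/K` finite separable (`K = L`
is allowed).

To compare the two forms, use all coordinates `(a, b)` together. The conormal space of `(a, b)` has
the basis `(f, h)` for any relations `h` with `det(∂h/∂b) ≠ 0`, and
`[da/f] = det(∂h/∂b) [da db/(f, h)]`. It also has the basis `(g, k)` for any relations `k` with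
`det(∂k/∂a) ≠ 0`, and `[db/g] = ± det(∂k/∂a) [da db/(g, k)]`. If `(g, k) = (M/q) (f, h)` in the
conormal space, then `[da db/(f, h)] = det(M/q) [da db/(g, k)]`. The sign, which depends on
the order of the coordinates and relations, is irrelevant for divisors. -/
def IsRatio (φ : R →+* A) {ι κ ι' κ' : Type} [Fintype ι] [DecidableEq ι] [Fintype κ]
    [DecidableEq κ] [Fintype ι'] [DecidableEq ι'] (a : ι → A) (f : κ → MvPolynomial ι R)
    (b : ι' → A) (g : κ' → MvPolynomial ι' R) (r : A) : Prop :=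
  ∃ (h : ι' → MvPolynomial (ι ⊕ ι') R) (k : ι → MvPolynomial (ι ⊕ ι') R)
    (e : κ ⊕ ι' ≃ κ' ⊕ ι) (q : MvPolynomial (ι ⊕ ι') R)
    (M : Matrix (κ ⊕ ι') (κ ⊕ ι') (MvPolynomial (ι ⊕ ι') R)),
    (∀ j, h j ∈ relations φ (Sum.elim a b)) ∧
    (∀ j, k j ∈ relations φ (Sum.elim a b)) ∧
    jacobian φ (Sum.elim a b) Sum.inr h ≠ 0 ∧
    jacobian φ (Sum.elim a b) Sum.inl k ≠ 0 ∧
    eval₂ φ (Sum.elim a b) q ≠ 0 ∧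
    (∀ i, q * Sum.elim (fun j => rename Sum.inr (g j)) k (e i) -
        ∑ j, M i j * Sum.elim (fun j => rename Sum.inl (f j)) h j ∈
      relations φ (Sum.elim a b) ^ 2) ∧
    r * jacobian φ (Sum.elim a b) Sum.inl k *
        eval₂ φ (Sum.elim a b) q ^ Fintype.card (κ ⊕ ι') =
      (M.map (eval₂ φ (Sum.elim a b))).det * jacobian φ (Sum.elim a b) Sum.inr h

end Algebra

/-- A nonzero rational section `η = coeff • [dt/f]` of the canonical sheaf `ω_{X/S}`, where
`[dt/f]` is given by a presentation of the function field of `X`. -/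
structure CanonicalForm {X S : Scheme.{u}} [IsIntegral X] (π : X ⟶ S) where
  /-- the coefficient -/
  coeff : X.functionField
  coeff_ne_zero : coeff ≠ 0
  /-- the presentation of the function field over the local ring of `S` -/
  pres : Presentation (π.stalkMap (genericPoint X)).hom

lemma genericPoint_specializes {X : Scheme.{u}} [IsIntegral X] (x : X) : genericPoint X ⤳ x :=
  (genericPoint_spec X).specializes trivial

/-- The rational section `η` of `ω_{X/S}` has order `m` along the prime divisor with generic
point `x`: if `[db/g]` is a local generator of `ω_{X/S}` at `x` and `η = ± v [db/g]`, then the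
rational function `v` has order `m` at `x`. -/
def CanonicalForm.HasOrder {X S : Scheme.{u}} [IsIntegral X] [IsLocallyNoetherian X] {π : X ⟶ S}
    (η : CanonicalForm π) (x : X) (m : ℤ) : Prop :=
  ∃ (P : Presentation (π.stalkMap x).hom) (r : X.functionField),
    IsRatio (π.stalkMap (genericPoint X)).hom η.pres.coord η.pres.rel
      (fun i => algebraMap (X.presheaf.stalk x) X.functionField (P.coord i))
      (fun j => MvPolynomial.map
        (S.presheaf.stalkSpecializes
          ((genericPoint_specializes x).map π.continuous)).hom (P.rel j)) r ∧
    X.ord (η.coeff * r) x = m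

/-- `D` is the divisor of the rational section `η` of `ω_{X/S}`. Such a `D` is called a canonical
divisor of `X` over `S`. -/
def CanonicalForm.HasDivisor {X S : Scheme.{u}} [IsIntegral X] [IsLocallyNoetherian X] {π : X ⟶ S}
    (η : CanonicalForm π) (D : X → ℤ) : Prop :=
  ∀ x : X, (Order.coheight x = 1 → η.HasOrder x (D x)) ∧ (Order.coheight x ≠ 1 → D x = 0)

/-- The rational canonical form `η'` on `U` is, up to sign, the pullback of the rational canonical
form `η` on `X` by the dominant, generically étale morphism `f : U ⟶ X` over `S`. -/
def CanonicalForm.IsPullback {U X S : Scheme.{u}} [IsIntegral U] [IsIntegral X] {πU : U ⟶ S}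
    {πX : X ⟶ S} (f : U ⟶ X) (η : CanonicalForm πX) (η' : CanonicalForm πU) : Prop :=
  ∃ (hf : f (genericPoint U) ⤳ genericPoint X)
    (hs : πU (genericPoint U) ⤳ πX (genericPoint X)) (r : U.functionField),
    IsRatio (πU.stalkMap (genericPoint U)).hom
      (fun i => (f.stalkMap (genericPoint U)).hom
        ((X.presheaf.stalkSpecializes hf).hom (η.pres.coord i)))
      (fun j => MvPolynomial.map (S.presheaf.stalkSpecializes hs).hom (η.pres.rel j))
      η'.pres.coord η'.pres.rel r ∧
    η'.coeff = (f.stalkMap (genericPoint U)).hom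
      ((X.presheaf.stalkSpecializes hf).hom η.coeff) * r

end

end QuotientRamification

/-! The theorem is local at points of codimension one. Let `y` be such a point of `U`, let `B` be
its local ring, a discrete valuation ring, and let `A` be the local ring of `U/G` at `f y`. The aim
is to find one `z` in `B` such that `B` is a localization of `A[z]`. Its relations are then
generated by H = ∏ (T - gz), and the different is generated by H'(z) = ∏_{g ≠ 1} (z - gz). The main
tool is Lagrange interpolation at the conjugates of `z` (`exists_lagrange`): for an invariant
extension, b·H'(z) is a polynomial of degree < p in `z` over the invariants.

Off `E₁` some function is moved modulo the maximal ideal at `y`. Then `z` can be chosen with every z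
- gz a unit, and the different is trivial (`exists_isGenerator_of_unramified`).

On `E₁`, with local equation `x`, the group acts trivially modulo x but not modulo x², because the
fixed scheme is {x = 0} there. The condition I(x) ∈ (x²) makes gb - b lie in (x²) for every b in the
maximal ideal (`sq_dvd_smul_sub`). Take `z` with z - gz exactly divisible by x. Its residue class
lies outside the residue field of `A` (`isUnit_sub_map`). Norms show that p-th powers of residue
classes come from `A`, and traces force characteristic p, so the class of `z` has minimal polynomial
X^p - a. Hence a polynomial of degree < p has at `z` a valuation divisible by the ramification index
e. Interpolating b = 1 and b = x gives e ∣ p - 1 and e ∣ p, so e = 1 (`irreducible_map`). Dividing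
interpolation polynomials by the (p-1)-st power of a uniformizer of `A` then shows that `z`
generates `B`, and the different is (x^(p-1)) (`exists_isGenerator_of_isFierce`).

For canonical sheaves, adjoining a root z of a relation g gives [da/f] = ± (∂g/∂z) [da dz/(f, g)]
(`isRatio_adjoin`), and here ∂g/∂z is a unit times H'(z) (`IsConormalFrame.adjoin`). A local
generator downstairs therefore pulls back to H'(z) times one upstairs, which produces the term (p -
1)E₁. To compare arbitrary presentations, ratios of forms must exist and multiply up to sign; both
are proved by measuring forms against one volume on the conormal space of a joint tuple (`IsScale`),
using that the extension of function fields is separable. Presentations exist because a regular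
quotient of a regular local ring is cut out by a regular sequence (`exists_presentation`).

Finally, the norm of `x₁` pulls back to x₁^p up to a unit, which makes p·F₁ principal
(`exists_associated_pow`). -/

namespace QuotientRamification

open MvPolynomial

/-! ### Relations of a tuple and the local ring of affine space at it -/

section Relations

variable {R A : Type u} [CommRing R] [CommRing A] {τ : Type}

lemma mem_relations {φ : R →+* A} {c : τ → A} {g : MvPolynomial τ R} :
    g ∈ relations φ c ↔ eval₂ φ c g = 0 := Iff.rfl

instance relations_isPrime [IsDomain A] (φ : R →+* A) (c : τ → A) : (relations φ c).IsPrime :=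
  RingHom.ker_isPrime _

lemma rename_mem_relations {ι : Type} {φ : R →+* A} {a : ι → A} {c : τ → A} {s : ι → τ}
    (hs : ∀ i, c (s i) = a i) {g : MvPolynomial ι R} (hg : g ∈ relations φ a) :
    rename s g ∈ relations φ c := by
  rw [mem_relations, eval₂_rename]
  rw [mem_relations] at hg
  convert hg using 2
  exact funext hs

lemma eval₂_pderiv_rename_of_notMem_range {ι : Type} {φ : R →+* A} {c : τ → A} {s : ι → τ} {t : τ}
    (ht : t ∉ Set.range s) (g : MvPolynomial ι R) : eval₂ φ c (pderiv t (rename s g)) = 0 := by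
  classical
  rw [pderiv_eq_zero_of_notMem_vars]
  · simp
  · intro h
    obtain ⟨i, -, hi⟩ := Finset.mem_image.1 (vars_rename s g h)
    exact ht ⟨i, hi⟩

end Relations

section LocalEval

variable {R L : Type u} [CommRing R] [Field L] {τ : Type}

/-- The evaluation map on the local ring of affine space at the point given by `c`. -/
noncomputable def localEval (φ : R →+* L) (c : τ → L) :
    Localization.AtPrime (relations φ c) →+* L :=
  IsLocalization.lift (M := (relations φ c).primeCompl) (g := eval₂Hom φ c)
    fun y => isUnit_iff_ne_zero.2 fun h => y.2 h

@[simp]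
lemma localEval_algebraMap (φ : R →+* L) (c : τ → L) (g : MvPolynomial τ R) :
    localEval φ c (algebraMap _ _ g) = eval₂ φ c g :=
  IsLocalization.lift_eq _ _

lemma localEval_surjective {φ : R →+* L} {c : τ → L} (hc : EssentiallyGenerates φ c) :
    Function.Surjective (localEval φ c) := by
  intro z
  obtain ⟨p, q, hq, h⟩ := hc z
  refine ⟨IsLocalization.mk' _ p (⟨q, fun hq' => hq.ne_zero hq'⟩ : (relations φ c).primeCompl), ?_⟩
  rw [localEval, IsLocalization.lift_mk'_spec]
  simpa [mul_comm] using h.symm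

/-- As `L` is a field, polynomials with nonzero value are already inverted in the local ring.
Together with surjectivity this makes `L` the residue field of the local ring of affine space. -/
lemma ker_localEval (φ : R →+* L) (c : τ → L) :
    RingHom.ker (localEval φ c) = IsLocalRing.maximalIdeal _ := by
  refine le_antisymm (IsLocalRing.le_maximalIdeal (RingHom.ker_ne_top _)) ?_
  intro z hz
  by_contra h
  rw [RingHom.mem_ker] at h
  obtain ⟨⟨p, q⟩, hp⟩ := IsLocalization.surj (relations φ c).primeCompl z
  have h1 : eval₂ φ c p ≠ 0 := by
    rw [← localEval_algebraMap, ← hp, map_mul, localEval_algebraMap]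
    exact mul_ne_zero h fun h => q.2 h
  have h2 := IsLocalization.map_units (Localization.AtPrime (relations φ c))
    (⟨p, h1⟩ : (relations φ c).primeCompl)
  rw [← hp] at h2
  exact hz (isUnit_of_mul_isUnit_left h2)

lemma isUnit_algebraMap_localization {φ : R →+* L} {c : τ → L} {q : MvPolynomial τ R}
    (hq : eval₂ φ c q ≠ 0) :
    IsUnit (algebraMap _ (Localization.AtPrime (relations φ c)) q) :=
  IsLocalization.map_units (Localization.AtPrime (relations φ c))
    (⟨q, hq⟩ : (relations φ c).primeCompl)

/-- The way back from the local ring to polynomials: the multiplier `q` is the denominator which the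
clause `span` of a conormal frame allows. -/
lemma mem_map_relations_iff {φ : R →+* L} {c : τ → L} {J : Ideal (MvPolynomial τ R)}
    {g : MvPolynomial τ R} :
    algebraMap _ (Localization.AtPrime (relations φ c)) g ∈
      J.map (algebraMap _ (Localization.AtPrime (relations φ c))) ↔
      ∃ q, eval₂ φ c q ≠ 0 ∧ q * g ∈ J := by
  rw [IsLocalization.algebraMap_mem_map_algebraMap_iff (relations φ c).primeCompl]
  rfl

end LocalEval

/-! ### Generators of the conormal space over a separable subextension -/

section Span

/-- First order Taylor expansion of a polynomial around an approximate section. -/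
lemma sub_eq_sum_pderiv_mul {R L T : Type*} [CommRing R] [CommRing L] [CommRing T] {τ : Type*}
    [Fintype τ] (φ : R →+* L) (c : τ → L) (mk : MvPolynomial τ R →+* T) (σ : L →+* T)
    (hσ : ∀ r, σ (φ r) = mk (C r))
    (hδ : ∀ t t', (mk (X t) - σ (c t)) * (mk (X t') - σ (c t')) = 0) (g : MvPolynomial τ R) :
    mk g - σ (eval₂ φ c g) = ∑ t, σ (eval₂ φ c (pderiv t g)) * (mk (X t) - σ (c t)) := by
  classical
  induction g using MvPolynomial.induction_on with
  | C r => simp [hσ]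
  | add p q hp hq =>
    simp only [map_add, eval₂_add, add_mul, Finset.sum_add_distrib, ← hp, ← hq]
    ring
  | mul_X p t hp =>
    have h1 : ∀ t', σ (eval₂ φ c (pderiv t' (p * X t))) * (mk (X t') - σ (c t')) =
        σ (eval₂ φ c (pderiv t' p)) * (mk (X t') - σ (c t')) * σ (c t) +
          if t' = t then σ (eval₂ φ c p) * (mk (X t) - σ (c t)) else 0 := by
      intro t'
      rw [Derivation.leibniz, pderiv_X]
      by_cases h : t' = t
      · subst h; simp; ring
      · simp [h, Ne.symm h]; ring
    rw [Finset.sum_congr rfl fun t' _ => h1 t', Finset.sum_add_distrib, ← Finset.sum_mul, ← hp]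
    have h2 : (mk p - σ (eval₂ φ c p)) * (mk (X t) - σ (c t)) = 0 := by
      rw [hp, Finset.sum_mul]
      exact Finset.sum_eq_zero fun t' _ => by rw [mul_assoc, hδ, mul_zero]
    simp only [Finset.sum_ite_eq', Finset.mem_univ, if_true, map_mul, eval₂_mul, eval₂_X]
    linear_combination h2

variable {R K L : Type u} [CommRing R] [Field K] [Field L] [Algebra K L]
  [Algebra.IsSeparable K L] {ι ι' κ τ : Type} [Fintype ι'] [DecidableEq ι'] [Fintype κ]

/-- Kill the relations of `a` and the square of the relations of `c`. The quotient `T` is a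
`K`-algebra and a square-zero extension of `L`, so the separable extension `L` of `K` lifts to a
section σ of T → L. By Taylor expansion, a relation is in `T` a combination of the elements δ_t = t
- σ(c_t). These vanish for the coordinates from `a`, and the invertible Jacobian expresses the
others through `h`. -/
theorem relations_le_span_of_jacobian_ne_zero {φK : R →+* K} {φ : R →+* L}
    (hφ : ∀ r, algebraMap K L (φK r) = φ r) {a : ι → K} {c : τ → L} {s : ι → τ} {s' : ι' → τ}
    (hs : ∀ i, c (s i) = algebraMap K L (a i)) (hbij : Function.Bijective (Sum.elim s s'))
    (ha : EssentiallyGenerates φK a) (hc : EssentiallyGenerates φ c)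
    {h : ι' → MvPolynomial τ R} (hh : ∀ i, h i ∈ relations φ c) (hjac : jacobian φ c s' h ≠ 0)
    [Finite ι] {g : MvPolynomial τ R} (hg : g ∈ relations φ c) :
    algebraMap _ (Localization.AtPrime (relations φ c)) g ∈
      (((relations φK a).map (rename (R := R) s).toRingHom ⊔ Ideal.span (Set.range h)) ⊔
        relations φ c ^ 2).map (algebraMap _ (Localization.AtPrime (relations φ c))) := by
  classical
  have := Fintype.ofFinite ι
  let Λ := Localization.AtPrime (relations φ c)
  let al : MvPolynomial τ R →+* Λ := algebraMap _ _
  let J : Ideal Λ := ((relations φK a).map (rename (R := R) s).toRingHom ⊔ relations φ c ^ 2).map al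
  obtain ⟨T, _, π, hπ, hπJ⟩ : ∃ (T : Type u) (_ : CommRing T) (π : Λ →+* T),
      Function.Surjective π ∧ RingHom.ker π = J :=
    ⟨Λ ⧸ J, inferInstance, Ideal.Quotient.mk J, Ideal.Quotient.mk_surjective, Ideal.mk_ker⟩
  let mk : MvPolynomial τ R →+* T := π.comp al
  have hrel : ∀ g ∈ relations φK a, mk (rename s g) = 0 := by
    intro g hg
    change al (rename s g) ∈ RingHom.ker π
    rw [hπJ]
    refine Ideal.mem_map_of_mem _ (Ideal.mem_sup_left ?_)
    exact Ideal.mem_map_of_mem (rename (R := R) s).toRingHom hg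
  have heval : ∀ g, eval₂ φ c (rename s g) = algebraMap K L (eval₂ φK a g) := by
    intro g
    rw [eval₂_rename, hom_eval₂]
    congr 1
    · ext r; simp [hφ]
    · funext i; simp [hs]
  -- the base field maps to `T`
  let mk' : MvPolynomial ι R →+* T := mk.comp (rename (R := R) s).toRingHom
  have hunit : ∀ y : (relations φK a).primeCompl, IsUnit (mk' y) := by
    intro y
    have : eval₂ φ c (rename s y.1) ≠ 0 := by
      rw [heval]
      exact (map_ne_zero _).2 fun h => y.2 h
    exact (isUnit_algebraMap_localization this).map π
  let ψ₀ : Localization.AtPrime (relations φK a) →+* T :=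
    IsLocalization.lift (M := (relations φK a).primeCompl) (P := T) (g := mk') hunit
  have hψ₀ : ∀ g, ψ₀ (algebraMap _ _ g) = mk (rename s g) := fun g => IsLocalization.lift_eq _ _
  have hker : RingHom.ker (localEval φK a) ≤ RingHom.ker ψ₀ := by
    rw [ker_localEval, ← Localization.AtPrime.map_eq_maximalIdeal, Ideal.map_le_iff_le_comap]
    intro g hg
    rw [Ideal.mem_comap, RingHom.mem_ker, hψ₀, hrel g hg]
  -- `K` is the residue field of the local ring of `a`, whose maximal ideal dies in `T`.
  let ψ : K →+* T := RingHom.liftOfSurjective _ (localEval_surjective ha) ⟨ψ₀, hker⟩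
  have hψ : ∀ g, ψ (eval₂ φK a g) = mk (rename s g) := by
    intro g
    rw [← localEval_algebraMap, ← hψ₀]
    exact congrArg (fun F : _ →+* T => F (algebraMap _ _ g))
      (RingHom.liftOfSurjective_comp _ (localEval_surjective ha) ⟨ψ₀, hker⟩)
  algebraize [ψ]
  -- evaluation on `T`
  have hJ : J ≤ RingHom.ker (localEval φ c) := by
    rw [ker_localEval]
    refine (Ideal.map_mono (sup_le ?_ (Ideal.pow_le_self two_ne_zero))).trans
      (Localization.AtPrime.map_eq_maximalIdeal (I := relations φ c)).le
    rw [Ideal.map_le_iff_le_comap]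
    intro g hg
    exact (heval g).trans (by rw [mem_relations.1 hg, map_zero])
  let ε₀ : T →+* L := RingHom.liftOfSurjective π hπ ⟨localEval φ c, hπJ.trans_le hJ⟩
  have hε₁ : ∀ z, ε₀ (π z) = localEval φ c z := fun z =>
    congrArg (fun F : _ →+* L => F z)
      (RingHom.liftOfSurjective_comp π hπ ⟨localEval φ c, hπJ.trans_le hJ⟩)
  have hε₀ : ∀ g, ε₀ (mk g) = eval₂ φ c g := fun g => (hε₁ _).trans (localEval_algebraMap _ _ _)
  let ε : T →ₐ[K] L := { ε₀ with
    commutes' := fun k => by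
      obtain ⟨z, rfl⟩ := localEval_surjective ha k
      obtain ⟨⟨p, q⟩, hp⟩ := IsLocalization.surj (relations φK a).primeCompl z
      have hq : eval₂ φK a q ≠ 0 := fun h => q.2 h
      have key : localEval φK a z = eval₂ φK a p / eval₂ φK a q := by
        rw [eq_div_iff hq, ← localEval_algebraMap φK a, ← localEval_algebraMap φK a, ← map_mul, hp]
      rw [key]
      have hF : ∀ g, (ε₀.comp ψ) (eval₂ φK a g) = algebraMap K L (eval₂ φK a g) := fun g => by
        rw [RingHom.comp_apply, hψ, hε₀, heval]
      change (ε₀.comp ψ) _ = _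
      rw [map_div₀, map_div₀, hF, hF] }
  have hεsurj : Function.Surjective ε := by
    intro z
    obtain ⟨w, rfl⟩ := localEval_surjective hc z
    exact ⟨π w, hε₁ w⟩
  have hkerε : RingHom.ker (ε : T →+* L) ^ 2 = ⊥ := by
    have h1 : RingHom.ker (ε : T →+* L) =
        (IsLocalRing.maximalIdeal Λ).map π := by
      ext x
      obtain ⟨x, rfl⟩ := hπ x
      rw [← ker_localEval, Ideal.mem_map_iff_of_surjective _ hπ]
      constructor
      · intro hx
        exact ⟨x, (hε₁ x).symm.trans hx, rfl⟩
      · rintro ⟨y, hy, hxy⟩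
        rw [← hxy]
        exact (hε₁ y).trans hy
    rw [h1, ← Ideal.map_pow, Ideal.map_eq_bot_iff_le_ker, hπJ,
      ← Localization.AtPrime.map_eq_maximalIdeal, ← Ideal.map_pow]
    exact Ideal.map_mono le_sup_right
  -- Separability enters here: a separable algebraic extension is formally étale, so the identity of
  -- `L` lifts along T → L.
  have hsm : Algebra.FormallySmooth K L :=
    (Algebra.FormallyEtale.iff_formallyUnramified_and_formallySmooth.1
      (Algebra.FormallyEtale.of_isSeparable K L)).2
  let σ : L →ₐ[K] T := Algebra.FormallySmooth.liftOfSurjective (AlgHom.id K L) ε hεsurj ⟨2, hkerε⟩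
  have hσ : ∀ z, ε (σ z) = z := fun z =>
    Algebra.FormallySmooth.liftOfSurjective_apply (AlgHom.id K L) ε hεsurj ⟨2, hkerε⟩ z
  let e : ι ⊕ ι' ≃ τ := Equiv.ofBijective _ hbij
  have : Fintype τ := Fintype.ofEquiv _ e
  let δ : τ → T := fun t => mk (X t) - σ (c t)
  have hδ : ∀ t, δ t ∈ RingHom.ker (ε : T →+* L) := by
    intro t
    have : ε (mk (X t)) = c t := (hε₀ _).trans (by simp)
    simp [δ, RingHom.mem_ker, hσ, this]
  have taylor := sub_eq_sum_pderiv_mul φ c mk (σ : L →+* T)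
    (fun r => by
      rw [← hφ]
      refine (σ.commutes _).trans ?_
      have := hψ (C r)
      rw [eval₂_C, rename_C] at this
      exact this)
    (fun t t' => by
      have : δ t * δ t' ∈ RingHom.ker (ε : T →+* L) ^ 2 := by
        rw [pow_two]
        exact Ideal.mul_mem_mul (hδ t) (hδ t')
      rw [hkerε] at this
      exact this)
  have hδs : ∀ i, δ (s i) = 0 := by
    intro i
    have := hψ (X i)
    rw [eval₂_X, rename_X] at this
    simp only [δ, hs]
    rw [σ.commutes, ← this]
    exact sub_self _
  have taylor' : ∀ g ∈ relations φ c,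
      mk g = ∑ i, σ (eval₂ φ c (pderiv (s' i) g)) * δ (s' i) := by
    intro g hg
    have := taylor g
    rw [mem_relations.1 hg, map_zero, sub_zero, ← e.sum_comp, Fintype.sum_sum_type] at this
    rw [this, Finset.sum_eq_zero, zero_add]
    · rfl
    · intro i _
      change _ * δ (s i) = 0
      rw [hδs, mul_zero]
  let N : Matrix ι' ι' L := Matrix.of fun i j => eval₂ φ c (pderiv (s' i) (h j))
  have hN : N * N⁻¹ = 1 := Matrix.mul_nonsing_inv _ (isUnit_iff_ne_zero.2 hjac)
  have hδspan : ∀ i, δ (s' i) ∈ Ideal.span (Set.range fun j => mk (h j)) := by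
    intro i
    have : δ (s' i) = ∑ j, σ (N⁻¹ j i) * mk (h j) := by
      simp_rw [taylor' _ (hh _), Finset.mul_sum]
      rw [Finset.sum_comm]
      have : ∀ k, ∑ j, σ (N⁻¹ j i) * (σ (eval₂ φ c (pderiv (s' k) (h j))) * δ (s' k)) =
          σ ((N * N⁻¹) k i) * δ (s' k) := by
        intro k
        rw [Matrix.mul_apply, map_sum, Finset.sum_mul]
        refine Finset.sum_congr rfl fun j _ => ?_
        rw [map_mul]
        simp only [N, Matrix.of_apply]
        ring
      simp [this, hN, Matrix.one_apply]
    rw [this]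
    exact Ideal.sum_mem _ fun j _ => Ideal.mul_mem_left _ _ (Ideal.subset_span ⟨j, rfl⟩)
  have hmem : mk g ∈ Ideal.span (Set.range fun j => mk (h j)) := by
    rw [taylor' g hg]
    exact Ideal.sum_mem _ fun i _ => Ideal.mul_mem_left _ _ (hδspan i)
  have hspan : Ideal.span (Set.range fun j => mk (h j)) =
      ((Ideal.span (Set.range h)).map al).map π := by
    rw [Ideal.map_map, Ideal.map_span, ← Set.range_comp]
    rfl
  rw [hspan] at hmem
  have : al g ∈ ((Ideal.span (Set.range h)).map al) ⊔ J := by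
    have := Ideal.comap_map_of_surjective' π hπ ((Ideal.span (Set.range h)).map al)
    rw [← hπJ, ← this]
    exact hmem
  rw [← Ideal.map_sup] at this
  refine Ideal.map_mono ?_ this
  rw [sup_comm (Ideal.span _), sup_assoc, sup_assoc, sup_comm (Ideal.span _)]

end Span

end QuotientRamification

namespace QuotientRamification

open MvPolynomial

/-! ### Independence of conormal vectors under a separable extension -/

section Independence

lemma sup_sq_le {S : Type*} [CommRing S] (I J : Ideal S) : (I ⊔ J) ^ 2 ≤ I ^ 2 ⊔ J := by
  have h1 : I * J ≤ I ^ 2 ⊔ J :=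
    Ideal.mul_le.2 fun _ _ s hs => Ideal.mem_sup_right (J.mul_mem_left _ hs)
  have h2 : J * (I ⊔ J) ≤ I ^ 2 ⊔ J :=
    Ideal.mul_le.2 fun _ hr s _ => Ideal.mem_sup_right (J.mul_mem_right s hr)
  have h3 : I * I ≤ I ^ 2 ⊔ J := by
    rw [← pow_two]
    exact le_sup_left
  calc (I ⊔ J) ^ 2 = (I * I ⊔ I * J) ⊔ J * (I ⊔ J) := by
        rw [pow_two, Ideal.sup_mul, Ideal.mul_sup]
    _ ≤ _ := sup_le (sup_le h3 h1) h2

lemma localEval_eq_zero_of_sum_mul_mem {R K : Type u} [CommRing R] [Field K] {ι κ : Type}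
    [Fintype κ] {φ : R →+* K} {a : ι → K} {f : κ → MvPolynomial ι R}
    (hf : ∀ c : κ → MvPolynomial ι R, ∑ j, c j * f j ∈ relations φ a ^ 2 →
      ∀ j, eval₂ φ a (c j) = 0)
    {x : κ → Localization.AtPrime (relations φ a)}
    (hx : ∑ j, x j * algebraMap _ _ (f j) ∈ IsLocalRing.maximalIdeal
      (Localization.AtPrime (relations φ a)) ^ 2) (j : κ) : localEval φ a (x j) = 0 := by
  obtain ⟨b, hb⟩ := IsLocalization.exist_integer_multiples_of_finite (relations φ a).primeCompl x
  choose p hp using hb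
  have hb0 : eval₂ φ a b.1 ≠ 0 := fun h => b.2 h
  have h1 : algebraMap _ (Localization.AtPrime (relations φ a)) (∑ j, p j * f j) ∈
      (relations φ a ^ 2).map (algebraMap _ (Localization.AtPrime (relations φ a))) := by
    rw [Ideal.map_pow, Localization.AtPrime.map_eq_maximalIdeal, map_sum]
    have : ∑ j, algebraMap _ (Localization.AtPrime (relations φ a)) (p j * f j) =
        algebraMap _ _ b.1 * ∑ j, x j * algebraMap _ _ (f j) := by
      rw [Finset.mul_sum]
      refine Finset.sum_congr rfl fun j _ => ?_
      rw [map_mul, hp, Algebra.smul_def]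
      ring
    rw [this]
    exact Ideal.mul_mem_left _ _ hx
  obtain ⟨q, hq, hmem⟩ := mem_map_relations_iff.1 h1
  rw [Finset.mul_sum] at hmem
  simp only [← mul_assoc] at hmem
  have h2 := hf _ hmem j
  rw [eval₂_mul] at h2
  have h3 : eval₂ φ a (p j) = 0 := (mul_eq_zero.1 h2).resolve_left hq
  rw [← localEval_algebraMap, hp, Algebra.smul_def, map_mul, localEval_algebraMap] at h3
  exact (mul_eq_zero.1 h3).resolve_left hb0

variable {R K L : Type u} [CommRing R] [Field K] [Field L] [Algebra K L] [FiniteDimensional K L]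
  [Algebra.IsSeparable K L] {ι κ τ : Type} [Fintype κ]

-- Write L = K(θ) and lift the minimal polynomial of θ to a monic `h` over Λ. The kernel of Λ[X] → L
-- is contained in (𝔪, h), so its square lies in (𝔪², h). Reduction modulo `h` turns the given
-- relation into one relation over Λ for each coefficient, and independence over `K` applies to each
-- of them.
open Polynomial in
lemma eval₂_eq_zero_of_sum_mul_rename_mem_aux {Λ : Type u} [CommRing Λ] {φK : R →+* K} {φ : R →+* L}
    (hφ : ∀ r, algebraMap K L (φK r) = φ r) {a : ι → K} {c : τ → L} {s : ι → τ}
    (hs : ∀ i, c (s i) = algebraMap K L (a i)) (hinj : Function.Injective s)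
    {ev : Λ →+* K} (hev : Function.Surjective ev)
    {al : MvPolynomial ι R →+* Λ} (hal : ∀ g, ev (al g) = MvPolynomial.eval₂ φK a g)
    {f : κ → MvPolynomial ι R}
    (hf : ∀ x : κ → Λ, ∑ j, x j * al (f j) ∈ RingHom.ker ev ^ 2 → ∀ j, ev (x j) = 0)
    {d : κ → MvPolynomial τ R} (hd : ∑ j, d j * rename s (f j) ∈ relations φ c ^ 2) (j : κ) :
    MvPolynomial.eval₂ φ c (d j) = 0 := by
  classical
  let 𝔪 := RingHom.ker ev
  let pb := Field.powerBasisOfFiniteOfSeparable K L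
  let θ := pb.gen
  let μ := minpoly K θ
  have hμ : μ.Monic := minpoly.monic (Algebra.IsIntegral.isIntegral θ)
  obtain ⟨h, hh, -, hmon⟩ := Polynomial.lifts_and_degree_eq_and_monic
    (Polynomial.map_surjective ev hev μ |>.imp fun _ h => h : μ ∈ lifts ev) hμ
  have hlift : ∀ z : L, ∃ B : Λ[X], aeval θ (B.map ev) = z := by
    intro z
    obtain ⟨q, hq⟩ := pb.exists_eq_aeval' z
    obtain ⟨B, rfl⟩ := Polynomial.map_surjective ev hev q
    exact ⟨B, hq.symm⟩
  choose B hB using hlift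
  let evX : Λ[X] →+* L := (aeval θ : K[X] →ₐ[K] L).toRingHom.comp (mapRingHom ev)
  -- Coordinates from `a` become constants of Λ; each other coordinate becomes a lift of an
  -- expression of its value as a polynomial in θ.
  let ψ : MvPolynomial τ R →+* Λ[X] := eval₂Hom ((Polynomial.C).comp (al.comp MvPolynomial.C))
    fun t => if ht : ∃ i, s i = t then Polynomial.C (al (MvPolynomial.X ht.choose)) else B (c t)
  have hψs : ∀ g, ψ (rename s g) = Polynomial.C (al g) := by
    intro g
    induction g using MvPolynomial.induction_on with
    | C r => simp [ψ]
    | add p q hp hq => simp [hp, hq]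
    | mul_X p i hp =>
      have hex : ∃ i', s i' = s i := ⟨i, rfl⟩
      have : hex.choose = i := hinj hex.choose_spec
      rw [map_mul, map_mul, hp, map_mul, map_mul]
      congr 1
      simp [ψ, this]
  have hevX : ∀ g, evX (ψ g) = MvPolynomial.eval₂ φ c g := by
    intro g
    have : evX.comp ψ = eval₂Hom φ c := by
      refine MvPolynomial.ringHom_ext (fun r => ?_) (fun t => ?_)
      · have : ev (al (MvPolynomial.C r)) = φK r := by simp [hal]
        simp [evX, ψ, this, hφ]
      · by_cases ht : ∃ i, s i = t
        · have h1 : c t = algebraMap K L (a ht.choose) := by rw [← hs, ht.choose_spec]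
          simp only [RingHom.comp_apply, ψ, coe_eval₂Hom, MvPolynomial.eval₂_X, dif_pos ht]
          have h2 : ev (al (MvPolynomial.X ht.choose)) = a ht.choose := by simp [hal]
          simp [evX, h2, h1]
        · simp only [RingHom.comp_apply, ψ, coe_eval₂Hom, MvPolynomial.eval₂_X, dif_neg ht]
          exact hB _
    exact congrArg (fun F : _ →+* L => F g) this
  have hmodC : ∀ (I : Ideal Λ) (u : Λ[X]), u ∈ I.map Polynomial.C →
      u %ₘ h ∈ I.map Polynomial.C := by
    intro I u hu
    rw [← Ideal.mk_ker (I := I), ← Polynomial.ker_mapRingHom, RingHom.mem_ker,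
      coe_mapRingHom] at hu ⊢
    rw [Polynomial.map_modByMonic _ hmon, hu, Polynomial.zero_modByMonic]
  have hkerX : RingHom.ker evX ≤ 𝔪.map Polynomial.C ⊔ Ideal.span {h} := by
    intro g hg
    have h1 : μ ∣ g.map ev := minpoly.dvd K θ hg
    have h2 : g %ₘ h ∈ 𝔪.map Polynomial.C := by
      rw [Ideal.mem_map_C_iff]
      intro n
      rw [RingHom.mem_ker, ← Polynomial.coeff_map, Polynomial.map_modByMonic _ hmon, hh,
        (Polynomial.modByMonic_eq_zero_iff_dvd hμ).2 h1, Polynomial.coeff_zero]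
    rw [← Polynomial.modByMonic_add_div g h]
    exact add_mem (Ideal.mem_sup_left h2)
      (Ideal.mem_sup_right (Ideal.mul_mem_right _ _ (Ideal.mem_span_singleton_self h)))
  have hsq : ∀ x ∈ RingHom.ker evX ^ 2, x %ₘ h ∈ (𝔪 ^ 2).map Polynomial.C := by
    intro x hx
    have hle : RingHom.ker evX ^ 2 ≤ (𝔪 ^ 2).map Polynomial.C ⊔ Ideal.span {h} := by
      refine (Ideal.pow_right_mono hkerX 2).trans ?_
      rw [Ideal.map_pow]
      exact sup_sq_le _ _
    obtain ⟨u, hu, v, hv, rfl⟩ := Submodule.mem_sup.1 (hle hx)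
    rw [Polynomial.add_modByMonic, (Polynomial.modByMonic_eq_zero_iff_dvd hmon).2
      (Ideal.mem_span_singleton.1 hv), add_zero]
    exact hmodC _ _ hu
  have hmem : ψ (∑ j, d j * rename s (f j)) ∈ RingHom.ker evX ^ 2 := by
    have : (relations φ c).map ψ ≤ RingHom.ker evX := by
      rw [Ideal.map_le_iff_le_comap]
      intro g hg
      exact (hevX g).trans hg
    exact Ideal.pow_right_mono this 2 (by rw [← Ideal.map_pow]; exact Ideal.mem_map_of_mem ψ hd)
  have hcoef : ∀ n j, ev ((ψ (d j) %ₘ h).coeff n) = 0 := by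
    intro n
    refine hf _ ?_
    have h1 := (Ideal.mem_map_C_iff.1 (hsq _ hmem)) n
    have h2 : (ψ (∑ j, d j * rename s (f j)) %ₘ h).coeff n =
        ∑ j, (ψ (d j) %ₘ h).coeff n * al (f j) := by
      have : ψ (∑ j, d j * rename s (f j)) = ∑ j, al (f j) • ψ (d j) := by
        rw [map_sum]
        refine Finset.sum_congr rfl fun j _ => ?_
        rw [map_mul, hψs, mul_comm, Polynomial.smul_eq_C_mul]
      rw [this, ← Polynomial.modByMonicHom_apply, map_sum, Polynomial.finsetSum_coeff]
      refine Finset.sum_congr rfl fun j _ => ?_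
      rw [map_smul, Polynomial.coeff_smul, smul_eq_mul, mul_comm, Polynomial.modByMonicHom_apply]
    rw [h2] at h1
    exact h1
  rw [← hevX, ← Polynomial.modByMonic_add_div (ψ (d j)) h, map_add, map_mul]
  have h1 : evX h = 0 := by
    change aeval θ (h.map ev) = 0
    rw [hh]
    exact minpoly.aeval K θ
  have h2 : evX (ψ (d j) %ₘ h) = 0 := by
    change aeval θ ((ψ (d j) %ₘ h).map ev) = 0
    have : (ψ (d j) %ₘ h).map ev = 0 := by
      ext n
      rw [Polynomial.coeff_map, hcoef, Polynomial.coeff_zero]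
    rw [this, map_zero]
  rw [h1, h2, zero_mul, add_zero]

theorem eval₂_eq_zero_of_sum_mul_rename_mem {φK : R →+* K} {φ : R →+* L}
    (hφ : ∀ r, algebraMap K L (φK r) = φ r) {a : ι → K} {c : τ → L} {s : ι → τ}
    (hs : ∀ i, c (s i) = algebraMap K L (a i)) (hinj : Function.Injective s)
    (ha : EssentiallyGenerates φK a) {f : κ → MvPolynomial ι R}
    (hf : ∀ c : κ → MvPolynomial ι R, ∑ j, c j * f j ∈ relations φK a ^ 2 →
      ∀ j, eval₂ φK a (c j) = 0)
    {d : κ → MvPolynomial τ R} (hd : ∑ j, d j * rename s (f j) ∈ relations φ c ^ 2) (j : κ) :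
    eval₂ φ c (d j) = 0 :=
  eval₂_eq_zero_of_sum_mul_rename_mem_aux hφ hs hinj (localEval_surjective ha)
    (localEval_algebraMap φK a)
    (fun _ hx => localEval_eq_zero_of_sum_mul_mem hf (by rwa [ker_localEval] at hx)) hd j

end Independence

end QuotientRamification

namespace QuotientRamification

open MvPolynomial

/-! ### Equality up to sign -/

section Sign

/-- Equality up to sign. -/
def EqUpToSign {A : Type*} [Ring A] (x y : A) : Prop := x = y ∨ x = -y

namespace EqUpToSign

variable {A : Type*} [Ring A] {x y z w : A}

lemma rfl' : EqUpToSign x x := Or.inl rfl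

lemma symm (h : EqUpToSign x y) : EqUpToSign y x := by
  rcases h with h | h <;> simp [EqUpToSign, h]

lemma trans (h : EqUpToSign x y) (h' : EqUpToSign y z) : EqUpToSign x z := by
  rcases h with rfl | rfl <;> rcases h' with rfl | rfl <;> simp [EqUpToSign]

lemma mul (h : EqUpToSign x y) (h' : EqUpToSign z w) : EqUpToSign (x * z) (y * w) := by
  rcases h with rfl | rfl <;> rcases h' with rfl | rfl <;> simp [EqUpToSign]

lemma of_mul_right {A : Type*} [CommRing A] [IsDomain A] {x y z : A} (hz : z ≠ 0)
    (h : EqUpToSign (x * z) (y * z)) : EqUpToSign x y := by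
  rcases h with h | h
  · exact Or.inl (mul_right_cancel₀ hz h)
  · exact Or.inr (mul_right_cancel₀ hz (by rw [h, neg_mul]))

end EqUpToSign

lemma eqUpToSign_det_submatrix {A m n : Type*} [CommRing A] [Fintype m] [DecidableEq m] [Fintype n]
    [DecidableEq n] (M : Matrix m m A) (e₁ e₂ : n ≃ m) :
    EqUpToSign (M.submatrix e₁ e₂).det M.det := by
  have h : M.submatrix e₁ e₂ = (M.submatrix (e₂.symm.trans e₁) id).submatrix e₂ e₂ := by
    ext i j
    simp
  rw [h, Matrix.det_submatrix_equiv_self, Matrix.det_permute]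
  rcases Int.units_eq_one_or (Equiv.Perm.sign (e₂.symm.trans e₁)) with h | h <;>
  simp [h, EqUpToSign]

end Sign

/-! ### Functionals and volume forms on the conormal space -/

section Functional

variable {R L : Type u} [CommRing R] [Field L] {τ : Type}

/-- `D` restricts to a linear functional on the conormal space of the tuple `c`. -/
structure IsConormalFunctional (φ : R →+* L) (c : τ → L) (D : MvPolynomial τ R → L) : Prop where
  add : ∀ g ∈ relations φ c, ∀ g' ∈ relations φ c, D (g + g') = D g + D g'
  mul : ∀ u, ∀ g ∈ relations φ c, D (u * g) = eval₂ φ c u * D g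

namespace IsConormalFunctional

variable {φ : R →+* L} {c : τ → L} {D : MvPolynomial τ R → L}

lemma map_zero (hD : IsConormalFunctional φ c D) : D 0 = 0 := by
  simpa using hD.mul 0 0 (zero_mem _)

lemma map_sum_mul (hD : IsConormalFunctional φ c D) {ι : Type*} (s : Finset ι)
    (u g : ι → MvPolynomial τ R) (hg : ∀ i, g i ∈ relations φ c) :
    D (∑ i ∈ s, u i * g i) = ∑ i ∈ s, eval₂ φ c (u i) * D (g i) := by
  classical
  induction s using Finset.induction_on with
  | empty => simp [hD.map_zero]
  | insert i s hi ih =>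
    rw [Finset.sum_insert hi, Finset.sum_insert hi, hD.add _ (Ideal.mul_mem_left _ _ (hg i)) _
      (Ideal.sum_mem _ fun j _ => Ideal.mul_mem_left _ _ (hg j)), hD.mul _ _ (hg i), ih]

lemma map_sq (hD : IsConormalFunctional φ c D) {g : MvPolynomial τ R}
    (hg : g ∈ relations φ c ^ 2) : D g = 0 := by
  have hle : relations φ c ^ 2 ≤ relations φ c := Ideal.pow_le_self two_ne_zero
  suffices g ∈ relations φ c ∧ D g = 0 from this.2
  rw [pow_two] at hg
  refine Submodule.mul_induction_on hg (fun x hx y hy => ?_) (fun x y hx hy => ?_)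
  · refine ⟨Ideal.mul_mem_left _ _ hy, ?_⟩
    rw [hD.mul _ _ hy, mem_relations.1 hx, zero_mul]
  · refine ⟨add_mem hx.1 hy.1, ?_⟩
    rw [hD.add _ hx.1 _ hy.1, hx.2, hy.2, add_zero]

lemma map_congr (hD : IsConormalFunctional φ c D) {g g' : MvPolynomial τ R}
    (hg' : g' ∈ relations φ c) (h : g - g' ∈ relations φ c ^ 2) : D g = D g' := by
  have hle : relations φ c ^ 2 ≤ relations φ c := Ideal.pow_le_self two_ne_zero
  have := hD.add _ (hle h) _ hg'
  rw [sub_add_cancel, hD.map_sq h, zero_add] at this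
  exact this

end IsConormalFunctional

lemma isConormalFunctional_pderiv (φ : R →+* L) (c : τ → L) (t : τ) :
    IsConormalFunctional φ c fun g => eval₂ φ c (pderiv t g) where
  add g _ g' _ := by simp
  mul u g hg := by
    rw [Derivation.leibniz]
    simp [mem_relations.1 hg]

/-- A conormal frame has a dual family of functionals. -/
lemma IsConormalFrame.exists_dual {φ : R →+* L} {c : τ → L} {κ : Type} [Fintype κ] [DecidableEq κ]
    {f : κ → MvPolynomial τ R} (hf : IsConormalFrame φ c f) :
    ∃ D : κ → MvPolynomial τ R → L, (∀ i, IsConormalFunctional φ c (D i)) ∧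
      ∀ i j, D i (f j) = if i = j then 1 else 0 := by
  classical
  have key : ∀ g ∈ relations φ c, ∃ (q : MvPolynomial τ R) (d : κ → MvPolynomial τ R),
      eval₂ φ c q ≠ 0 ∧ q * g - ∑ j, d j * f j ∈ relations φ c ^ 2 := by
    intro g hg
    obtain ⟨q, hq, hmem⟩ := hf.span g hg
    obtain ⟨x, hx, y, hy, hxy⟩ := Submodule.mem_sup.1 hmem
    obtain ⟨d, hd⟩ := Ideal.mem_span_range_iff_exists_fun.1 hx
    refine ⟨q, d, hq.ne_zero, ?_⟩
    rw [hd, ← hxy, add_sub_cancel_left]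
    exact hy
  choose! q d hq hd using key
  -- The coordinates of `g` in the frame are the quotients d/q. By independence of the frame they do
  -- not depend on the choice of `d` and `q` (`huniq`), and this makes them linear.
  let D : κ → MvPolynomial τ R → L := fun i g => eval₂ φ c (d g i) / eval₂ φ c (q g)
  have huniq : ∀ g ∈ relations φ c, ∀ (q' : MvPolynomial τ R) (d' : κ → MvPolynomial τ R),
      q' * g - ∑ j, d' j * f j ∈ relations φ c ^ 2 →
      ∀ i, eval₂ φ c q' * D i g = eval₂ φ c (d' i) := by
    intro g hg q' d' h' i
    have h1 : ∑ j, (q' * d g j - q g * d' j) * f j ∈ relations φ c ^ 2 := by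
      have : ∑ j, (q' * d g j - q g * d' j) * f j =
          q g * (q' * g - ∑ j, d' j * f j) - q' * (q g * g - ∑ j, d g j * f j) := by
        simp only [mul_sub, sub_mul, Finset.sum_sub_distrib, Finset.mul_sum, mul_assoc]
        ring
      rw [this]
      exact sub_mem (Ideal.mul_mem_left _ _ h') (Ideal.mul_mem_left _ _ (hd g hg))
    have h2 := hf.indep _ h1 i
    rw [eval₂_sub, eval₂_mul, eval₂_mul, sub_eq_zero] at h2
    simp only [D]
    rw [← mul_div_assoc, h2, mul_comm, mul_div_assoc, div_self (hq g hg), mul_one]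
  refine ⟨D, fun i => ⟨fun g hg g' hg' => ?_, fun u g hg => ?_⟩, fun i j => ?_⟩
  · have h1 : q g * q g' * (g + g') - ∑ j, (q g' * d g j + q g * d g' j) * f j ∈
        relations φ c ^ 2 := by
      have : q g * q g' * (g + g') - ∑ j, (q g' * d g j + q g * d g' j) * f j =
          q g' * (q g * g - ∑ j, d g j * f j) + q g * (q g' * g' - ∑ j, d g' j * f j) := by
        simp only [mul_sub, add_mul, Finset.sum_add_distrib, Finset.mul_sum, mul_assoc]
        ring
      rw [this]
      exact add_mem (Ideal.mul_mem_left _ _ (hd g hg)) (Ideal.mul_mem_left _ _ (hd g' hg'))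
    have h2 := huniq _ (add_mem hg hg') _ _ h1 i
    rw [eval₂_mul, eval₂_add, eval₂_mul, eval₂_mul] at h2
    simp only [D] at h2 ⊢
    have := hq g hg
    have := hq g' hg'
    field_simp
    field_simp at h2
    linear_combination h2
  · have h1 : q g * (u * g) - ∑ j, (u * d g j) * f j ∈ relations φ c ^ 2 := by
      have : q g * (u * g) - ∑ j, (u * d g j) * f j = u * (q g * g - ∑ j, d g j * f j) := by
        simp only [mul_sub, Finset.mul_sum, mul_assoc]
        ring
      rw [this]
      exact Ideal.mul_mem_left _ _ (hd g hg)
    have h2 := huniq _ (Ideal.mul_mem_left _ u hg) _ _ h1 i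
    rw [eval₂_mul] at h2
    have := hq g hg
    simp only [D] at h2 ⊢
    field_simp
    field_simp at h2
    linear_combination h2
  · have h1 : 1 * f j - ∑ j', (if j' = j then 1 else 0) * f j' ∈ relations φ c ^ 2 := by simp
    have h2 := huniq _ (hf.mem j) _ _ h1 i
    rw [eval₂_one, one_mul] at h2
    rw [h2]
    split_ifs <;> simp

/-- `W` is a basis of the dual of the conormal space of the tuple `c`. -/
structure IsDualBasis (φ : R →+* L) (c : τ → L) {m : Type} [Fintype m] [DecidableEq m]
    (W : m → MvPolynomial τ R → L) : Prop where
  functional : ∀ i, IsConormalFunctional φ c (W i)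
  gen : ∀ D, IsConormalFunctional φ c D → ∃ l : m → L, ∀ g ∈ relations φ c, D g = ∑ i, l i * W i g
  sep : ∃ u : m → MvPolynomial τ R, (∀ j, u j ∈ relations φ c) ∧
    (Matrix.of fun i j => W i (u j)).det ≠ 0

/-- A functional is determined by its values on the frame, and the invertible matrix of values `W i
(F j)` realizes any prescribed values by a combination of the `W i`. -/
lemma IsConormalFrame.isDualBasis {φ : R →+* L} {c : τ → L} {m : Type} [Fintype m] [DecidableEq m]
    {F : m → MvPolynomial τ R} (hF : IsConormalFrame φ c F) {W : m → MvPolynomial τ R → L}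
    (hW : ∀ i, IsConormalFunctional φ c (W i)) (hdet : (Matrix.of fun i j => W i (F j)).det ≠ 0) :
    IsDualBasis φ c W where
  functional := hW
  sep := ⟨F, hF.mem, hdet⟩
  gen D hD := by
    let N : Matrix m m L := Matrix.of fun i j => W i (F j)
    have hN : N⁻¹ * N = 1 := Matrix.nonsing_inv_mul _ (isUnit_iff_ne_zero.2 hdet)
    let l : m → L := Matrix.vecMul (fun j => D (F j)) N⁻¹
    have hl : ∀ j, D (F j) = ∑ i, l i * W i (F j) := by
      intro j
      have : Matrix.vecMul l N = fun j => D (F j) := by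
        rw [Matrix.vecMul_vecMul, hN, Matrix.vecMul_one]
      exact (congrFun this j).symm
    refine ⟨l, fun g hg => ?_⟩
    obtain ⟨q, hq, hmem⟩ := hF.span g hg
    obtain ⟨x, hx, y, hy, hxy⟩ := Submodule.mem_sup.1 hmem
    obtain ⟨d, rfl⟩ := Ideal.mem_span_range_iff_exists_fun.1 hx
    have h1 : ∀ D', IsConormalFunctional φ c D' →
        eval₂ φ c q * D' g = ∑ j, eval₂ φ c (d j) * D' (F j) := by
      intro D' hD'
      rw [← hD'.mul _ _ hg, ← hD'.map_sum_mul _ _ _ hF.mem]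
      refine hD'.map_congr (Ideal.sum_mem _ fun j _ => Ideal.mul_mem_left _ _ (hF.mem j)) ?_
      rw [← hxy, add_sub_cancel_left]
      exact hy
    refine mul_left_cancel₀ hq.ne_zero ?_
    rw [h1 D hD, Finset.mul_sum]
    simp_rw [mul_left_comm _ (l _), h1 _ (hW _), hl, Finset.mul_sum]
    rw [Finset.sum_comm]
    exact Finset.sum_congr rfl fun _ _ => Finset.sum_congr rfl fun _ _ => by ring

variable {φ : R →+* L} {c : τ → L} {m m' : Type} [Fintype m] [DecidableEq m] [Fintype m']
  [DecidableEq m']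

omit [Fintype m'] [DecidableEq m'] in
lemma IsDualBasis.exists_matrix {W : m → MvPolynomial τ R → L} (hW : IsDualBasis φ c W)
    {W' : m' → MvPolynomial τ R → L} (hW' : ∀ i, IsConormalFunctional φ c (W' i)) :
    ∃ T : Matrix m' m L, ∀ i, ∀ g ∈ relations φ c, W' i g = ∑ j, T i j * W j g := by
  choose l hl using fun i => hW.gen (W' i) (hW' i)
  exact ⟨Matrix.of l, hl⟩

lemma IsDualBasis.matrix_eq_one {W : m → MvPolynomial τ R → L} (hW : IsDualBasis φ c W)
    {T : Matrix m m L} (hT : ∀ i, ∀ g ∈ relations φ c, W i g = ∑ j, T i j * W j g) : T = 1 := by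
  obtain ⟨u, hu, hdet⟩ := hW.sep
  let N : Matrix m m L := Matrix.of fun i j => W i (u j)
  have hN : N * N⁻¹ = 1 := Matrix.mul_nonsing_inv _ (isUnit_iff_ne_zero.2 hdet)
  have h : T * N = N := by
    ext i j
    rw [Matrix.mul_apply]
    exact (hT i _ (hu j)).symm
  calc T = T * N * N⁻¹ := by rw [Matrix.mul_assoc, hN, Matrix.mul_one]
    _ = 1 := by rw [h, hN]

/-- The two change-of-basis matrices are inverse to each other by `matrix_eq_one`, hence square.
Index types of two frames can then be matched by a bijection. -/
lemma IsDualBasis.card_eq {W : m → MvPolynomial τ R → L} (hW : IsDualBasis φ c W)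
    {W' : m' → MvPolynomial τ R → L} (hW' : IsDualBasis φ c W') :
    Fintype.card m = Fintype.card m' := by
  obtain ⟨T, hT⟩ := hW.exists_matrix hW'.functional
  obtain ⟨T', hT'⟩ := hW'.exists_matrix hW.functional
  have key : ∀ {n n' : Type} [Fintype n] [Fintype n'] (V : n → MvPolynomial τ R → L)
      (V' : n' → MvPolynomial τ R → L) (S : Matrix n' n L) (S' : Matrix n n' L),
      (∀ i, ∀ g ∈ relations φ c, V' i g = ∑ j, S i j * V j g) →
      (∀ i, ∀ g ∈ relations φ c, V i g = ∑ j, S' i j * V' j g) →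
      ∀ i, ∀ g ∈ relations φ c, V i g = ∑ j, (S' * S) i j * V j g := by
    intro n n' _ _ V V' S S' h h' i g hg
    rw [h' i g hg]
    simp_rw [h _ g hg, Matrix.mul_apply, Finset.sum_mul, Finset.mul_sum]
    rw [Finset.sum_comm]
    exact Finset.sum_congr rfl fun _ _ => Finset.sum_congr rfl fun _ _ => by ring
  exact Matrix.square_of_invertible T' T (hW.matrix_eq_one (key _ _ _ _ hT hT'))
    (hW'.matrix_eq_one (key _ _ _ _ hT' hT))

/-- The multilinear form defined by a family of functionals transforms by the determinant. -/
lemma det_functional_eq_of_sub_mem {W : m → MvPolynomial τ R → L}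
    (hW : ∀ i, IsConormalFunctional φ c (W i)) {u v : m → MvPolynomial τ R}
    (hu : ∀ j, u j ∈ relations φ c) (hv : ∀ j, v j ∈ relations φ c) {q : MvPolynomial τ R}
    {M : Matrix m m (MvPolynomial τ R)}
    (h : ∀ i, q * v i - ∑ j, M i j * u j ∈ relations φ c ^ 2) :
    eval₂ φ c q ^ Fintype.card m * (Matrix.of fun i j => W i (v j)).det =
      (M.map (eval₂ φ c)).det * (Matrix.of fun i j => W i (u j)).det := by
  rw [← Matrix.det_smul, ← Matrix.det_transpose (M.map _), mul_comm, ← Matrix.det_mul]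
  congr 1
  ext i j
  rw [Matrix.smul_apply, Matrix.mul_apply, Matrix.of_apply, smul_eq_mul,
    ← (hW i).mul _ _ (hv j), (hW i).map_congr (Ideal.sum_mem _ fun k _ =>
      Ideal.mul_mem_left _ _ (hu k)) (h j), (hW i).map_sum_mul _ _ _ hu]
  exact Finset.sum_congr rfl fun k _ => by simp [mul_comm]

end Functional

end QuotientRamification

namespace QuotientRamification

open MvPolynomial

/-! ### Extending a conormal frame along a separable extension -/

section FrameExtension

variable {R K L : Type u} [CommRing R] [Field K] [Field L] [Algebra K L]

lemma eval₂_pderiv_rename_eq_zero {ι ι' τ : Type} {φ : R →+* L} {c : τ → L} {s : ι → τ} {s' : ι' → τ}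
    (hbij : Function.Bijective (Sum.elim s s')) (i : ι') (g : MvPolynomial ι R) :
    eval₂ φ c (pderiv (s' i) (rename s g)) = 0 := by
  refine eval₂_pderiv_rename_of_notMem_range ?_ g
  rintro ⟨j, hj⟩
  have : (Sum.elim s s') (Sum.inl j) = (Sum.elim s s') (Sum.inr i) := hj
  exact absurd (hbij.1 this) (by simp)

/-- The conormal frame of the tuple `c` obtained from a conormal frame of the subtuple `a`, which
generates a subfield of finite separable degree. -/
theorem IsConormalFrame.extend [FiniteDimensional K L] [Algebra.IsSeparable K L]
    {ι ι' κ τ : Type} [Finite ι] [Fintype ι'] [DecidableEq ι'] [Fintype κ]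
    {φK : R →+* K} {φ : R →+* L}
    (hφ : ∀ r, algebraMap K L (φK r) = φ r) {a : ι → K} {c : τ → L} {s : ι → τ} {s' : ι' → τ}
    (hs : ∀ i, c (s i) = algebraMap K L (a i)) (hbij : Function.Bijective (Sum.elim s s'))
    (ha : EssentiallyGenerates φK a) (hc : EssentiallyGenerates φ c)
    {f : κ → MvPolynomial ι R} (hf : IsConormalFrame φK a f)
    {h : ι' → MvPolynomial τ R} (hh : ∀ i, h i ∈ relations φ c) (hjac : jacobian φ c s' h ≠ 0) :
    IsConormalFrame φ c (Sum.elim (fun j => rename s (f j)) h) := by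
  classical
  have hs' : ∀ g ∈ relations φK a, rename s g ∈ relations φ c := by
    intro g hg
    rw [mem_relations, eval₂_rename]
    have : eval₂ φ (c ∘ s) g = algebraMap K L (eval₂ φK a g) := by
      rw [hom_eval₂]
      congr 1
      · ext r; simp [hφ]
      · funext i; simp [hs]
    rw [this, mem_relations.1 hg, map_zero]
  refine ⟨?_, ?_, ?_⟩
  · rintro (j | j)
    · exact hs' _ (hf.mem j)
    · exact hh j
  · intro g hg
    have h1 := relations_le_span_of_jacobian_ne_zero hφ hs hbij ha hc hh hjac hg
    have hle : ((relations φK a).map (rename (R := R) s).toRingHom ⊔ Ideal.span (Set.range h)) ⊔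
        relations φ c ^ 2 ≤ ((Ideal.span (Set.range (Sum.elim (fun j => rename s (f j)) h)) ⊔
          relations φ c ^ 2).map (algebraMap _ (Localization.AtPrime (relations φ c)))).comap
          (algebraMap _ (Localization.AtPrime (relations φ c))) := by
      refine sup_le (sup_le ?_ ?_) ?_
      · rw [Ideal.map_le_iff_le_comap]
        intro u hu
        obtain ⟨q, hq, hmem⟩ := hf.span u hu
        refine Ideal.mem_comap.2 (mem_map_relations_iff.2 ⟨rename s q, ?_, ?_⟩)
        · rw [eval₂_rename]
          have : eval₂ φ (c ∘ s) q = algebraMap K L (eval₂ φK a q) := by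
            rw [hom_eval₂]
            congr 1
            · ext r; simp [hφ]
            · funext i; simp [hs]
          rw [this]
          simpa using hq.ne_zero
        · change _ * rename s u ∈ _
          rw [← map_mul]
          obtain ⟨x, hx, y, hy, hxy⟩ := Submodule.mem_sup.1 hmem
          rw [← hxy, map_add]
          refine add_mem (Ideal.mem_sup_left ?_) (Ideal.mem_sup_right ?_)
          · obtain ⟨d, rfl⟩ := Ideal.mem_span_range_iff_exists_fun.1 hx
            rw [map_sum]
            refine Ideal.sum_mem _ fun j _ => ?_
            rw [map_mul]
            exact Ideal.mul_mem_left _ _ (Ideal.subset_span ⟨Sum.inl j, rfl⟩)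
          · have h2 : (relations φK a).map (rename (R := R) s).toRingHom ≤ relations φ c :=
              Ideal.map_le_iff_le_comap.2 fun u hu => hs' u hu
            have h3 := Ideal.mem_map_of_mem (rename (R := R) s).toRingHom hy
            rw [Ideal.map_pow] at h3
            exact Ideal.pow_right_mono h2 2 h3
      · refine (Ideal.span_le.2 ?_).trans Ideal.le_comap_map
        rintro _ ⟨j, rfl⟩
        exact Ideal.mem_sup_left (Ideal.subset_span ⟨Sum.inr j, rfl⟩)
      · exact le_sup_right.trans Ideal.le_comap_map
    obtain ⟨q, hq, hmem⟩ := mem_map_relations_iff.1 (Ideal.map_le_iff_le_comap.2 hle h1)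
    exact ⟨q, isUnit_iff_ne_zero.2 hq, hmem⟩
  · intro d hd
    rw [Fintype.sum_sum_type] at hd
    simp only [Sum.elim_inl, Sum.elim_inr] at hd
    -- The derivatives along the new coordinates vanish on the relations of `a` and on squares, so
    -- they isolate the coefficients of `h`. What remains is a combination of the `f`, where
    -- independence over `K` takes over.
    have h1 : ∀ i, eval₂ φ c (d (Sum.inr i)) = 0 := by
      let N : Matrix ι' ι' L := Matrix.of fun i j => eval₂ φ c (pderiv (s' i) (h j))
      have hN : N⁻¹ * N = 1 := Matrix.nonsing_inv_mul _ (isUnit_iff_ne_zero.2 hjac)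
      have h2 : N.mulVec (fun i => eval₂ φ c (d (Sum.inr i))) = 0 := by
        funext i
        have hD := isConormalFunctional_pderiv φ c (s' i)
        have h3 := hD.map_sq hd
        rw [hD.add _ (Ideal.sum_mem _ fun j _ => Ideal.mul_mem_left _ _ (hs' _ (hf.mem j))) _
          (Ideal.sum_mem _ fun j _ => Ideal.mul_mem_left _ _ (hh j)),
          hD.map_sum_mul _ _ _ (fun j => hs' _ (hf.mem j)), hD.map_sum_mul _ _ _ hh] at h3
        simp only [eval₂_pderiv_rename_eq_zero hbij, mul_zero, Finset.sum_const_zero,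
          zero_add] at h3
        rw [Pi.zero_apply, ← h3]
        exact Finset.sum_congr rfl fun j _ => mul_comm _ _
      have h3 : N⁻¹.mulVec (N.mulVec (fun i => eval₂ φ c (d (Sum.inr i)))) = 0 := by
        rw [h2, Matrix.mulVec_zero]
      rw [Matrix.mulVec_mulVec, hN, Matrix.one_mulVec] at h3
      exact congrFun h3
    rintro (j | j)
    · refine eval₂_eq_zero_of_sum_mul_rename_mem hφ hs
        (fun x y hxy => Sum.inl_injective (hbij.1 hxy)) ha hf.indep (d := fun j => d (Sum.inl j)) ?_ j
      rw [← add_sub_cancel_right (∑ j, _) (∑ j, d (Sum.inr j) * h j)]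
      refine sub_mem hd (Ideal.sum_mem _ fun j _ => ?_)
      rw [pow_two]
      exact Ideal.mul_mem_mul (mem_relations.2 (h1 j)) (hh j)
    · exact h1 j

lemma exists_polynomial_map_localEval {ι : Type} {φK : R →+* K} {a : ι → K}
    (ha : EssentiallyGenerates φK a) (p : Polynomial K) :
    ∃ (q : MvPolynomial ι R) (m : Polynomial (MvPolynomial ι R)), eval₂ φK a q ≠ 0 ∧
      m.map (eval₂Hom φK a) = Polynomial.C (eval₂ φK a q) * p := by
  induction p using Polynomial.induction_on' with
  | add p p' hp hp' =>
    obtain ⟨q, m, hq, hm⟩ := hp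
    obtain ⟨q', m', hq', hm'⟩ := hp'
    refine ⟨q * q', Polynomial.C q' * m + Polynomial.C q * m', ?_, ?_⟩
    · rw [eval₂_mul]
      exact mul_ne_zero hq hq'
    · simp only [Polynomial.map_add, Polynomial.map_mul, Polynomial.map_C, hm, hm', eval₂_mul,
        Polynomial.C_mul, coe_eval₂Hom]
      ring
  | monomial n z =>
    obtain ⟨p, q, hq, h⟩ := ha z
    refine ⟨q, Polynomial.monomial n p, hq.ne_zero, ?_⟩
    rw [Polynomial.map_monomial, coe_eval₂Hom, ← h, Polynomial.C_mul_monomial, mul_comm]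

lemma pderiv_eval₂_rename {ι τ : Type} {s : ι → τ} {t t' : τ} (ht : t ∉ Set.range s)
    (m : Polynomial (MvPolynomial ι R)) :
    pderiv t (m.eval₂ (rename (R := R) s).toRingHom (X t')) =
      m.derivative.eval₂ (rename (R := R) s).toRingHom (X t') * pderiv t (X t') := by
  have h0 : ∀ g : MvPolynomial ι R, pderiv t (rename s g) = 0 := by
    classical
    intro g
    refine pderiv_eq_zero_of_notMem_vars fun h => ?_
    obtain ⟨i, -, hi⟩ := Finset.mem_image.1 (vars_rename s g h)
    exact ht ⟨i, hi⟩
  induction m using Polynomial.induction_on' with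
  | add p q hp hq =>
    rw [Polynomial.eval₂_add, map_add, hp, hq, Polynomial.derivative_add, Polynomial.eval₂_add,
      add_mul]
  | monomial n z =>
    rw [Polynomial.eval₂_monomial, Derivation.leibniz, Derivation.leibniz_pow]
    change _ + _ • pderiv t (rename s z) = _
    rw [h0, Polynomial.derivative_monomial, Polynomial.eval₂_monomial]
    simp only [smul_eq_mul, nsmul_eq_mul, mul_zero, add_zero, map_mul, map_natCast]
    ring

/-- For each new coordinate take its minimal polynomial over `K`, with denominators cleared. It
involves no other new coordinate, so the Jacobian matrix is diagonal, and its entries are nonzero by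
separability. -/
lemma exists_jacobian_ne_zero [Algebra.IsSeparable K L] {ι ι' τ : Type} [Fintype ι']
    [DecidableEq ι'] {φK : R →+* K} {φ : R →+* L}
    (hφ : ∀ r, algebraMap K L (φK r) = φ r) {a : ι → K} {c : τ → L} {s : ι → τ} {s' : ι' → τ}
    (hs : ∀ i, c (s i) = algebraMap K L (a i)) (hinj : Function.Injective s')
    (hdisj : ∀ i, s' i ∉ Set.range s) (ha : EssentiallyGenerates φK a) :
    ∃ h : ι' → MvPolynomial τ R, (∀ i, h i ∈ relations φ c) ∧ jacobian φ c s' h ≠ 0 := by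
  choose q m hq hm using fun i => exists_polynomial_map_localEval ha (minpoly K (c (s' i)))
  have hcomp : (eval₂Hom φ c).comp (rename (R := R) s).toRingHom =
      (algebraMap K L).comp (eval₂Hom φK a) := by
    refine ringHom_ext (fun r => ?_) (fun i => ?_)
    · simp [hφ]
    · simp [hs]
  have heval : ∀ (n : Polynomial (MvPolynomial ι R)) t,
      eval₂ φ c (n.eval₂ (rename (R := R) s).toRingHom (X t)) =
        Polynomial.aeval (c t) (n.map (eval₂Hom φK a)) := by
    intro n t
    rw [← coe_eval₂Hom, Polynomial.hom_eval₂, hcomp, Polynomial.aeval_def, Polynomial.eval₂_map,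
      coe_eval₂Hom, eval₂_X]
  refine ⟨fun i => (m i).eval₂ (rename (R := R) s).toRingHom (X (s' i)), fun i => ?_, ?_⟩
  · rw [mem_relations, heval, hm, map_mul, minpoly.aeval, mul_zero]
  · have hmat : (Matrix.of fun i j => eval₂ φ c (pderiv (s' i)
        ((m j).eval₂ (rename (R := R) s).toRingHom (X (s' j))))) =
        Matrix.diagonal fun i => algebraMap K L (eval₂ φK a (q i)) *
          Polynomial.aeval (c (s' i)) (Polynomial.derivative (minpoly K (c (s' i)))) := by
      ext i j
      rw [Matrix.of_apply, pderiv_eval₂_rename (hdisj i)]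
      by_cases hij : i = j
      · subst hij
        rw [pderiv_X_self, mul_one, heval, ← Polynomial.derivative_map, hm, Matrix.diagonal_apply_eq]
        simp
      · rw [pderiv_X_of_ne (fun h => hij (hinj h).symm), mul_zero, Matrix.diagonal_apply_ne _ hij,
          eval₂_zero]
    rw [jacobian, hmat, Matrix.det_diagonal]
    refine Finset.prod_ne_zero_iff.2 fun i _ => mul_ne_zero (by simpa using hq i) ?_
    exact (Algebra.IsSeparable.isSeparable K (c (s' i))).aeval_derivative_ne_zero (minpoly.aeval _ _)

end FrameExtension

end QuotientRamification

namespace QuotientRamification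

open MvPolynomial

/-! ### The coordinate of a canonical form with respect to a volume form -/

section Scale

variable {R L : Type u} [CommRing R] [Field L]

/-- The polynomials `f` form a conormal frame for the tuple `a`, which generates a subfield of `L`
over which `L` is finite separable. -/
def IsSeparableFrame (φ : R →+* L) {ι κ : Type} [Fintype κ] (a : ι → L)
    (f : κ → MvPolynomial ι R) : Prop :=
  ∃ (K : Type u) (_ : Field K) (_ : Algebra K L) (φK : R →+* K) (aK : ι → K),
    FiniteDimensional K L ∧ Algebra.IsSeparable K L ∧ (∀ r, algebraMap K L (φK r) = φ r) ∧
      (∀ i, a i = algebraMap K L (aK i)) ∧ EssentiallyGenerates φK aK ∧ IsConormalFrame φK aK f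

lemma EssentiallyGenerates.extend {φ : R →+* L} {ι τ : Type} {a : ι → L} {c : τ → L} {s : ι → τ}
    (hs : ∀ i, c (s i) = a i) (ha : EssentiallyGenerates φ a) : EssentiallyGenerates φ c := by
  intro z
  obtain ⟨p, q, hq, h⟩ := ha z
  have : c ∘ s = a := funext hs
  exact ⟨rename s p, rename s q, by rwa [eval₂_rename, this],
    by rwa [eval₂_rename, eval₂_rename, this]⟩

lemma IsConormalFrame.isSeparableFrame {φ : R →+* L} {ι κ : Type} [Fintype κ] {a : ι → L}
    {f : κ → MvPolynomial ι R} (hf : IsConormalFrame φ a f) (ha : EssentiallyGenerates φ a) :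
    IsSeparableFrame φ a f :=
  ⟨L, inferInstance, Algebra.id L, φ, a, inferInstance, inferInstance, fun _ => rfl, fun _ => rfl,
    ha, hf⟩

/-- For a basis `W` of the dual of the conormal space of the tuple `c`: the canonical form
`[da/f]` has coordinate `l` with respect to the volume form defined by `W`. -/
def IsScale (φ : R →+* L) {τ m ι κ : Type} [Fintype m] [DecidableEq m] (c : τ → L)
    (W : m → MvPolynomial τ R → L) (s : ι → τ) (f : κ → MvPolynomial ι R) (l : L) : Prop :=
  l ≠ 0 ∧ ∀ (ι' : Type) [Fintype ι'] [DecidableEq ι'] (s' : ι' → τ),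
    Function.Bijective (Sum.elim s s') → ∀ h : ι' → MvPolynomial τ R,
    (∀ i, h i ∈ relations φ c) → ∀ e : m ≃ κ ⊕ ι',
    EqUpToSign (Matrix.of fun i j => W i (Sum.elim (fun j => rename s (f j)) h (e j))).det
      (l * jacobian φ c s' h)

variable {φ : R →+* L} {τ ι ι' κ : Type} [Fintype ι] [Fintype κ] [DecidableEq κ] [Fintype ι']
  [DecidableEq ι'] {a : ι → L} {c : τ → L} {s : ι → τ} {s' : ι' → τ}
  {f : κ → MvPolynomial ι R}

set_option linter.unusedSectionVars false

lemma IsSeparableFrame.exists_jacobian_ne_zero (hf : IsSeparableFrame φ a f)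
    (hs : ∀ i, c (s i) = a i) (hinj : Function.Injective s')
    (hdisj : ∀ i, s' i ∉ Set.range s) :
    ∃ h : ι' → MvPolynomial τ R, (∀ i, h i ∈ relations φ c) ∧ jacobian φ c s' h ≠ 0 := by
  obtain ⟨K, _, _, φK, aK, _, _, hφ, haK, hgen, -⟩ := hf
  exact QuotientRamification.exists_jacobian_ne_zero hφ (fun i => (hs i).trans (haK i)) hinj hdisj
    hgen

lemma notMem_range_of_bijective {ι ι' τ : Type*} {s : ι → τ} {s' : ι' → τ}
    (hbij : Function.Bijective (Sum.elim s s')) (i : ι') : s' i ∉ Set.range s := by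
  rintro ⟨j, hj⟩
  have : (Sum.elim s s') (Sum.inl j) = (Sum.elim s s') (Sum.inr i) := hj
  exact absurd (hbij.1 this) (by simp)

lemma IsSeparableFrame.extend (hf : IsSeparableFrame φ a f) (hs : ∀ i, c (s i) = a i)
    (hbij : Function.Bijective (Sum.elim s s')) (hc : EssentiallyGenerates φ c)
    {h : ι' → MvPolynomial τ R} (hh : ∀ i, h i ∈ relations φ c) (hjac : jacobian φ c s' h ≠ 0) :
    IsConormalFrame φ c (Sum.elim (fun j => rename s (f j)) h) := by
  obtain ⟨K, _, _, φK, aK, _, _, hφ, haK, hgen, hfr⟩ := hf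
  exact hfr.extend hφ (fun i => (hs i).trans (haK i)) hbij hgen hc hh hjac

lemma IsSeparableFrame.rename_mem (hf : IsSeparableFrame φ a f) (hs : ∀ i, c (s i) = a i) (j : κ) :
    rename s (f j) ∈ relations φ c := by
  obtain ⟨K, _, _, φK, aK, _, _, hφ, haK, hgen, hfr⟩ := hf
  refine rename_mem_relations hs ?_
  have h1 := hfr.mem j
  rw [mem_relations] at h1 ⊢
  have : a = fun i => algebraMap K L (aK i) := funext haK
  have h2 := congrArg (algebraMap K L) h1
  rw [hom_eval₂, map_zero] at h2
  rw [this, ← h2]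
  congr 1
  ext r
  simp [hφ]

/-- The basis of the dual of the conormal space of `c` which is adapted to the frame `f`. -/
lemma IsSeparableFrame.exists_dualBasis (hf : IsSeparableFrame φ a f) (hs : ∀ i, c (s i) = a i)
    (hbij : Function.Bijective (Sum.elim s s')) (hc : EssentiallyGenerates φ c) :
    ∃ W : κ ⊕ ι' → MvPolynomial τ R → L, IsDualBasis φ c W ∧
      ∀ h : ι' → MvPolynomial τ R, (∀ i, h i ∈ relations φ c) →
        (Matrix.of fun i j => W i (Sum.elim (fun j => rename s (f j)) h j)).det =
          jacobian φ c s' h := by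
  classical
  obtain ⟨h₀, hh₀, hjac⟩ := hf.exists_jacobian_ne_zero (s' := s') hs
    (fun x y hxy => Sum.inr_injective (hbij.1 hxy)) (notMem_range_of_bijective hbij)
  have hfr := hf.extend hs hbij hc hh₀ hjac
  obtain ⟨D, hD, hD'⟩ := hfr.exists_dual
  -- Functionals dual to `f`, together with the derivatives along the complementary coordinates. On
  -- (f, h) their matrix is block triangular, with diagonal blocks 1 and the Jacobian matrix of `h`.
  let W : κ ⊕ ι' → MvPolynomial τ R → L :=
    Sum.elim (fun i => D (Sum.inl i)) fun i g => eval₂ φ c (pderiv (s' i) g)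
  have hW : ∀ i, IsConormalFunctional φ c (W i) := by
    rintro (i | i)
    · exact hD _
    · exact isConormalFunctional_pderiv φ c (s' i)
  have hdet : ∀ h : ι' → MvPolynomial τ R,
      (Matrix.of fun i j => W i (Sum.elim (fun j => rename s (f j)) h j)).det =
        jacobian φ c s' h := by
    intro h
    have : (Matrix.of fun i j => W i (Sum.elim (fun j => rename s (f j)) h j)) =
        Matrix.fromBlocks 1 (Matrix.of fun i j => D (Sum.inl i) (h j)) 0
          (Matrix.of fun i j => eval₂ φ c (pderiv (s' i) (h j))) := by
      ext (i | i) (j | j)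
      · have := hD' (Sum.inl i) (Sum.inl j)
        simp only [Sum.elim_inl, Sum.inl.injEq] at this
        simp [W, this, Matrix.one_apply]
      · simp [W]
      · simp [W, eval₂_pderiv_rename_eq_zero hbij]
      · simp [W]
    rw [this, Matrix.det_fromBlocks_zero₂₁, Matrix.det_one, one_mul, jacobian]
  exact ⟨W, hfr.isDualBasis hW (by rwa [hdet]), fun h _ => hdet h⟩

lemma jacobian_comp_equiv {ι'' : Type} [Fintype ι''] [DecidableEq ι''] (e : ι'' ≃ ι')
    (h : ι' → MvPolynomial τ R) : jacobian φ c (s' ∘ e) (h ∘ e) = jacobian φ c s' h :=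
  Matrix.det_submatrix_equiv_self e
    (Matrix.of fun i j => eval₂ φ c (pderiv (s' i) (h j)))

/-- The scale of a separable frame exists. -/
theorem IsSeparableFrame.exists_scale (hf : IsSeparableFrame φ a f) (hs : ∀ i, c (s i) = a i)
    (hbij : Function.Bijective (Sum.elim s s')) (hc : EssentiallyGenerates φ c)
    {m : Type} [Fintype m] [DecidableEq m] {W : m → MvPolynomial τ R → L}
    (hW : IsDualBasis φ c W) : ∃ l, IsScale φ c W s f l := by
  classical
  obtain ⟨V, hV, hVdet⟩ := hf.exists_dualBasis hs hbij hc
  let θ : m ≃ κ ⊕ ι' := Fintype.equivOfCardEq (hW.card_eq hV)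
  -- The scale is the determinant of the change from the adapted dual basis `V` to `W`.
  obtain ⟨T, hT⟩ := hV.exists_matrix hW.functional
  have hTdet : ∀ u : m → MvPolynomial τ R, (∀ j, u j ∈ relations φ c) →
      (Matrix.of fun i j => W i (u j)).det =
        (T.submatrix id θ).det * (Matrix.of fun i j => V (θ i) (u j)).det := by
    intro u hu
    rw [← Matrix.det_mul]
    congr 1
    ext i j
    rw [Matrix.of_apply, hT i _ (hu j), Matrix.mul_apply, ← θ.sum_comp]
    rfl
  have hT0 : (T.submatrix id θ).det ≠ 0 := by
    obtain ⟨u, hu, hdet⟩ := hW.sep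
    rw [hTdet u hu] at hdet
    exact left_ne_zero_of_mul hdet
  refine ⟨(T.submatrix id θ).det, hT0, fun ι'' _ _ s'' hbij' h hh e => ?_⟩
  -- All complements of `s` have the same range, so `s''` is a reindexing of `s'`; this costs at
  -- most a sign.
  have hex : ∀ i : ι'', ∃ i', s' i' = s'' i := by
    intro i
    obtain ⟨j | j, hj⟩ := hbij.2 (s'' i)
    · exact absurd ⟨j, hj⟩ (notMem_range_of_bijective hbij' i)
    · exact ⟨j, hj⟩
  choose ρ hρ using hex
  have hρb : Function.Bijective ρ := by
    constructor
    · intro x y hxy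
      have : s'' x = s'' y := by rw [← hρ, ← hρ, hxy]
      exact Sum.inr_injective (hbij'.1 (a₁ := Sum.inr x) (a₂ := Sum.inr y) this)
    · intro x
      obtain ⟨j | j, hj⟩ := hbij'.2 (s' x)
      · exact absurd ⟨j, hj⟩ (notMem_range_of_bijective hbij x)
      · refine ⟨j, ?_⟩
        have : s' (ρ j) = s' x := by rw [hρ]; exact hj
        exact Sum.inr_injective (hbij.1 (a₁ := Sum.inr (ρ j)) (a₂ := Sum.inr x) this)
  let ρe : ι'' ≃ ι' := Equiv.ofBijective ρ hρb
  have hs'' : s'' = s' ∘ ρe := (funext hρ).symm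
  have hu : ∀ j, Sum.elim (fun j => rename s (f j)) h j ∈ relations φ c := by
    rintro (j | j)
    · exact hf.rename_mem hs j
    · exact hh j
  rw [hTdet _ fun j => hu _]
  refine EqUpToSign.mul .rfl' ?_
  have h1 := hVdet (h ∘ ρe.symm) fun i => hh _
  have h2 : jacobian φ c s'' h = jacobian φ c s' (h ∘ ρe.symm) := by
    rw [hs'', ← jacobian_comp_equiv ρe (h ∘ ρe.symm)]
    congr 1
    funext i
    simp
  rw [h2, ← h1]
  have h3 := eqUpToSign_det_submatrix
    (Matrix.of fun i j => V i (Sum.elim (fun j => rename s (f j)) (h ∘ ρe.symm) j)) θ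
    (e.trans (Equiv.sumCongr (Equiv.refl κ) ρe))
  have h4 : (Matrix.of fun i j => V (θ i) (Sum.elim (fun j => rename s (f j)) h (e j))) =
      (Matrix.of fun i j => V i (Sum.elim (fun j => rename s (f j)) (h ∘ ρe.symm) j)).submatrix θ
        (e.trans (Equiv.sumCongr (Equiv.refl κ) ρe)) := by
    ext i j
    change V (θ i) _ = V (θ i) _
    congr 1
    change _ = Sum.elim _ _ (Equiv.sumCongr (Equiv.refl κ) ρe (e j))
    rcases e j with x | x <;> simp
  rw [h4]
  exact h3

end Scale

/-! ### Existence and multiplicativity of ratios of canonical forms -/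

section Ratio

variable {R L : Type u} [CommRing R] [Field L] {φ : R →+* L}
  {ι κ ι' κ' : Type} [Fintype ι] [DecidableEq ι] [Fintype κ] [DecidableEq κ] [Fintype ι']
  [DecidableEq ι'] [Fintype κ'] [DecidableEq κ']
  {a : ι → L} {f : κ → MvPolynomial ι R} {b : ι' → L} {g : κ' → MvPolynomial ι' R} {r : L}

/-- Existence of the ratio of two canonical forms. -/
theorem IsSeparableFrame.exists_isRatio (hf : IsSeparableFrame φ a f)
    (hg : IsSeparableFrame φ b g) (hb : EssentiallyGenerates φ b) :
    ∃ r, IsRatio φ a f b g r := by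
  classical
  let c : ι ⊕ ι' → L := Sum.elim a b
  have hc : EssentiallyGenerates φ c := hb.extend (s := Sum.inr) fun _ => rfl
  have hbij : Function.Bijective (Sum.elim (Sum.inl : ι → ι ⊕ ι') Sum.inr) := by
    rw [Sum.elim_inl_inr]
    exact Function.bijective_id
  have hbij' : Function.Bijective (Sum.elim (Sum.inr : ι' → ι ⊕ ι') Sum.inl) :=
    (Equiv.sumComm ι' ι).bijective
  obtain ⟨W, hW, -⟩ := hf.exists_dualBasis (c := c) (fun _ => rfl) hbij hc
  obtain ⟨V, hV, -⟩ := hg.exists_dualBasis (c := c) (fun _ => rfl) hbij' hc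
  let e : κ ⊕ ι' ≃ κ' ⊕ ι := Fintype.equivOfCardEq (hW.card_eq hV)
  obtain ⟨h, hh, hhj⟩ := hf.exists_jacobian_ne_zero (c := c) (s := Sum.inl)
    (s' := (Sum.inr : ι' → ι ⊕ ι')) (fun _ => rfl) Sum.inr_injective
    (notMem_range_of_bijective hbij)
  obtain ⟨k, hk, hkj⟩ := hg.exists_jacobian_ne_zero (c := c) (s := Sum.inr)
    (s' := (Sum.inl : ι → ι ⊕ ι')) (fun _ => rfl) Sum.inl_injective
    (notMem_range_of_bijective hbij')
  have hfr := hf.extend (c := c) (fun _ => rfl) hbij hc hh hhj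
  have hgk : ∀ i, Sum.elim (fun j => rename Sum.inr (g j)) k (e i) ∈ relations φ c := by
    intro i
    rcases e i with j | j
    · exact hg.rename_mem (c := c) (s := Sum.inr) (fun _ => rfl) j
    · exact hk j
  have key : ∀ i, ∃ (q : MvPolynomial (ι ⊕ ι') R) (d : κ ⊕ ι' → MvPolynomial (ι ⊕ ι') R),
      eval₂ φ c q ≠ 0 ∧ q * Sum.elim (fun j => rename Sum.inr (g j)) k (e i) -
        ∑ j, d j * Sum.elim (fun j => rename Sum.inl (f j)) h j ∈ relations φ c ^ 2 := by
    intro i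
    obtain ⟨q, hq, hmem⟩ := hfr.span _ (hgk i)
    obtain ⟨x, hx, y, hy, hxy⟩ := Submodule.mem_sup.1 hmem
    obtain ⟨d, hd⟩ := Ideal.mem_span_range_iff_exists_fun.1 hx
    refine ⟨q, d, hq.ne_zero, ?_⟩
    rw [hd, ← hxy, add_sub_cancel_left]
    exact hy
  choose q d hq hd using key
  have hprod : eval₂ φ c (∏ i, q i) ≠ 0 := by
    rw [← coe_eval₂Hom, map_prod]
    exact Finset.prod_ne_zero_iff.2 fun i _ => hq i
  -- The common denominator is the product of all `q i`, so row `i` is multiplied by the other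
  -- factors.
  let M : Matrix (κ ⊕ ι') (κ ⊕ ι') (MvPolynomial (ι ⊕ ι') R) :=
    Matrix.of fun i j => (∏ i' ∈ Finset.univ.erase i, q i') * d i j
  refine ⟨(M.map (eval₂ φ c)).det * jacobian φ c Sum.inr h /
    (jacobian φ c Sum.inl k * eval₂ φ c (∏ i, q i) ^ Fintype.card (κ ⊕ ι')),
    h, k, e, ∏ i, q i, M, hh, hk, hhj, hkj, hprod, fun i => ?_, ?_⟩
  · have : (∏ i, q i) * Sum.elim (fun j => rename Sum.inr (g j)) k (e i) -
        ∑ j, M i j * Sum.elim (fun j => rename Sum.inl (f j)) h j =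
        (∏ i' ∈ Finset.univ.erase i, q i') *
          (q i * Sum.elim (fun j => rename Sum.inr (g j)) k (e i) -
            ∑ j, d i j * Sum.elim (fun j => rename Sum.inl (f j)) h j) := by
      rw [← Finset.prod_erase_mul _ _ (Finset.mem_univ i), mul_sub, Finset.mul_sum, mul_assoc]
      simp only [M, Matrix.of_apply, mul_assoc]
    rw [this]
    exact Ideal.mul_mem_left _ _ (hd i)
  · rw [mul_assoc]
    exact div_mul_cancel₀ _ (mul_ne_zero hkj (pow_ne_zero _ hprod))

/-- Comparison of a ratio with the scales with respect to a fixed volume form on the conormal space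
of a larger tuple. -/
theorem IsRatio.eqUpToSign_scale (hr : IsRatio φ a f b g r) (hf : IsSeparableFrame φ a f)
    (hg : IsSeparableFrame φ b g) {τ m ι'' : Type} [Fintype m] [DecidableEq m] [Fintype ι'']
    [DecidableEq ι''] {c : τ → L} {W : m → MvPolynomial τ R → L} (hW : IsDualBasis φ c W)
    (hc : EssentiallyGenerates φ c)
    {s : ι → τ} {t : ι' → τ} {v : ι'' → τ} (hs : ∀ i, c (s i) = a i) (ht : ∀ i, c (t i) = b i)
    (hbij : Function.Bijective (Sum.elim s (Sum.elim t v))) {x y : L}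
    (hx : IsScale φ c W s f x) (hy : IsScale φ c W t g y) : EqUpToSign y (x * r) := by
  classical
  obtain ⟨h, k, e, q, M, hh, hk, hhj, hkj, hq, hM, hreq⟩ := hr
  let st : ι ⊕ ι' → τ := Sum.elim s t
  have hst : ∀ i, c (st i) = Sum.elim a b i := by
    rintro (i | i)
    · exact hs i
    · exact ht i
  have hstc : c ∘ st = Sum.elim a b := funext hst
  have hbij₂ : Function.Bijective (Sum.elim st v) := by
    have : Sum.elim st v = Sum.elim s (Sum.elim t v) ∘ Equiv.sumAssoc ι ι' ι'' := by
      funext i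
      rcases i with (i | i) | i <;> rfl
    rw [this]
    exact hbij.comp (Equiv.bijective _)
  have hbij₃ : Function.Bijective (Sum.elim t (Sum.elim s v)) := by
    have : Sum.elim t (Sum.elim s v) = Sum.elim st v ∘
        ((Equiv.sumAssoc ι' ι ι'').symm.trans (Equiv.sumCongr (Equiv.sumComm _ _) (.refl _))) := by
      funext i
      rcases i with i | i | i <;> rfl
    rw [this]
    exact hbij₂.comp (Equiv.bijective _)
  have hv : Function.Injective v := fun p q hpq =>
    Sum.inr_injective (hbij₂.1 (a₁ := Sum.inr p) (a₂ := Sum.inr q) hpq)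
  have hvs : ∀ i, v i ∉ Set.range st := notMem_range_of_bijective hbij₂
  -- Relations for the coordinates outside both tuples. They complete both families (f, h) and (g,
  -- k) to the large tuple, and their Jacobian is a common nonzero factor which cancels at the end.
  obtain ⟨l, hl, hlj⟩ := hf.exists_jacobian_ne_zero (c := c) hs hv
    fun i hi => hvs i (by obtain ⟨j, hj⟩ := hi; exact ⟨Sum.inl j, hj⟩)
  have hjac : ∀ {n : Type} [Fintype n] [DecidableEq n] (w : n → ι ⊕ ι')
      (p : n → MvPolynomial (ι ⊕ ι') R),
      jacobian φ c (Sum.elim (st ∘ w) v) (Sum.elim (fun i => rename st (p i)) l) =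
        jacobian φ (Sum.elim a b) w p * jacobian φ c v l := by
    intro n _ _ w p
    have hinj : Function.Injective st := fun p q hpq =>
      Sum.inl_injective (hbij₂.1 (a₁ := Sum.inl p) (a₂ := Sum.inl q) hpq)
    rw [jacobian, jacobian, jacobian, ← Matrix.det_fromBlocks_zero₂₁ _
      (Matrix.of fun i j => eval₂ φ c (pderiv (st (w i)) (l j)))]
    congr 1
    ext (i | i) (j | j)
    · simp [pderiv_rename hinj, eval₂_rename, hstc]
    · simp
    · simp [eval₂_pderiv_rename_of_notMem_range (hvs i)]
    · simp
  have hmem : ∀ p ∈ relations φ (Sum.elim a b), rename st p ∈ relations φ c :=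
    fun p hp => rename_mem_relations hst hp
  let u₀ : κ ⊕ ι' → MvPolynomial (ι ⊕ ι') R := Sum.elim (fun j => rename Sum.inl (f j)) h
  let w₀ : κ ⊕ ι' → MvPolynomial (ι ⊕ ι') R :=
    fun i => Sum.elim (fun j => rename Sum.inr (g j)) k (e i)
  have hu₀ : ∀ j, u₀ j ∈ relations φ (Sum.elim a b) := by
    rintro (j | j)
    · exact hf.rename_mem (c := Sum.elim a b) (s := Sum.inl) (fun _ => rfl) j
    · exact hh j
  have hw₀ : ∀ j, w₀ j ∈ relations φ (Sum.elim a b) := by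
    intro j
    simp only [w₀]
    rcases e j with j | j
    · exact hg.rename_mem (c := Sum.elim a b) (s := Sum.inr) (fun _ => rfl) j
    · exact hk j
  let u : (κ ⊕ ι') ⊕ ι'' → MvPolynomial τ R := Sum.elim (fun i => rename st (u₀ i)) l
  let w : (κ ⊕ ι') ⊕ ι'' → MvPolynomial τ R := Sum.elim (fun i => rename st (w₀ i)) l
  have hu : ∀ j, u j ∈ relations φ c := by
    rintro (j | j)
    · exact hmem _ (hu₀ j)
    · exact hl j
  have hw : ∀ j, w j ∈ relations φ c := by
    rintro (j | j)
    · exact hmem _ (hw₀ j)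
    · exact hl j
  obtain ⟨V, hV, -⟩ := hf.exists_dualBasis (s' := Sum.elim t v) hs hbij hc
  let θ : m ≃ (κ ⊕ ι') ⊕ ι'' :=
    (Fintype.equivOfCardEq (hW.card_eq hV)).trans (Equiv.sumAssoc κ ι' ι'').symm
  -- the two volumes
  have h1 := hx.2 _ (Sum.elim t v) hbij (Sum.elim (fun i => rename st (h i)) l)
    (by rintro (j | j); exacts [hmem _ (hh j), hl j]) (θ.trans (Equiv.sumAssoc κ ι' ι''))
  have h2 := hy.2 _ (Sum.elim s v) hbij₃ (Sum.elim (fun i => rename st (k i)) l)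
    (by rintro (j | j); exacts [hmem _ (hk j), hl j])
    (θ.trans ((Equiv.sumCongr e (.refl _)).trans (Equiv.sumAssoc κ' ι ι'')))
  have h3 : jacobian φ c (Sum.elim t v) (Sum.elim (fun i => rename st (h i)) l) =
      jacobian φ (Sum.elim a b) Sum.inr h * jacobian φ c v l := hjac Sum.inr h
  have h4 : jacobian φ c (Sum.elim s v) (Sum.elim (fun i => rename st (k i)) l) =
      jacobian φ (Sum.elim a b) Sum.inl k * jacobian φ c v l := hjac Sum.inl k
  rw [h3] at h1
  rw [h4] at h2
  have h5 : (fun j => Sum.elim (fun j => rename s (f j)) (Sum.elim (fun i => rename st (h i)) l)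
      ((θ.trans (Equiv.sumAssoc κ ι' ι'')) j)) = u ∘ θ := by
    funext j
    simp only [Equiv.trans_apply, Function.comp_apply]
    rcases θ j with (j | j) | j <;> simp [u, u₀, rename_rename, st]
  have h6 : (fun j => Sum.elim (fun j => rename t (g j)) (Sum.elim (fun i => rename st (k i)) l)
      ((θ.trans ((Equiv.sumCongr e (.refl _)).trans (Equiv.sumAssoc κ' ι ι''))) j)) = w ∘ θ := by
    funext j
    simp only [Equiv.trans_apply, Function.comp_apply]
    rcases θ j with j | j
    · simp only [Equiv.sumCongr_apply, Sum.map_inl, w, Sum.elim_inl, w₀]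
      rcases e j with j | j <;> simp [rename_rename, st]
    · simp [w]
  simp only [funext_iff] at h5 h6
  simp only [h5] at h1
  simp only [h6] at h2
  -- the transition matrix
  let N : Matrix ((κ ⊕ ι') ⊕ ι'') ((κ ⊕ ι') ⊕ ι'') (MvPolynomial τ R) :=
    Matrix.fromBlocks (M.map (rename st)) 0 0 (rename st q • (1 : Matrix ι'' ι'' _))
  have hN : ∀ i, rename st q * w i - ∑ j, N i j * u j ∈ relations φ c ^ 2 := by
    have hle : (relations φ (Sum.elim a b)).map (rename (R := R) st).toRingHom ≤ relations φ c :=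
      Ideal.map_le_iff_le_comap.2 fun p hp => hmem p hp
    rintro (i | i)
    · have := Ideal.mem_map_of_mem (rename (R := R) st).toRingHom (hM i)
      rw [Ideal.map_pow] at this
      have := Ideal.pow_right_mono hle 2 this
      rw [Fintype.sum_sum_type]
      simpa [N, u, w, u₀, w₀] using this
    · rw [Fintype.sum_sum_type]
      simp [N, u, w, Matrix.one_apply]
  let Nθ : Matrix m m (MvPolynomial τ R) := N.submatrix θ θ
  have hNθ : ∀ i, rename st q * (w ∘ θ) i - ∑ j, Nθ i j * (u ∘ θ) j ∈ relations φ c ^ 2 := by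
    intro i
    have := hN (θ i)
    rw [← θ.sum_comp] at this
    exact this
  have h7 := det_functional_eq_of_sub_mem hW.functional (u := u ∘ θ) (v := w ∘ θ)
    (fun j => hu _) (fun j => hw _) hNθ
  have hq' : eval₂ φ c (rename st q) = eval₂ φ (Sum.elim a b) q := by
    rw [eval₂_rename, hstc]
  have h8 : (Nθ.map (eval₂ φ c)).det = (M.map (eval₂ φ (Sum.elim a b))).det *
      eval₂ φ (Sum.elim a b) q ^ Fintype.card ι'' := by
    have : (Nθ.map (eval₂ φ c)) = (Matrix.fromBlocks (M.map (eval₂ φ (Sum.elim a b))) 0 0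
        (eval₂ φ (Sum.elim a b) q • (1 : Matrix ι'' ι'' L))).submatrix θ θ := by
      ext i j
      simp only [Nθ, N, Matrix.map_apply, Matrix.submatrix_apply]
      rcases θ i with i | i <;> rcases θ j with j | j
      · simp [eval₂_rename, hstc]
      · simp
      · simp
      · by_cases hij : i = j
        · simp [hij, hq']
        · simp [hij]
    rw [this, Matrix.det_submatrix_equiv_self, Matrix.det_fromBlocks_zero₂₁, Matrix.det_smul,
      Matrix.det_one, mul_one]
  have hcard : Fintype.card m = Fintype.card (κ ⊕ ι') + Fintype.card ι'' := by
    rw [Fintype.card_congr θ, Fintype.card_sum]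
  rw [h8, hq', hcard, pow_add] at h7
  have hne : jacobian φ (Sum.elim a b) Sum.inl k * jacobian φ c v l *
      (eval₂ φ (Sum.elim a b) q ^ Fintype.card (κ ⊕ ι') *
        eval₂ φ (Sum.elim a b) q ^ Fintype.card ι'') ≠ 0 :=
    mul_ne_zero (mul_ne_zero hkj hlj) (mul_ne_zero (pow_ne_zero _ hq) (pow_ne_zero _ hq))
  refine EqUpToSign.of_mul_right hne ?_
  have h9 := (h2.mul (.rfl' (x := eval₂ φ (Sum.elim a b) q ^ Fintype.card (κ ⊕ ι') *
    eval₂ φ (Sum.elim a b) q ^ Fintype.card ι''))).symm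
  have h10 := h1.mul (.rfl' (x := (M.map (eval₂ φ (Sum.elim a b))).det *
      eval₂ φ (Sum.elim a b) q ^ Fintype.card ι''))
  have h11 : x * r * (jacobian φ (Sum.elim a b) Sum.inl k * jacobian φ c v l *
      (eval₂ φ (Sum.elim a b) q ^ Fintype.card (κ ⊕ ι') *
        eval₂ φ (Sum.elim a b) q ^ Fintype.card ι'')) =
      x * (jacobian φ (Sum.elim a b) Sum.inr h * jacobian φ c v l) *
      ((M.map (eval₂ φ (Sum.elim a b))).det * eval₂ φ (Sum.elim a b) q ^ Fintype.card ι'') := by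
    linear_combination (x * jacobian φ c v l * eval₂ φ (Sum.elim a b) q ^ Fintype.card ι'') * hreq
  rw [h11, ← mul_assoc y]
  refine h9.trans (EqUpToSign.trans (Or.inl ?_) h10)
  rw [mul_comm, h7, mul_comm]

/-- Ratios of canonical forms are multiplicative, up to sign. -/
theorem IsRatio.eqUpToSign_mul {ι'' κ'' : Type} [Fintype ι''] [DecidableEq ι''] [Fintype κ'']
    [DecidableEq κ''] {d : ι'' → L} {l : κ'' → MvPolynomial ι'' R} {r' r'' : L}
    (hf : IsSeparableFrame φ a f) (hg : IsSeparableFrame φ b g) (hl : IsSeparableFrame φ d l)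
    (hd : EssentiallyGenerates φ d) (h : IsRatio φ a f b g r) (h' : IsRatio φ b g d l r')
    (h'' : IsRatio φ a f d l r'') : EqUpToSign r'' (r * r') := by
  classical
  let c : ι ⊕ ι' ⊕ ι'' → L := Sum.elim a (Sum.elim b d)
  let s : ι → ι ⊕ ι' ⊕ ι'' := Sum.inl
  let t : ι' → ι ⊕ ι' ⊕ ι'' := Sum.inr ∘ Sum.inl
  let v : ι'' → ι ⊕ ι' ⊕ ι'' := Sum.inr ∘ Sum.inr
  have hc : EssentiallyGenerates φ c := hd.extend (s := v) fun _ => rfl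
  have h1 : Function.Bijective (Sum.elim s (Sum.elim t v)) := by
    convert Function.bijective_id using 1
    funext i
    rcases i with i | i | i <;> rfl
  have h2 : Function.Bijective (Sum.elim s (Sum.elim v t)) := by
    convert (Equiv.sumCongr (.refl ι) (Equiv.sumComm ι'' ι')).bijective using 1
    funext i
    rcases i with i | i | i <;> rfl
  have h3 : Function.Bijective (Sum.elim t (Sum.elim v s)) := by
    convert ((Equiv.sumAssoc ι' ι'' ι).symm.trans (Equiv.sumComm _ _)).bijective using 1
    funext i
    rcases i with i | i | i <;> rfl
  have h4 : Function.Bijective (Sum.elim v (Sum.elim s t)) := by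
    convert ((Equiv.sumComm ι'' (ι ⊕ ι')).trans (Equiv.sumAssoc _ _ _)).bijective using 1
    funext i
    rcases i with i | i | i <;> rfl
  -- One volume form on the conormal space of the joint tuple (a, b, d) measures all three forms,
  -- and each ratio is a quotient of two of the scales up to sign.
  obtain ⟨W, hW, -⟩ := hf.exists_dualBasis (c := c) (fun _ => rfl) h1 hc
  obtain ⟨x, hx⟩ := hf.exists_scale (c := c) (fun _ => rfl) h1 hc hW
  obtain ⟨y, hy⟩ := hg.exists_scale (c := c) (fun _ => rfl) h3 hc hW
  obtain ⟨z, hz⟩ := hl.exists_scale (c := c) (fun _ => rfl) h4 hc hW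
  have e1 := h.eqUpToSign_scale hf hg hW hc (fun _ => rfl) (fun _ => rfl) h1 hx hy
  have e2 := h'.eqUpToSign_scale hg hl hW hc (fun _ => rfl) (fun _ => rfl) h3 hy hz
  have e3 := h''.eqUpToSign_scale hf hl hW hc (fun _ => rfl) (fun _ => rfl) h2 hx hz
  have e4 := e3.symm.trans (e2.trans (e1.mul .rfl'))
  rw [mul_comm x r'', mul_assoc, mul_comm x] at e4
  exact e4.of_mul_right hx.1

/-- A ratio is, up to sign, a quotient of two scales, and scales are nonzero. Here no coordinates
lie outside the two tuples, so the third index type is `Empty`. -/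
theorem IsRatio.ne_zero (hf : IsSeparableFrame φ a f) (hg : IsSeparableFrame φ b g)
    (hb : EssentiallyGenerates φ b) (h : IsRatio φ a f b g r) : r ≠ 0 := by
  classical
  let c : ι ⊕ ι' → L := Sum.elim a b
  have hc : EssentiallyGenerates φ c := hb.extend (s := Sum.inr) fun _ => rfl
  have hbij : Function.Bijective (Sum.elim (Sum.inl : ι → ι ⊕ ι') Sum.inr) := by
    rw [Sum.elim_inl_inr]
    exact Function.bijective_id
  have hbij' : Function.Bijective (Sum.elim (Sum.inr : ι' → ι ⊕ ι') Sum.inl) :=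
    (Equiv.sumComm ι' ι).bijective
  have hbij'' : Function.Bijective (Sum.elim (Sum.inl : ι → ι ⊕ ι')
      (Sum.elim Sum.inr (Empty.elim : Empty → ι ⊕ ι'))) := by
    convert (Equiv.sumCongr (.refl ι) (Equiv.sumEmpty ι' Empty)).bijective using 1
    funext i
    rcases i with i | i | i
    · rfl
    · rfl
    · exact i.elim
  obtain ⟨W, hW, -⟩ := hf.exists_dualBasis (c := c) (fun _ => rfl) hbij hc
  obtain ⟨x, hx⟩ := hf.exists_scale (c := c) (fun _ => rfl) hbij hc hW
  obtain ⟨y, hy⟩ := hg.exists_scale (c := c) (fun _ => rfl) hbij' hc hW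
  have e1 := h.eqUpToSign_scale hf hg hW hc (fun _ => rfl) (fun _ => rfl) hbij'' hx hy
  rintro rfl
  rcases e1 with e | e <;> simp [hy.1] at e

end Ratio

end QuotientRamification

namespace QuotientRamification

open MvPolynomial

/-! ### Localization of frames -/

section Localization

lemma eval₂_map_comp {R R' A A' : Type u} [CommRing R] [CommRing R'] [CommRing A] [CommRing A']
    {ι : Type} {φ : R →+* A} {φ' : R' →+* A'} {θ : R →+* R'} {j : A →+* A'}
    (hcomp : ∀ r, φ' (θ r) = j (φ r)) {a : ι → A} (g : MvPolynomial ι R) :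
    eval₂ φ' (fun i => j (a i)) (map θ g) = j (eval₂ φ a g) := by
  rw [eval₂_map, hom_eval₂]
  congr 1
  ext r
  simp [hcomp]

lemma map_mem_relations {R R' A A' : Type u} [CommRing R] [CommRing R'] [CommRing A] [CommRing A']
    {ι : Type} {φ : R →+* A} {φ' : R' →+* A'} {θ : R →+* R'} {j : A →+* A'}
    (hcomp : ∀ r, φ' (θ r) = j (φ r)) {a : ι → A} {g : MvPolynomial ι R}
    (hg : g ∈ relations φ a) : map θ g ∈ relations φ' (fun i => j (a i)) := by
  rw [mem_relations, eval₂_map_comp hcomp, mem_relations.1 hg, map_zero]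

lemma map_mem_relations_sq {R R' A A' : Type u} [CommRing R] [CommRing R'] [CommRing A]
    [CommRing A'] {ι : Type} {φ : R →+* A} {φ' : R' →+* A'} {θ : R →+* R'} {j : A →+* A'}
    (hcomp : ∀ r, φ' (θ r) = j (φ r)) {a : ι → A} {g : MvPolynomial ι R}
    (hg : g ∈ relations φ a ^ 2) : map θ g ∈ relations φ' (fun i => j (a i)) ^ 2 := by
  have hle : (relations φ a).map (map θ) ≤ relations φ' (fun i => j (a i)) :=
    Ideal.map_le_iff_le_comap.2 fun g hg => map_mem_relations hcomp hg
  have := Ideal.mem_map_of_mem (map θ : MvPolynomial ι R →+* MvPolynomial ι R') hg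
  rw [Ideal.map_pow] at this
  exact Ideal.pow_right_mono hle 2 this

variable {R R' A A' : Type u} [CommRing R] [CommRing R'] [Algebra R R'] [CommRing A] [CommRing A']

/-- A conormal frame stays a conormal frame under localization. -/
theorem IsConormalFrame.localize (M : Submonoid R) [IsLocalization M R'] {ι κ : Type} [Fintype κ]
    {φ : R →+* A} {φ' : R' →+* A'} {j : A →+* A'} (hj : Function.Injective j)
    (hcomp : ∀ r, φ' (algebraMap R R' r) = j (φ r)) {a : ι → A} {f : κ → MvPolynomial ι R}
    (hf : IsConormalFrame φ a f) :
    IsConormalFrame φ' (fun i => j (a i)) (fun k => map (algebraMap R R') (f k)) := by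
  let : Algebra (MvPolynomial ι R) (MvPolynomial ι R') := algebraMvPolynomial
  have hloc : IsLocalization (M.map (C : R →+* MvPolynomial ι R)) (MvPolynomial ι R') :=
    MvPolynomial.isLocalization M R'
  have halg : algebraMap (MvPolynomial ι R) (MvPolynomial ι R') = map (algebraMap R R') := rfl
  have hmem : ∀ g : MvPolynomial ι R, map (algebraMap R R') g ∈ relations φ' (fun i => j (a i)) →
      g ∈ relations φ a := by
    intro g hg
    rw [mem_relations, eval₂_map_comp hcomp] at hg
    exact mem_relations.2 (hj (by rw [hg, map_zero]))
  have hclear : ∀ g : MvPolynomial ι R', ∃ (w : R) (g₀ : MvPolynomial ι R),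
      IsUnit (algebraMap R R' w) ∧ C (algebraMap R R' w) * g = map (algebraMap R R') g₀ := by
    intro g
    obtain ⟨⟨g₀, w, hw⟩, h⟩ := IsLocalization.surj (M.map (C : R →+* MvPolynomial ι R)) g
    obtain ⟨w, hwM, rfl⟩ := hw
    refine ⟨w, g₀, IsLocalization.map_units R' (⟨w, hwM⟩ : M), ?_⟩
    rw [halg] at h
    rw [mul_comm, ← h]
    simp
  -- After multiplication by a unit, a polynomial over `R'` comes from `R`, and injectivity of `j`
  -- makes it a relation there.
  have hle : relations φ' (fun i => j (a i)) ≤ (relations φ a).map (map (algebraMap R R')) := by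
    intro g hg
    obtain ⟨w, g₀, hw, h⟩ := hclear g
    rw [← Ideal.unit_mul_mem_iff_mem _ (hw.map C), h]
    refine Ideal.mem_map_of_mem _ (hmem _ ?_)
    rw [← h]
    exact Ideal.mul_mem_left _ _ hg
  refine ⟨fun k => map_mem_relations hcomp (hf.mem k), fun g hg => ?_, fun d hd k => ?_⟩
  · obtain ⟨w, g₀, hw, h⟩ := hclear g
    obtain ⟨q, hq, hqg⟩ := hf.span g₀ (hmem _ (by rw [← h]; exact Ideal.mul_mem_left _ _ hg))
    refine ⟨map (algebraMap R R') q, ?_, ?_⟩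
    · rw [eval₂_map_comp hcomp]
      exact hq.map j
    · rw [← Ideal.unit_mul_mem_iff_mem _ (hw.map C), mul_left_comm, h, ← map_mul]
      obtain ⟨x, hx, y, hy, hxy⟩ := Submodule.mem_sup.1 hqg
      obtain ⟨d, rfl⟩ := Ideal.mem_span_range_iff_exists_fun.1 hx
      rw [← hxy, map_add, map_sum]
      refine add_mem (Ideal.mem_sup_left (Ideal.sum_mem _ fun k _ => ?_))
        (Ideal.mem_sup_right (map_mem_relations_sq hcomp hy))
      rw [map_mul]
      exact Ideal.mul_mem_left _ _ (Ideal.subset_span ⟨k, rfl⟩)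
  · obtain ⟨w, hw⟩ := IsLocalization.exist_integer_multiples_of_finite
      (M.map (C : R →+* MvPolynomial ι R)) d
    choose d₀ hd₀ using hw
    obtain ⟨w, ⟨w, hwM, rfl⟩⟩ := w
    have hwu := IsLocalization.map_units R' (⟨w, hwM⟩ : M)
    have hd₁ : ∀ k, map (algebraMap R R') (d₀ k) = C (algebraMap R R' w) * d k := by
      intro k
      rw [← halg, hd₀, Algebra.smul_def, halg]
      simp
    have h1 : algebraMap (MvPolynomial ι R) (MvPolynomial ι R') (∑ k, d₀ k * f k) ∈
        (relations φ a ^ 2).map (algebraMap (MvPolynomial ι R) (MvPolynomial ι R')) := by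
      rw [Ideal.map_pow]
      refine Ideal.pow_right_mono hle 2 ?_
      have : algebraMap (MvPolynomial ι R) (MvPolynomial ι R') (∑ k, d₀ k * f k) =
          C (algebraMap R R' w) * ∑ k, d k * map (algebraMap R R') (f k) := by
        rw [halg, map_sum, Finset.mul_sum]
        refine Finset.sum_congr rfl fun k _ => ?_
        rw [map_mul, hd₁, mul_assoc]
      rw [this]
      exact Ideal.mul_mem_left _ _ hd
    rw [IsLocalization.algebraMap_mem_map_algebraMap_iff (M.map (C : R →+* MvPolynomial ι R))] at h1
    obtain ⟨_, ⟨v, hv, rfl⟩, h2⟩ := h1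
    rw [Finset.mul_sum] at h2
    simp only [← mul_assoc] at h2
    have h3 := congrArg j (hf.indep _ h2 k)
    rw [← eval₂_map_comp hcomp, map_mul, hd₁, map_zero] at h3
    have hvu := IsLocalization.map_units R' (⟨v, hv⟩ : M)
    have : map (algebraMap R R') (C v : MvPolynomial ι R) = C (algebraMap R R' v) := map_C _ _
    erw [this] at h3
    rw [eval₂_mul, eval₂_mul, eval₂_C, eval₂_C, (hvu.map φ').mul_right_eq_zero,
      (hwu.map φ').mul_right_eq_zero] at h3
    exact h3

lemma EssentiallyGenerates.localize {K : Type u} [Field K] {ι : Type} {φ : R →+* A} {φ' : R' →+* K}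
    {j : A →+* K} (hj : Function.Injective j) (hfrac : ∀ z, ∃ x y, y ≠ 0 ∧ z * j y = j x)
    (hcomp : ∀ r, φ' (algebraMap R R' r) = j (φ r)) {a : ι → A}
    (ha : EssentiallyGenerates φ a) : EssentiallyGenerates φ' (fun i => j (a i)) := by
  intro z
  obtain ⟨x, y, hy, hz⟩ := hfrac z
  obtain ⟨p, q, hq, hp⟩ := ha x
  obtain ⟨p', q', hq', hp'⟩ := ha y
  refine ⟨map (algebraMap R R') (p * q'), map (algebraMap R R') (p' * q), ?_, ?_⟩
  · rw [eval₂_map_comp hcomp, eval₂_mul, ← hp', isUnit_iff_ne_zero, Ne, map_eq_zero_iff j hj]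
    intro h
    rw [hq.mul_left_eq_zero, hq'.mul_left_eq_zero] at h
    exact hy h
  · rw [eval₂_map_comp hcomp, eval₂_map_comp hcomp, eval₂_mul, eval₂_mul, ← hp', ← hp]
    simp only [map_mul]
    linear_combination (j (eval₂ φ a q') * j (eval₂ φ a q)) * hz

end Localization

/-! ### Ratios under a change of rings -/

section RatioMap

variable {R R' A A' : Type u} [CommRing R] [CommRing R'] [CommRing A] [CommRing A']

theorem IsRatio.map {φ : R →+* A} {φ' : R' →+* A'} {θ : R →+* R'} {j : A →+* A'}
    (hj : Function.Injective j) (hcomp : ∀ r, φ' (θ r) = j (φ r))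
    {ι κ ι' κ' : Type} [Fintype ι] [DecidableEq ι] [Fintype κ] [DecidableEq κ] [Fintype ι']
    [DecidableEq ι'] {a : ι → A} {f : κ → MvPolynomial ι R} {b : ι' → A}
    {g : κ' → MvPolynomial ι' R} {r : A} (h : IsRatio φ a f b g r) :
    IsRatio φ' (fun i => j (a i)) (fun k => MvPolynomial.map θ (f k)) (fun i => j (b i))
      (fun k => MvPolynomial.map θ (g k)) (j r) := by
  obtain ⟨h, k, e, q, M, hh, hk, hhj, hkj, hq, hM, hr⟩ := h
  have hab : Sum.elim (fun i => j (a i)) (fun i => j (b i)) = fun i => j (Sum.elim a b i) := by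
    funext i
    rcases i with i | i <;> rfl
  have hjac : ∀ {n : Type} [Fintype n] [DecidableEq n] (s : n → ι ⊕ ι')
      (p : n → MvPolynomial (ι ⊕ ι') R),
      jacobian φ' (fun i => j (Sum.elim a b i)) s (fun i => MvPolynomial.map θ (p i)) =
        j (jacobian φ (Sum.elim a b) s p) := by
    intro n _ _ s p
    rw [jacobian, jacobian, RingHom.map_det]
    congr 1
    ext i l
    simp only [Matrix.of_apply, RingHom.mapMatrix_apply, Matrix.map_apply]
    rw [pderiv_map, eval₂_map_comp hcomp]
  refine ⟨fun i => MvPolynomial.map θ (h i), fun i => MvPolynomial.map θ (k i), e,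
    MvPolynomial.map θ q, M.map (MvPolynomial.map θ), ?_⟩
  rw [hab]
  refine ⟨fun i => map_mem_relations hcomp (hh i), fun i => map_mem_relations hcomp (hk i), ?_, ?_,
    ?_, fun i => ?_, ?_⟩
  · rwa [hjac, Ne, map_eq_zero_iff j hj]
  · rwa [hjac, Ne, map_eq_zero_iff j hj]
  · rwa [eval₂_map_comp hcomp, Ne, map_eq_zero_iff j hj]
  · have := map_mem_relations_sq (θ := θ) (j := j) hcomp (hM i)
    convert this using 1
    rw [map_sub, map_mul, map_sum]
    congr 1
    · congr 1
      rcases e i with l | l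
      · simp [map_rename]
      · rfl
    · refine Finset.sum_congr rfl fun l _ => ?_
      rw [map_mul]
      rcases l with l | l
      · simp [map_rename]
      · rfl
  · rw [hjac, hjac, eval₂_map_comp hcomp, ← map_pow, ← map_mul, ← map_mul, hr, map_mul]
    congr 1
    rw [RingHom.map_det]
    congr 1
    ext i l
    simp only [RingHom.mapMatrix_apply, Matrix.map_apply]
    rw [eval₂_map_comp hcomp]

end RatioMap

end QuotientRamification

namespace QuotientRamification

open MvPolynomial

/-! ### The effect of one additional root on the canonical form -/

section AdjoinRatio

variable {R L : Type u} [CommRing R] [CommRing L] [Nontrivial L]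

/-- Comparison of the canonical forms `[da/f]` and `[da dz/(f, g)]`. -/
theorem isRatio_adjoin {φ : R →+* L} {ι κ ι' κ' : Type} [Fintype ι] [DecidableEq ι] [Fintype κ]
    [DecidableEq κ] [Fintype ι'] [DecidableEq ι'] (e : ι ⊕ Unit ≃ ι') (e' : κ ⊕ Unit ≃ κ')
    {a : ι → L} {z : L} {f : κ → MvPolynomial ι R}
    {g : MvPolynomial (ι ⊕ Unit) R} (hg : g ∈ relations φ (Sum.elim a fun _ => z))
    (hz : eval₂ φ (Sum.elim a fun _ => z) (pderiv (Sum.inr ()) g) ≠ 0) :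
    ∃ r, IsRatio φ a f (Sum.elim a (fun _ => z) ∘ e.symm)
      (fun k => rename e (Sum.elim (fun k => rename Sum.inl (f k)) (fun _ => g) (e'.symm k))) r ∧
      EqUpToSign r (eval₂ φ (Sum.elim a fun _ => z) (pderiv (Sum.inr ()) g)) := by
  classical
  let b : ι' → L := Sum.elim a (fun _ => z) ∘ e.symm
  let c : ι ⊕ ι' → L := Sum.elim a b
  -- The second tuple repeats `a`, and the relations `d` identify the two copies. With h = (d, g)
  -- and k = -d the two Jacobians are ∂g/∂z and 1.
  let d : ι → MvPolynomial (ι ⊕ ι') R := fun i => X (Sum.inr (e (Sum.inl i))) - X (Sum.inl i)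
  let g' : MvPolynomial (ι ⊕ ι') R := rename (Sum.inr ∘ e) g
  let h : ι' → MvPolynomial (ι ⊕ ι') R := fun i => Sum.elim d (fun _ => g') (e.symm i)
  let k : ι → MvPolynomial (ι ⊕ ι') R := fun i => - d i
  have hd : ∀ i, d i ∈ relations φ c := by
    intro i
    simp [d, mem_relations, c, b]
  have hce : c ∘ (Sum.inr ∘ e) = Sum.elim a fun _ => z := by
    funext i
    simp [c, b]
  have hg' : g' ∈ relations φ c := by
    rw [mem_relations, eval₂_rename, hce]
    exact hg
  have hh : ∀ i, h i ∈ relations φ c := by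
    intro i
    simp only [h]
    rcases e.symm i with i | i
    · exact hd i
    · exact hg'
  have hk : ∀ i, k i ∈ relations φ c := fun i => neg_mem (hd i)
  have hinj : Function.Injective ((Sum.inr : ι' → ι ⊕ ι') ∘ e) :=
    Sum.inr_injective.comp e.injective
  have hjk : jacobian φ c Sum.inl k = 1 := by
    rw [jacobian]
    convert Matrix.det_one (n := ι) (R := L)
    ext i j
    rw [Matrix.of_apply, Matrix.one_apply]
    by_cases hij : i = j
    · subst hij
      simp [k, d, pderiv_X]
    · simp [k, d, pderiv_X, hij, Ne.symm hij]
  have hjh : jacobian φ c Sum.inr h =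
      eval₂ φ (Sum.elim a fun _ => z) (pderiv (Sum.inr ()) g) := by
    rw [jacobian, ← Matrix.det_submatrix_equiv_self e]
    have : (Matrix.of fun i j => eval₂ φ c (pderiv (Sum.inr i) (h j))).submatrix e e =
        Matrix.fromBlocks 1 (Matrix.of fun i _ => eval₂ φ c (pderiv (Sum.inr (e (Sum.inl i))) g'))
          0 (Matrix.of fun _ _ : Unit => eval₂ φ (Sum.elim a fun _ => z) (pderiv (Sum.inr ()) g)) := by
      ext (i | i) (j | j)
      · rw [Matrix.submatrix_apply, Matrix.of_apply, Matrix.fromBlocks_apply₁₁, Matrix.one_apply]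
        by_cases hij : i = j
        · subst hij
          simp [h, d, pderiv_X]
        · have : e (Sum.inl i) ≠ e (Sum.inl j) := by simpa using hij
          simp [h, d, pderiv_X, hij, Ne.symm hij]
      · simp [h]
      · simp [h, d, pderiv_X]
      · have h1 : pderiv (Sum.inr (e (Sum.inr j))) g' =
            rename (Sum.inr ∘ e) (pderiv (Sum.inr j) g) :=
          pderiv_rename hinj (Sum.inr j) g
        have h2 : c ∘ (Sum.inr ∘ e) = Sum.elim a fun _ => z := hce
        simp only [Matrix.submatrix_apply, Matrix.of_apply, h, Equiv.symm_apply_apply,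
          Sum.elim_inr, Matrix.fromBlocks_apply₂₂]
        rw [h1, eval₂_rename, h2]
    rw [this, Matrix.det_fromBlocks_zero₂₁, Matrix.det_one, one_mul, Matrix.det_unique]
    rfl
  -- first order expansion
  let T := MvPolynomial (ι ⊕ ι') R ⧸ relations φ c ^ 2
  have taylor : ∀ p : MvPolynomial ι R,
      rename (fun i => Sum.inr (e (Sum.inl i))) p -
        (rename Sum.inl p + ∑ i, rename Sum.inl (pderiv i p) * d i) ∈ relations φ c ^ 2 := by
    intro p
    have h1 := sub_eq_sum_pderiv_mul (T := T) (C : R →+* MvPolynomial ι R) (X : ι → MvPolynomial ι R)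
      ((Ideal.Quotient.mk (relations φ c ^ 2)).comp
        (rename (R := R) fun i => Sum.inr (e (Sum.inl i))).toRingHom)
      ((Ideal.Quotient.mk (relations φ c ^ 2)).comp
        (rename (R := R) (Sum.inl : ι → ι ⊕ ι')).toRingHom)
      (fun r => by simp) (fun t t' => by
        have : d t * d t' ∈ relations φ c ^ 2 := by
          rw [pow_two]
          exact Ideal.mul_mem_mul (hd t) (hd t')
        rw [← Ideal.Quotient.eq_zero_iff_mem] at this
        simpa [d] using this) p
    rw [← Ideal.Quotient.eq]
    simp only [eval₂_eta] at h1
    rw [map_add, map_sum, ← sub_eq_iff_eq_add']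
    simpa [d] using h1
  let E : κ ⊕ ι' ≃ κ' ⊕ ι :=
    (Equiv.sumCongr (.refl κ) (e.symm.trans (Equiv.sumComm ι Unit))).trans
      ((Equiv.sumAssoc κ Unit ι).symm.trans (Equiv.sumCongr e' (.refl ι)))
  -- Modulo squares, `f` in the second copy of `a` is `f` in the first copy plus ∑ (∂f/∂t_i) d_i;
  -- moreover k = -d, and g is unchanged. The transition matrix is therefore block triangular of
  -- determinant ±1.
  let M₀ : Matrix (κ ⊕ ι ⊕ Unit) (κ ⊕ ι ⊕ Unit) (MvPolynomial (ι ⊕ ι') R) :=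
    Matrix.fromBlocks 1 (Matrix.of fun j i =>
      Sum.elim (fun i => rename Sum.inl (pderiv i (f j))) (fun _ => 0) i) 0
      (Matrix.fromBlocks (-1) 0 0 1)
  let ε : κ ⊕ ι' ≃ κ ⊕ ι ⊕ Unit := Equiv.sumCongr (.refl κ) e.symm
  let M := M₀.submatrix ε ε
  have hM : EqUpToSign (M.map (eval₂ φ c)).det 1 := by
    have : (M.map (eval₂ φ c)).det = eval₂Hom φ c M₀.det := by
      have h1 := RingHom.map_det (eval₂Hom φ c) M
      rw [Matrix.det_submatrix_equiv_self] at h1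
      exact h1.symm
    rw [this, Matrix.det_fromBlocks_zero₂₁, Matrix.det_one, one_mul, Matrix.det_fromBlocks_zero₂₁,
      Matrix.det_one, mul_one, Matrix.det_neg, Matrix.det_one, mul_one, map_pow, map_neg, map_one]
    exact neg_one_pow_eq_or L _
  refine ⟨(M.map (eval₂ φ c)).det * jacobian φ c Sum.inr h,
    ⟨h, k, E, 1, M, hh, hk, ?_, ?_, ?_, ?_, ?_⟩, ?_⟩
  · change jacobian φ c Sum.inr h ≠ 0
    rwa [hjh]
  · change jacobian φ c Sum.inl k ≠ 0
    rw [hjk]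
    exact one_ne_zero
  · rw [eval₂_one]
    exact one_ne_zero
  · intro i
    change _ ∈ relations φ c ^ 2
    rw [one_mul, ← ε.symm.sum_comp, Fintype.sum_sum_type, Fintype.sum_sum_type]
    rcases i with j | i
    · have h1 := taylor (f j)
      simpa [E, M, M₀, ε, Matrix.one_apply, rename_rename, Function.comp_def, h] using h1
    · obtain ⟨i, rfl⟩ := e.surjective i
      rcases i with i | i
      · simp [E, M, M₀, ε, Matrix.one_apply, h, k]
      · simp [E, M, M₀, ε, h, g', rename_rename]
  · change _ * jacobian φ c Sum.inl k * _ = _ * jacobian φ c Sum.inr h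
    rw [hjk, mul_one, eval₂_one, one_pow, mul_one]
  · rw [← hjh]
    have := hM.mul (.rfl' (x := jacobian φ c Sum.inr h))
    rwa [one_mul] at this

end AdjoinRatio

end QuotientRamification

namespace QuotientRamification

open MvPolynomial

/-! ### Conormal frames of an algebra generated by one root -/

section Adjoin

variable {R A B : Type u} [CommRing R] [CommRing A] [CommRing B]

lemma EssentiallyGenerates.exists_polynomial {ι : Type} {φ : R →+* A} {a : ι → A}
    (ha : EssentiallyGenerates φ a) (p : Polynomial A) :
    ∃ (q : MvPolynomial ι R) (m : Polynomial (MvPolynomial ι R)), IsUnit (eval₂ φ a q) ∧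
      m.map (eval₂Hom φ a) = Polynomial.C (eval₂ φ a q) * p := by
  induction p using Polynomial.induction_on' with
  | add p p' hp hp' =>
    obtain ⟨q, m, hq, hm⟩ := hp
    obtain ⟨q', m', hq', hm'⟩ := hp'
    refine ⟨q * q', Polynomial.C q' * m + Polynomial.C q * m', ?_, ?_⟩
    · rw [eval₂_mul]
      exact hq.mul hq'
    · simp only [Polynomial.map_add, Polynomial.map_mul, Polynomial.map_C, hm, hm', eval₂_mul,
        Polynomial.C_mul, coe_eval₂Hom]
      ring
  | monomial n z =>
    obtain ⟨p, q, hq, h⟩ := ha z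
    refine ⟨q, Polynomial.monomial n p, hq, ?_⟩
    rw [Polynomial.map_monomial, coe_eval₂Hom, ← h, Polynomial.C_mul_monomial, mul_comm]

/-- A polynomial in one variable over a polynomial ring, as a polynomial in one more variable. -/
noncomputable def ofIterated (R : Type u) [CommRing R] (ι : Type) :
    Polynomial (MvPolynomial ι R) →+* MvPolynomial (ι ⊕ Unit) R :=
  Polynomial.eval₂RingHom (rename (R := R) Sum.inl).toRingHom (X (Sum.inr ()))

lemma ofIterated_surjective (ι : Type) : Function.Surjective (ofIterated R ι) := by
  intro g
  induction g using MvPolynomial.induction_on with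
  | C r => exact ⟨Polynomial.C (C r), by simp [ofIterated]⟩
  | add p q hp hq =>
    obtain ⟨p, rfl⟩ := hp
    obtain ⟨q, rfl⟩ := hq
    exact ⟨p + q, map_add _ _ _⟩
  | mul_X p i hp =>
    obtain ⟨p, rfl⟩ := hp
    rcases i with i | i
    · exact ⟨p * Polynomial.C (X i), by simp [ofIterated]⟩
    · exact ⟨p * Polynomial.X, by simp [ofIterated]⟩

lemma eval₂_ofIterated {ι : Type} {φ : R →+* A} {i : A →+* B} {a : ι → A} {z : B}
    (m : Polynomial (MvPolynomial ι R)) :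
    eval₂ (i.comp φ) (Sum.elim (fun k => i (a k)) fun _ => z) (ofIterated R ι m) =
      (m.map (eval₂Hom φ a)).eval₂ i z := by
  rw [← coe_eval₂Hom, ofIterated, Polynomial.coe_eval₂RingHom, Polynomial.hom_eval₂,
    Polynomial.eval₂_map]
  congr 1
  · refine ringHom_ext (fun r => ?_) (fun k => ?_) <;> simp
  · simp

lemma pderiv_ofIterated {ι : Type} (m : Polynomial (MvPolynomial ι R)) :
    pderiv (Sum.inr ()) (ofIterated R ι m) = ofIterated R ι m.derivative := by
  have := pderiv_eval₂_rename (s := (Sum.inl : ι → ι ⊕ Unit)) (t := Sum.inr ()) (t' := Sum.inr ())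
    (by simp) m
  rw [pderiv_X_self, mul_one] at this
  exact this

/-- A conormal frame of the algebra `B`, which is essentially generated over `A` by a root `z` of
a polynomial `H` which generates the ideal of relations of `z` over `A`. -/
theorem IsConormalFrame.adjoin {K L : Type u} [Field K] [Field L] [Algebra K L]
    [FiniteDimensional K L] [Algebra.IsSeparable K L] {φ : R →+* A} {i : A →+* B} {jA : A →+* K}
    {jB : B →+* L} (hjA : Function.Injective jA) (hjB : Function.Injective jB)
    (hfracA : ∀ z, ∃ x y, y ≠ 0 ∧ z * jA y = jA x) (hfracB : ∀ z, ∃ x y, y ≠ 0 ∧ z * jB y = jB x)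
    (hcomm : ∀ x, algebraMap K L (jA x) = jB (i x)) {ι κ : Type} [Finite ι] [Fintype κ] {a : ι → A}
    (ha : EssentiallyGenerates φ a) {f : κ → MvPolynomial ι R} (hf : IsConormalFrame φ a f) {z : B}
    {H : Polynomial A} (hz : H.eval₂ i z = 0) (hmin : ∀ p : Polynomial A, p.eval₂ i z = 0 → H ∣ p)
    (hder : H.derivative.eval₂ i z ≠ 0)
    (hgen : ∀ b : B, ∃ P Q : Polynomial A, IsUnit (Q.eval₂ i z) ∧
      b * Q.eval₂ i z = P.eval₂ i z) :
    EssentiallyGenerates (i.comp φ) (Sum.elim (fun k => i (a k)) fun _ : Unit => z) ∧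
    ∃ (g : MvPolynomial (ι ⊕ Unit) R) (w : A), IsUnit w ∧
      eval₂ (i.comp φ) (Sum.elim (fun k => i (a k)) fun _ => z) (pderiv (Sum.inr ()) g) =
        i w * H.derivative.eval₂ i z ∧
      IsConormalFrame (i.comp φ) (Sum.elim (fun k => i (a k)) fun _ => z)
        (Sum.elim (fun k => rename Sum.inl (f k)) fun _ : Unit => g) := by
  classical
  let c : ι ⊕ Unit → B := Sum.elim (fun k => i (a k)) fun _ => z
  have hc : EssentiallyGenerates (i.comp φ) c := by
    intro b
    obtain ⟨P, Q, hQ, hb⟩ := hgen b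
    obtain ⟨q, m, hq, hm⟩ := ha.exists_polynomial P
    obtain ⟨q', m', hq', hm'⟩ := ha.exists_polynomial Q
    refine ⟨ofIterated R ι (m * Polynomial.C q'), ofIterated R ι (m' * Polynomial.C q), ?_, ?_⟩
    · rw [eval₂_ofIterated, Polynomial.map_mul, hm', Polynomial.map_C, Polynomial.eval₂_mul,
        Polynomial.eval₂_mul, Polynomial.eval₂_C, Polynomial.eval₂_C]
      exact ((hq'.map i).mul hQ).mul (hq.map i)
    · rw [eval₂_ofIterated, eval₂_ofIterated, Polynomial.map_mul, Polynomial.map_mul, hm, hm',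
        Polynomial.map_C, Polynomial.map_C]
      simp only [Polynomial.eval₂_mul, Polynomial.eval₂_C, coe_eval₂Hom]
      linear_combination (i (eval₂ φ a q') * i (eval₂ φ a q)) * hb
  refine ⟨hc, ?_⟩
  obtain ⟨q, m, hq, hm⟩ := ha.exists_polynomial H
  have hgrel : ofIterated R ι m ∈ relations (i.comp φ) c := by
    rw [mem_relations, eval₂_ofIterated, hm, Polynomial.eval₂_mul, hz, mul_zero]
  have hgder : eval₂ (i.comp φ) c (pderiv (Sum.inr ()) (ofIterated R ι m)) =
      i (eval₂ φ a q) * H.derivative.eval₂ i z := by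
    rw [pderiv_ofIterated, eval₂_ofIterated, ← Polynomial.derivative_map, hm,
      Polynomial.derivative_C_mul, Polynomial.eval₂_mul, Polynomial.eval₂_C]
  refine ⟨ofIterated R ι m, eval₂ φ a q, hq, hgder, ?_⟩
  have hrename : ∀ p ∈ relations φ a, rename Sum.inl p ∈ relations (i.comp φ) c := by
    intro p hp
    rw [mem_relations, eval₂_rename]
    have : eval₂ (i.comp φ) (c ∘ Sum.inl) p = i (eval₂ φ a p) := by
      rw [hom_eval₂]
      rfl
    rw [this, mem_relations.1 hp, map_zero]
  have hmem : ∀ j : κ ⊕ Unit, Sum.elim (fun k => rename Sum.inl (f k))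
      (fun _ : Unit => ofIterated R ι m) j ∈ relations (i.comp φ) c := by
    rintro (k | k)
    · exact hrename _ (hf.mem k)
    · exact hgrel
  refine ⟨hmem, ?_, ?_⟩
  · -- spanning
    let J := Ideal.span (Set.range (Sum.elim (fun k => rename Sum.inl (f k))
      (fun _ : Unit => ofIterated R ι m))) ⊔ relations (i.comp φ) c ^ 2
    change ∀ g ∈ relations (i.comp φ) c, ∃ q, IsUnit (eval₂ (i.comp φ) c q) ∧ q * g ∈ J
    have hA : ∀ p ∈ (relations φ a).map (rename (R := R) (Sum.inl : ι → ι ⊕ Unit)).toRingHom,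
        ∃ q, IsUnit (eval₂ (i.comp φ) c q) ∧ q * p ∈ J := by
      intro p hp
      refine Submodule.span_induction (p := fun p _ =>
        ∃ q, IsUnit (eval₂ (i.comp φ) c q) ∧ q * p ∈ J) ?_ ?_ ?_ ?_ hp
      · rintro _ ⟨u, hu, rfl⟩
        obtain ⟨q, hq, hqu⟩ := hf.span u hu
        refine ⟨rename Sum.inl q, ?_, ?_⟩
        · have : eval₂ (i.comp φ) c (rename Sum.inl q) = i (eval₂ φ a q) := by
            rw [eval₂_rename, hom_eval₂]
            rfl
          rw [this]
          exact hq.map i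
        · change _ * rename Sum.inl u ∈ _
          rw [← map_mul]
          obtain ⟨x, hx, y, hy, hxy⟩ := Submodule.mem_sup.1 hqu
          obtain ⟨d, rfl⟩ := Ideal.mem_span_range_iff_exists_fun.1 hx
          rw [← hxy, map_add, map_sum]
          refine add_mem (Ideal.mem_sup_left (Ideal.sum_mem _ fun k _ => ?_))
            (Ideal.mem_sup_right ?_)
          · rw [map_mul]
            exact Ideal.mul_mem_left _ _ (Ideal.subset_span ⟨Sum.inl k, rfl⟩)
          · have h2 : (relations φ a).map (rename (R := R) (Sum.inl : ι → ι ⊕ Unit)).toRingHom ≤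
                relations (i.comp φ) c := Ideal.map_le_iff_le_comap.2 fun u hu => hrename u hu
            have h3 := Ideal.mem_map_of_mem (rename (R := R) (Sum.inl : ι → ι ⊕ Unit)).toRingHom hy
            rw [Ideal.map_pow] at h3
            exact Ideal.pow_right_mono h2 2 h3
      · exact ⟨1, by simp, by simp⟩
      · rintro x y - - ⟨q, hq, hx⟩ ⟨q', hq', hy⟩
        refine ⟨q * q', by rw [eval₂_mul]; exact hq.mul hq', ?_⟩
        have : q * q' * (x + y) = q' * (q * x) + q * (q' * y) := by ring
        rw [this]
        exact add_mem (Ideal.mul_mem_left _ _ hx) (Ideal.mul_mem_left _ _ hy)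
      · rintro x y - ⟨q, hq, hy⟩
        refine ⟨q, hq, ?_⟩
        rw [smul_eq_mul, mul_left_comm]
        exact Ideal.mul_mem_left _ _ hy
    intro g hg
    -- Read the relation as a polynomial in `z`; over `A` it is divisible by `H`. After clearing
    -- denominators it differs from a multiple of `m` by a polynomial whose coefficients are
    -- relations of `a`.
    obtain ⟨n, rfl⟩ := ofIterated_surjective ι g
    rw [mem_relations, eval₂_ofIterated] at hg
    obtain ⟨P, hP⟩ := hmin _ hg
    obtain ⟨q', m', hq', hm'⟩ := ha.exists_polynomial P
    have hker : Polynomial.C (q * q') * n - m * m' ∈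
        RingHom.ker (Polynomial.mapRingHom (eval₂Hom φ a)) := by
      rw [RingHom.mem_ker, Polynomial.coe_mapRingHom, Polynomial.map_sub, Polynomial.map_mul,
        Polynomial.map_mul, hP, hm, hm', Polynomial.map_C, map_mul, Polynomial.C_mul]
      simp only [coe_eval₂Hom]
      ring
    rw [Polynomial.ker_mapRingHom] at hker
    have h1 := Ideal.mem_map_of_mem (ofIterated R ι) hker
    rw [Ideal.map_map] at h1
    have h2 : (ofIterated R ι).comp Polynomial.C = (rename (R := R) Sum.inl).toRingHom := by
      ext <;> simp [ofIterated]
    rw [h2] at h1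
    obtain ⟨s, hs, hsJ⟩ := hA _ h1
    refine ⟨s * ofIterated R ι (Polynomial.C (q * q')), ?_, ?_⟩
    · rw [eval₂_mul, eval₂_ofIterated, Polynomial.map_C, Polynomial.eval₂_C, coe_eval₂Hom,
        eval₂_mul, map_mul]
      exact hs.mul ((hq.map i).mul (hq'.map i))
    · have : s * ofIterated R ι (Polynomial.C (q * q')) * ofIterated R ι n =
          s * ofIterated R ι (Polynomial.C (q * q') * n - m * m') +
            s * ofIterated R ι m' * ofIterated R ι m := by
        simp only [map_sub, map_mul]
        ring
      rw [this]
      exact add_mem hsJ (Ideal.mul_mem_left _ _ (Ideal.mem_sup_left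
        (Ideal.subset_span ⟨Sum.inr (), rfl⟩)))
  · -- independence
    have : IsLocalization (⊥ : Submonoid R) R := IsLocalization.self bot_le
    have hrelL : relations (jB.comp (i.comp φ)) (fun k => jB (c k)) = relations (i.comp φ) c := by
      ext p
      rw [mem_relations, mem_relations, ← map_eq_zero_iff jB hjB, hom_eval₂]
    -- Independence can be tested over the fraction fields, where `IsConormalFrame.extend` applies.
    -- The base ring `R` is unchanged, so it is localized at the trivial submonoid.
    have hfK : IsConormalFrame (jA.comp φ) (fun k => jA (a k)) f := by
      have := hf.localize (R' := R) ⊥ (φ' := jA.comp φ) hjA fun r => rfl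
      simpa [Algebra.algebraMap_self, MvPolynomial.map_id] using this
    have haK : EssentiallyGenerates (jA.comp φ) (fun k => jA (a k)) :=
      ha.localize (R' := R) hjA hfracA fun r => rfl
    have hcL : EssentiallyGenerates (jB.comp (i.comp φ)) (fun k => jB (c k)) :=
      hc.localize (R' := R) hjB hfracB fun r => rfl
    have hbij : Function.Bijective (Sum.elim (Sum.inl : ι → ι ⊕ Unit) Sum.inr) := by
      rw [Sum.elim_inl_inr]
      exact Function.bijective_id
    have hne : jB (i (eval₂ φ a q)) * jB (H.derivative.eval₂ i z) ≠ 0 := by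
      refine mul_ne_zero ((hq.map i).map jB).ne_zero ?_
      rwa [Ne, map_eq_zero_iff jB hjB]
    have hfrL := hfK.extend (φ := jB.comp (i.comp φ)) (c := fun k => jB (c k)) (s := Sum.inl)
      (s' := (Sum.inr : Unit → ι ⊕ Unit)) (h := fun _ => ofIterated R ι m)
      (fun r => hcomm _) (fun k => (hcomm _).symm) hbij haK hcL
      (fun _ => by rw [hrelL]; exact hgrel) (by
        rw [jacobian, Matrix.det_unique, Matrix.of_apply]
        have := congrArg jB hgder
        rw [hom_eval₂, map_mul] at this
        intro h
        exact hne (this.symm.trans h))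
    intro d hd j
    have := hfrL.indep d (by rw [hrelL]; exact hd) j
    rw [← map_eq_zero_iff jB hjB, hom_eval₂]
    exact this

end Adjoin

end QuotientRamification

namespace QuotientRamification

open MvPolynomial

/-! ### Reindexing, and the presentation with one more coordinate and relation -/

section Reindex

variable {R A : Type u} [CommRing R] [CommRing A] {φ : R →+* A} {ι κ ι' κ' : Type}
  {a : ι → A} {f : κ → MvPolynomial ι R}

lemma eval₂_comp_symm_rename (e : ι ≃ ι') (p : MvPolynomial ι R) :
    eval₂ φ (a ∘ e.symm) (rename e p) = eval₂ φ a p := by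
  rw [eval₂_rename, Function.comp_assoc, e.symm_comp_self, Function.comp_id]

lemma EssentiallyGenerates.reindex (e : ι ≃ ι') (ha : EssentiallyGenerates φ a) :
    EssentiallyGenerates φ (a ∘ e.symm) := by
  intro z
  obtain ⟨p, q, hq, h⟩ := ha z
  exact ⟨rename e p, rename e q, by rwa [eval₂_comp_symm_rename],
    by rwa [eval₂_comp_symm_rename, eval₂_comp_symm_rename]⟩

lemma map_relations_rename_equiv (e : ι ≃ ι') :
    (relations φ a).map (renameEquiv R e : MvPolynomial ι R →+* MvPolynomial ι' R) =
      relations φ (a ∘ e.symm) := by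
  apply le_antisymm
  · refine Ideal.map_le_iff_le_comap.2 fun p hp => ?_
    change rename e p ∈ relations φ (a ∘ e.symm)
    rwa [mem_relations, eval₂_comp_symm_rename]
  · intro p hp
    obtain ⟨p, rfl⟩ := (renameEquiv R e).surjective p
    refine Ideal.mem_map_of_mem (renameEquiv R e : MvPolynomial ι R →+* MvPolynomial ι' R) ?_
    change rename e p ∈ _ at hp
    rwa [mem_relations, eval₂_comp_symm_rename] at hp

lemma rename_mem_relations_sq_iff (e : ι ≃ ι') {p : MvPolynomial ι R} :
    rename e p ∈ relations φ (a ∘ e.symm) ^ 2 ↔ p ∈ relations φ a ^ 2 := by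
  rw [← map_relations_rename_equiv, ← Ideal.map_pow]
  exact (Ideal.apply_mem_of_equiv_iff (f := (renameEquiv R e).toRingEquiv))

lemma IsConormalFrame.reindex [Fintype κ] [Fintype κ'] (e : ι ≃ ι') (e' : κ ≃ κ')
    (hf : IsConormalFrame φ a f) :
    IsConormalFrame φ (a ∘ e.symm) (fun k => rename e (f (e'.symm k))) := by
  refine ⟨fun k => ?_, fun g hg => ?_, fun c hc k => ?_⟩
  · rw [mem_relations, eval₂_comp_symm_rename]
    exact hf.mem _
  · obtain ⟨g, rfl⟩ := (renameEquiv R e).surjective g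
    change rename e g ∈ _ at hg
    rw [mem_relations, eval₂_comp_symm_rename] at hg
    obtain ⟨q, hq, h⟩ := hf.span g hg
    refine ⟨rename e q, by rwa [eval₂_comp_symm_rename], ?_⟩
    change _ * rename e g ∈ _
    rw [← map_mul]
    obtain ⟨x, hx, y, hy, hxy⟩ := Submodule.mem_sup.1 h
    obtain ⟨d, rfl⟩ := Ideal.mem_span_range_iff_exists_fun.1 hx
    rw [← hxy, map_add, map_sum]
    refine add_mem (Ideal.mem_sup_left (Ideal.sum_mem _ fun k _ => ?_))
      (Ideal.mem_sup_right ((rename_mem_relations_sq_iff e).2 hy))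
    rw [map_mul]
    exact Ideal.mul_mem_left _ _ (Ideal.subset_span ⟨e' k, by simp⟩)
  · obtain ⟨d, rfl⟩ : ∃ d : κ → MvPolynomial ι R, c = fun k => rename e (d (e'.symm k)) :=
      ⟨fun k => rename e.symm (c (e' k)), funext fun k => by simp [rename_rename]⟩
    rw [eval₂_comp_symm_rename]
    refine hf.indep d ?_ _
    rw [← rename_mem_relations_sq_iff e, map_sum]
    refine Eq.mp (congrArg (· ∈ _) ?_) hc
    rw [← e'.sum_comp]
    simp

end Reindex

variable {R A B : Type u} [CommRing R] [CommRing A] [CommRing B]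

/-- A presentation of the algebra `B`, which is essentially generated over `A` by a root `z` of
a polynomial `H` which generates the ideal of relations of `z` over `A`, and its canonical
generator. -/
theorem Presentation.exists_adjoin {K L : Type u} [Field K] [Field L] [Algebra K L]
    [FiniteDimensional K L] [Algebra.IsSeparable K L] {φ : R →+* A} {i : A →+* B} {jA : A →+* K}
    {jB : B →+* L} (hjA : Function.Injective jA) (hjB : Function.Injective jB)
    (hfracA : ∀ z, ∃ x y, y ≠ 0 ∧ z * jA y = jA x) (hfracB : ∀ z, ∃ x y, y ≠ 0 ∧ z * jB y = jB x)
    (hcomm : ∀ x, algebraMap K L (jA x) = jB (i x)) (P : Presentation φ) {z : B}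
    {H : Polynomial A} (hz : H.eval₂ i z = 0) (hmin : ∀ p : Polynomial A, p.eval₂ i z = 0 → H ∣ p)
    (hder : H.derivative.eval₂ i z ≠ 0)
    (hgen : ∀ b : B, ∃ P Q : Polynomial A, IsUnit (Q.eval₂ i z) ∧
      b * Q.eval₂ i z = P.eval₂ i z) {R' : Type u} [CommRing R'] {θ : R →+* R'} {φ' : R' →+* L}
    (hφ' : ∀ r, φ' (θ r) = jB (i (φ r))) :
    ∃ (Q : Presentation (i.comp φ)) (w : A) (r : L), IsUnit w ∧
      IsRatio φ' (fun k => jB (i (P.coord k))) (fun k => map θ (P.rel k))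
        (fun k => jB (Q.coord k)) (fun k => map θ (Q.rel k)) r ∧
      EqUpToSign r (jB (i w * H.derivative.eval₂ i z)) := by
  obtain ⟨hc, g, w, hw, hg, hf⟩ := P.isConormalFrame.adjoin hjA hjB hfracA hfracB hcomm
    P.essentiallyGenerates hz hmin hder hgen
  let e : Fin P.n ⊕ Unit ≃ Fin (P.n + 1) :=
    (Equiv.sumCongr (.refl _) finOneEquiv.symm).trans finSumFinEquiv
  let e' : Fin P.c ⊕ Unit ≃ Fin (P.c + 1) :=
    (Equiv.sumCongr (.refl _) finOneEquiv.symm).trans finSumFinEquiv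
  have hjc : (Sum.elim (fun k => jB (i (P.coord k))) fun _ : Unit => jB z) =
      fun k => jB (Sum.elim (fun k => i (P.coord k)) (fun _ : Unit => z) k) := by
    funext k
    rcases k with k | k <;> rfl
  have hev : ∀ p : MvPolynomial (Fin P.n ⊕ Unit) R,
      eval₂ (jB.comp (i.comp φ)) (Sum.elim (fun k => jB (i (P.coord k))) fun _ => jB z) p =
      jB (eval₂ (i.comp φ) (Sum.elim (fun k => i (P.coord k)) fun _ => z) p) := by
    intro p
    rw [hjc, hom_eval₂]
  obtain ⟨r, hr, hr'⟩ := isRatio_adjoin (φ := jB.comp (i.comp φ)) e e'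
    (a := fun k => jB (i (P.coord k))) (z := jB z) (f := P.rel) (g := g)
    (by
      have := mem_relations.1 (hf.mem (Sum.inr ()))
      rw [mem_relations, hev, ← map_zero jB]
      exact congrArg jB this)
    (by
      rw [hev, hg, Ne, map_eq_zero_iff jB hjB]
      intro h
      exact hder ((hw.map i).mul_right_eq_zero.1 h))
  rw [hev, hg] at hr'
  refine ⟨⟨P.n + 1, P.c + 1, _, _, hc.reindex e, hf.reindex e e'⟩, w, r, hw, ?_, hr'⟩
  have := hr.map (φ' := φ') (θ := θ) (j := RingHom.id L) Function.injective_id hφ'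
  rw [hjc] at this
  exact this

end QuotientRamification

namespace QuotientRamification

open IsLocalRing

/-! ### Regular local rings and regular sequences -/

section Regular

variable {R : Type u} [CommRing R]

/-- `f` spans a line in the cotangent space. Lifts of a basis of the quotient by this line generate
the maximal ideal together with `f`, by Nakayama, and `f` dies in the quotient ring. -/
lemma spanFinrank_maximalIdeal_quotient_le [IsLocalRing R] [IsNoetherianRing R] {f : R}
    (hf : f ∈ maximalIdeal R) (hf' : f ∉ maximalIdeal R ^ 2)
    [IsLocalRing (R ⧸ Ideal.span {f})] :
    (maximalIdeal (R ⧸ Ideal.span {f})).spanFinrank + 1 ≤ (maximalIdeal R).spanFinrank := by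
  let v : CotangentSpace R := (maximalIdeal R).toCotangent ⟨f, hf⟩
  have hv : v ≠ 0 := fun h => hf' ((Ideal.toCotangent_eq_zero _ _).1 h)
  let N : Submodule (ResidueField R) (CotangentSpace R) := Submodule.span _ {v}
  let b := Module.finBasis (ResidueField R) (CotangentSpace R ⧸ N)
  have hrank := N.finrank_quotient_add_finrank
  rw [finrank_span_singleton hv,
    ← spanFinrank_maximalIdeal_eq_finrank_cotangentSpace] at hrank
  have hex : ∀ k, ∃ g : maximalIdeal R, N.mkQ ((maximalIdeal R).toCotangent g) = b k := by
    intro k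
    obtain ⟨x, hx⟩ := N.mkQ_surjective (b k)
    obtain ⟨g, rfl⟩ := (maximalIdeal R).toCotangent_surjective x
    exact ⟨g, hx⟩
  choose g hg using hex
  have hspan : Submodule.span R (insert ⟨f, hf⟩ (Set.range g)) = ⊤ := by
    rw [← CotangentSpace.span_image_eq_top_iff, Set.image_insert_eq, ← Set.range_comp]
    let M := Submodule.span (ResidueField R)
      (insert v (Set.range ((maximalIdeal R).toCotangent ∘ g)))
    have h1 : N ≤ M := Submodule.span_mono (by simp)
    have h2 : M.map N.mkQ = ⊤ := by
      rw [eq_top_iff, ← b.span_eq, Submodule.span_le]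
      rintro _ ⟨k, rfl⟩
      exact ⟨_, Submodule.subset_span (Set.mem_insert_of_mem _ ⟨k, rfl⟩), hg k⟩
    have h3 := congrArg (Submodule.comap N.mkQ) h2
    rwa [Submodule.comap_map_mkQ, Submodule.comap_top, sup_eq_right.2 h1] at h3
  have hspan' : maximalIdeal R = Ideal.span (insert f (Set.range fun k => (g k : R))) := by
    have := congrArg (Submodule.map (maximalIdeal R).subtype) hspan
    rw [Submodule.map_span, Submodule.map_top, Submodule.range_subtype, Set.image_insert_eq,
      ← Set.range_comp] at this
    exact this.symm
  have hmax : maximalIdeal (R ⧸ Ideal.span {f}) =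
      Ideal.span (Set.range fun k => Ideal.Quotient.mk (Ideal.span {f}) (g k)) := by
    refine (map_maximalIdeal_of_surjective (Ideal.Quotient.mk (Ideal.span {f}))
      Ideal.Quotient.mk_surjective).symm.trans ((congrArg (Ideal.map _) hspan').trans ?_)
    rw [Ideal.map_span, Set.image_insert_eq, ← Set.range_comp,
      Ideal.Quotient.eq_zero_iff_mem.2 (Ideal.mem_span_singleton_self f)]
    exact Ideal.span_insert_zero
  rw [← hrank, hmax]
  refine Nat.add_le_add_right ((Submodule.spanFinrank_span_le_ncard_of_finite
    (Set.finite_range _)).trans ?_) 1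
  rw [← Set.image_univ]
  refine (Set.ncard_image_le Set.finite_univ).trans ?_
  rw [Set.ncard_univ, Nat.card_eq_fintype_card, Fintype.card_fin]

lemma quotient_isLocalRing [IsLocalRing R] {f : R} (hf : f ∈ maximalIdeal R) :
    IsLocalRing (R ⧸ Ideal.span {f}) := by
  have : Nontrivial (R ⧸ Ideal.span {f}) := by
    rw [Ideal.Quotient.nontrivial_iff, Ne, Ideal.span_singleton_eq_top]
    exact hf
  exact .of_surjective' (Ideal.Quotient.mk _) Ideal.Quotient.mk_surjective

lemma exists_ringKrullDim_eq [IsLocalRing R] [IsNoetherianRing R] :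
    ∃ n : ℕ, ringKrullDim R = n := by
  obtain ⟨m, hm⟩ := WithBot.ne_bot_iff_exists.1 (ringKrullDim_ne_bot (R := R))
  have hm' : m ≠ ⊤ := by
    rintro rfl
    exact ringKrullDim_ne_top (R := R) hm.symm
  obtain ⟨n, rfl⟩ := ENat.ne_top_iff_exists.1 hm'
  exact ⟨n, hm.symm⟩

/-- The quotient of a regular local ring by a parameter is regular, of dimension one less. -/
theorem quotient_isRegularLocalRing [IsRegularLocalRing R] {f : R} (hf : f ∈ maximalIdeal R)
    (hf' : f ∉ maximalIdeal R ^ 2) :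
    IsRegularLocalRing (R ⧸ Ideal.span {f}) ∧
      ringKrullDim (R ⧸ Ideal.span {f}) + 1 = ringKrullDim R := by
  have := quotient_isLocalRing hf
  -- The number of generators of the maximal ideal drops by at least one and the dimension by at
  -- most one. As the dimension never exceeds the number of generators, both drop by exactly one.
  have h1 := spanFinrank_maximalIdeal_quotient_le hf hf'
  have h2 := (isRegularLocalRing_iff R).1 ‹_›
  have h3 := ringKrullDim_le_ringKrullDim_quotient_add_card (R := R) {f} (by
    rw [← Ideal.jacobson_bot, jacobson_eq_maximalIdeal ⊥ bot_ne_top]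
    simpa using hf)
  have h4 := ringKrullDim_le_spanFinrank_maximalIdeal (R ⧸ Ideal.span {f})
  rw [Finset.coe_singleton, Finset.card_singleton, ← h2] at h3
  obtain ⟨n, hn⟩ := exists_ringKrullDim_eq (R := R ⧸ Ideal.span {f})
  rw [isRegularLocalRing_iff, ← h2]
  rw [hn] at h3 h4 ⊢
  norm_cast at h3 h4 ⊢
  omega

/-- A regular local ring is a domain. -/
theorem isDomain_of_isRegularLocalRing [IsRegularLocalRing R] : IsDomain R := by
  obtain ⟨n, hn⟩ := exists_ringKrullDim_eq (R := R)
  induction n generalizing R with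
  | zero =>
    have h2 := (isRegularLocalRing_iff R).1 ‹_›
    rw [hn] at h2
    have h3 := (Submodule.spanFinrank_eq_zero_iff_eq_bot
      (maximalIdeal R).fg_of_isNoetherianRing).1 (by exact_mod_cast h2)
    exact (isField_iff_maximalIdeal_eq.2 h3).isDomain
  | succ n ih =>
    have hmax : maximalIdeal R ∉ minimalPrimes R := by
      rw [← Ideal.height_eq_zero_iff]
      intro h
      have := maximalIdeal_height_eq_ringKrullDim (R := R)
      rw [h, hn] at this
      norm_cast at this
    have hsq : ¬ maximalIdeal R ≤ maximalIdeal R ^ 2 := by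
      intro h
      rw [pow_two] at h
      have hbot := Submodule.eq_bot_of_le_smul_of_le_jacobson_bot _ _
        (maximalIdeal R).fg_of_isNoetherianRing h (jacobson_eq_maximalIdeal ⊥ bot_ne_top).ge
      refine hmax ?_
      rw [hbot]
      have : (⊥ : Ideal R).IsPrime := hbot ▸ inferInstance
      exact ⟨⟨this, le_rfl⟩, fun _ _ _ => bot_le⟩
    -- Prime avoidance, with 𝔪² as the ideal that need not be prime.
    have hav : ∃ f ∈ maximalIdeal R, f ∉ maximalIdeal R ^ 2 ∧ ∀ P ∈ minimalPrimes R, f ∉ P := by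
      by_contra! hcon
      obtain ⟨P, hP, hle⟩ := (Ideal.subset_union_prime_finite (f := id)
        ((minimalPrimes.finite_of_isNoetherianRing R).insert (maximalIdeal R ^ 2))
        (maximalIdeal R ^ 2) (maximalIdeal R ^ 2) (I := maximalIdeal R) (by
          rintro P (rfl | hP) h _
          · exact absurd rfl h
          · exact hP.1.1)).1 (by
          intro f hf
          by_cases hf' : f ∈ maximalIdeal R ^ 2
          · exact Set.mem_biUnion (Set.mem_insert _ _) hf'
          · obtain ⟨P, hP, hfP⟩ := hcon f hf hf'
            exact Set.mem_biUnion (Set.mem_insert_of_mem _ hP) hfP)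
      rcases hP with rfl | hP
      · exact hsq hle
      · have := hP.1.1
        have := le_antisymm hle (le_maximalIdeal this.ne_top)
        exact hmax (this ▸ hP)
    obtain ⟨f, hf, hf', hfP⟩ := hav
    obtain ⟨hreg, hdim⟩ := quotient_isRegularLocalRing hf hf'
    have hn' : ringKrullDim (R ⧸ Ideal.span {f}) = n := by
      obtain ⟨m, hm⟩ := exists_ringKrullDim_eq (R := R ⧸ Ideal.span {f})
      rw [hm, hn] at hdim
      rw [hm]
      norm_cast at hdim ⊢
      omega
    have hdom := ih hn'
    have hprime : (Ideal.span {f}).IsPrime := (Ideal.Quotient.isDomain_iff_prime _).1 hdom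
    -- The prime ideal (f) contains a minimal prime `P` with f ∉ P. Hence P = fP, and P = 0 by
    -- Nakayama.
    obtain ⟨P, hP, hPf⟩ := Ideal.exists_minimalPrimes_le (I := ⊥) (J := Ideal.span {f}) bot_le
    have hPprime := hP.1.1
    have hPbot : P = ⊥ := by
      refine Submodule.eq_bot_of_le_smul_of_le_jacobson_bot (Ideal.span {f}) _
        P.fg_of_isNoetherianRing ?_ ?_
      · intro x hx
        obtain ⟨y, rfl⟩ := Ideal.mem_span_singleton'.1 (hPf hx)
        rw [smul_eq_mul, mul_comm y]
        exact Ideal.mul_mem_mul (Ideal.mem_span_singleton_self f)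
          ((hPprime.mem_or_mem hx).resolve_right (hfP P hP))
      · rw [jacobson_eq_maximalIdeal ⊥ bot_ne_top, Ideal.span_singleton_le_iff_mem]
        exact hf
    rw [hPbot] at hPprime
    exact .of_bot_isPrime R

/-- Every relation between the elements `f j` is a combination of the relations
`f k • f j - f j • f k = 0`. -/
def HasKoszulSyzygies {c : ℕ} (f : Fin c → R) : Prop :=
  ∀ d : Fin c → R, ∑ j, d j * f j = 0 → ∃ b : Fin c → Fin c → R,
    ∀ j, d j = ∑ k, (b j k - b k j) * f k

lemma sum_koszul {c : ℕ} (f : Fin c → R) (b : Fin c → Fin c → R) :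
    ∑ j, (∑ k, (b j k - b k j) * f k) * f j = 0 := by
  have : ∑ j, (∑ k, (b j k - b k j) * f k) * f j =
      ∑ j, ∑ k, b j k * f k * f j - ∑ j, ∑ k, b k j * f k * f j := by
    simp only [Finset.sum_mul, sub_mul, Finset.sum_sub_distrib]
  rw [this, sub_eq_zero]
  conv_rhs => rw [Finset.sum_comm]
  exact Finset.sum_congr rfl fun j _ => Finset.sum_congr rfl fun k _ => by ring

/-- Modulo `g` the relation is Koszul, up to corrections e_j g of the coefficients of the `f j`.
Since `g` is not a zero divisor, the coefficient of `g` itself must be -∑ e_j f_j, which is the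
remaining Koszul part. -/
lemma HasKoszulSyzygies.cons {g : R} (hg : g ∈ nonZeroDivisors R) {c : ℕ} {f : Fin c → R}
    (hf : HasKoszulSyzygies fun j => Ideal.Quotient.mk (Ideal.span {g}) (f j)) :
    HasKoszulSyzygies (Fin.cons g f : Fin (c + 1) → R) := by
  intro d hd
  rw [Fin.sum_univ_succ, Fin.cons_zero] at hd
  simp only [Fin.cons_succ] at hd
  obtain ⟨b', hb'⟩ := hf (fun j => Ideal.Quotient.mk _ (d j.succ)) (by
    have := congrArg (Ideal.Quotient.mk (Ideal.span {g})) hd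
    simpa [Ideal.Quotient.eq_zero_iff_mem.2 (Ideal.mem_span_singleton_self g)] using this)
  choose b hb using fun j k => Ideal.Quotient.mk_surjective (b' j k)
  have he : ∀ j : Fin c, ∃ e, d j.succ = ∑ k, (b j k - b k j) * f k + e * g := by
    intro j
    have : d j.succ - ∑ k, (b j k - b k j) * f k ∈ Ideal.span {g} := by
      rw [← Ideal.Quotient.eq_zero_iff_mem, map_sub, hb' j]
      simp [hb]
    obtain ⟨e, he⟩ := Ideal.mem_span_singleton'.1 this
    exact ⟨e, by rw [he]; ring⟩
  choose e he using he
  have hd0 : d 0 = -∑ j, e j * f j := by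
    have h1 : ∑ j : Fin c, d j.succ * f j = g * ∑ j, e j * f j := by
      have := sum_koszul f b
      rw [Finset.mul_sum]
      calc _ = ∑ j, ((∑ k, (b j k - b k j) * f k) * f j + g * (e j * f j)) :=
            Finset.sum_congr rfl fun j _ => by rw [he j]; ring
        _ = _ := by rw [Finset.sum_add_distrib, this, zero_add]
    rw [h1] at hd
    have h2 : g * (d 0 + ∑ j, e j * f j) = 0 := by linear_combination hd
    exact eq_neg_of_add_eq_zero_left ((mul_left_mem_nonZeroDivisors_eq_zero_iff hg).1 h2)
  refine ⟨Fin.cons (fun _ => 0) fun j => Fin.cons (e j) (b j), fun j => ?_⟩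
  refine Fin.cases ?_ (fun j => ?_) j
  · rw [hd0, Fin.sum_univ_succ]
    simp
  · rw [he, Fin.sum_univ_succ]
    simp [add_comm]

/-- A prime ideal with regular quotient in a regular local ring is generated by a regular
sequence. -/
theorem exists_hasKoszulSyzygies [IsRegularLocalRing R] (J : Ideal R)
    [hJ : IsRegularLocalRing (R ⧸ J)] :
    ∃ (c : ℕ) (f : Fin c → R), Ideal.span (Set.range f) = J ∧ HasKoszulSyzygies f := by
  obtain ⟨n, hn⟩ := exists_ringKrullDim_eq (R := R)
  induction n using Nat.strong_induction_on generalizing R with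
  | _ n ih =>
    have hdomain : IsDomain R := isDomain_of_isRegularLocalRing
    by_cases hbot : J = ⊥
    · exact ⟨0, Fin.elim0, by simp [hbot], fun d _ => ⟨fun _ _ => 0, fun j => j.elim0⟩⟩
    have hJtop : J ≠ ⊤ := by
      rintro rfl
      exact not_subsingleton (R ⧸ (⊤ : Ideal R)) inferInstance
    have hJm : J ≤ maximalIdeal R := le_maximalIdeal hJtop
    -- If J ⊆ 𝔪², then by Nakayama the maximal ideal of R/J needs as many generators as that of `R`,
    -- although the dimension is smaller because J ≠ 0; so R/J would not be regular.
    have hex : ∃ f ∈ J, f ∉ maximalIdeal R ^ 2 := by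
      by_contra! hcon
      obtain ⟨x, hx, hx0⟩ := Submodule.exists_mem_ne_zero_of_ne_bot hbot
      have h1 : (maximalIdeal R).spanFinrank ≤ (maximalIdeal (R ⧸ J)).spanFinrank := by
        obtain ⟨s, hs, hspan⟩ := Submodule.FG.exists_span_finset_card_eq_spanFinrank
          (maximalIdeal (R ⧸ J)).fg_of_isNoetherianRing
        choose g hg using fun x : R ⧸ J => Ideal.Quotient.mk_surjective x
        have hle : maximalIdeal R ≤ Ideal.span (g '' s) ⊔ J := by
          have h1 : (maximalIdeal R).map (Ideal.Quotient.mk J) ≤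
              (Ideal.span (g '' s)).map (Ideal.Quotient.mk J) := by
            rw [map_maximalIdeal_of_surjective _ Ideal.Quotient.mk_surjective, Ideal.map_span,
              ← Set.image_comp, ← hspan]
            exact Submodule.span_mono fun x hx => ⟨x, hx, hg x⟩
          refine (Ideal.map_le_iff_le_comap.1 h1).trans ?_
          rw [Ideal.comap_map_of_surjective' _ Ideal.Quotient.mk_surjective, Ideal.mk_ker]
        have hle' : maximalIdeal R ≤ Ideal.span (g '' s) := by
          refine Submodule.le_of_le_smul_of_le_jacobson_bot (I := maximalIdeal R)
            (maximalIdeal R).fg_of_isNoetherianRing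
            (jacobson_eq_maximalIdeal ⊥ bot_ne_top).ge (hle.trans ?_)
          rw [smul_eq_mul, ← pow_two]
          exact sup_le_sup_left hcon _
        have hge : Ideal.span (g '' s) ≤ maximalIdeal R := by
          rw [Ideal.span_le]
          rintro _ ⟨y, hy, rfl⟩
          have h1 : Ideal.Quotient.mk J (g y) ∈ maximalIdeal (R ⧸ J) := by
            rw [hg, ← hspan]
            exact Submodule.subset_span hy
          rw [mem_maximalIdeal] at h1
          exact fun h => h1 (h.map _)
        rw [le_antisymm hle' hge, ← hs]
        refine (Submodule.spanFinrank_span_le_ncard_of_finite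
          (s.finite_toSet.image g)).trans ((Set.ncard_image_le s.finite_toSet).trans ?_)
        rw [Set.ncard_coe_finset]
      have h2 := (isRegularLocalRing_iff R).1 ‹_›
      have h3 := (isRegularLocalRing_iff (R ⧸ J)).1 ‹_›
      have h4 := ringKrullDim_succ_le_of_surjective (Ideal.Quotient.mk J)
        Ideal.Quotient.mk_surjective (mem_nonZeroDivisors_of_ne_zero hx0)
        (Ideal.Quotient.eq_zero_iff_mem.2 hx)
      rw [← h2, ← h3] at h4
      norm_cast at h4
      omega
    obtain ⟨g, hgJ, hg⟩ := hex
    obtain ⟨hreg, hdim⟩ := quotient_isRegularLocalRing (hJm hgJ) hg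
    obtain ⟨m, hm⟩ := exists_ringKrullDim_eq (R := R ⧸ Ideal.span {g})
    have hle : Ideal.span {g} ≤ J := (Ideal.span_singleton_le_iff_mem J).2 hgJ
    have hJ' : IsRegularLocalRing
        ((R ⧸ Ideal.span {g}) ⧸ J.map (Ideal.Quotient.mk (Ideal.span {g}))) :=
      .of_ringEquiv (DoubleQuot.quotQuotEquivQuotOfLE hle).symm
    obtain ⟨c, f', hf', hsyz⟩ := ih m (by
      rw [hm, hn] at hdim
      norm_cast at hdim
      omega) (J.map (Ideal.Quotient.mk (Ideal.span {g}))) hm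
    choose f hf using fun j => Ideal.Quotient.mk_surjective (f' j)
    have hf'' : f' = fun j => Ideal.Quotient.mk (Ideal.span {g}) (f j) :=
      funext fun j => (hf j).symm
    subst hf''
    refine ⟨c + 1, Fin.cons g f, ?_, hsyz.cons (mem_nonZeroDivisors_of_ne_zero ?_)⟩
    · have h1 := congrArg (Ideal.comap (Ideal.Quotient.mk (Ideal.span {g}))) hf'
      have h2 : Ideal.span (Set.range fun j => Ideal.Quotient.mk (Ideal.span {g}) (f j)) =
          (Ideal.span (Set.range f)).map (Ideal.Quotient.mk (Ideal.span {g})) := by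
        rw [Ideal.map_span, ← Set.range_comp]
        rfl
      rw [h2, Ideal.comap_map_of_surjective' _ Ideal.Quotient.mk_surjective,
        Ideal.comap_map_of_surjective' _ Ideal.Quotient.mk_surjective, Ideal.mk_ker,
        sup_eq_left.2 hle] at h1
      rw [Fin.range_cons, Ideal.span_insert, sup_comm, h1]
    · rintro rfl
      exact hg (Ideal.zero_mem _)

end Regular
end QuotientRamification

namespace QuotientRamification

open IsLocalRing MvPolynomial

/-! ### Regularity of affine space, and existence of presentations -/

section RegularPolynomial

lemma isRegularLocalRing_localization_of_ringEquiv {A B : Type*} [CommRing A] [CommRing B]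
    (e : A ≃+* B) (p : Ideal B) [p.IsPrime]
    (h : IsRegularLocalRing (Localization.AtPrime (p.comap e))) :
    IsRegularLocalRing (Localization.AtPrime p) :=
  IsRegularLocalRing.of_ringEquiv <| IsLocalization.ringEquivOfRingEquiv
    (Localization.AtPrime (p.comap e)) (Localization.AtPrime p) e (e.map_primeCompl_comap_eq p)

lemma isRegularLocalRing_localization_congr {A : Type*} [CommRing A] {p q : Ideal A} [p.IsPrime]
    [q.IsPrime] (hpq : p = q) (h : IsRegularLocalRing (Localization.AtPrime p)) :
    IsRegularLocalRing (Localization.AtPrime q) := by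
  subst hpq
  exact h

/-- Localizing the base at the contraction `q` of `p` reduces to a prime of R_q[X] lying over the
maximal ideal of the regular local ring R_q. -/
lemma isRegularLocalRing_localization_polynomial {R : Type*} [CommRing R]
    (p : Ideal (Polynomial R)) [hp : p.IsPrime]
    (h : IsRegularLocalRing (Localization.AtPrime (p.comap Polynomial.C))) :
    IsRegularLocalRing (Localization.AtPrime p) := by
  let q := p.comap Polynomial.C
  let S := Polynomial (Localization.AtPrime q)
  let pc := Submonoid.map Polynomial.C.toMonoidHom q.primeCompl
  let : Algebra (Polynomial R) S := Polynomial.algebra R (Localization.AtPrime q)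
  have : IsLocalization pc S := Polynomial.isLocalization _ _
  let pS := p.map (algebraMap (Polynomial R) S)
  have disj : Disjoint (pc : Set (Polynomial R)) (p : Set (Polynomial R)) := by
    simpa [pc, q] using! Set.disjoint_image_left.mpr
      (Set.disjoint_compl_left_iff_subset.mpr (fun _ a ↦ a))
  have : pS.IsPrime := IsLocalization.isPrime_of_isPrime_disjoint pc _ _ ‹_› disj
  have : IsLocalization.AtPrime (Localization.AtPrime pS) p := by
    convert IsLocalization.isLocalization_isLocalization_atPrime_isLocalization pc
      (Localization.AtPrime pS) pS
    exact (IsLocalization.under_map_of_isPrime_disjoint pc _ ‹_› disj).symm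
  have : IsRegularLocalRing (Localization.AtPrime q) := h
  have eq : Ideal.comap Polynomial.C pS = maximalIdeal (Localization.AtPrime q) := by
    rw [← IsLocalization.map_under q.primeCompl _ (Ideal.comap Polynomial.C pS),
      ← IsLocalization.map_under q.primeCompl _ (maximalIdeal (Localization.AtPrime q))]
    simp only [Ideal.comap_comap, S, pS]
    rw [← Polynomial.algebraMap_eq (R := Localization.AtPrime q),
      ← IsScalarTower.algebraMap_eq R (Localization.AtPrime q)
        (Polynomial (Localization.AtPrime q)),
      IsScalarTower.algebraMap_eq R (Polynomial R) (Polynomial (Localization.AtPrime q)),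
      ← Ideal.comap_comap, ← Ideal.under_def (Polynomial R),
      IsLocalization.under_map_of_isPrime_disjoint pc _ ‹_› disj]
    simp [q, IsLocalization.AtPrime.under_maximalIdeal (Localization.AtPrime q) q]
  have :=
    Polynomial.isRegularLocalRing_localization_atPrime_of_comap_eq_maximalIdeal _ pS eq
  exact IsRegularLocalRing.of_ringEquiv (R := Localization.AtPrime pS) (IsLocalization.algEquiv p.primeCompl
    (Localization.AtPrime pS) (Localization.AtPrime p)).toRingEquiv

/-- A local ring of an affine space over a scheme is regular if the local ring of the base is. -/
theorem isRegularLocalRing_localization_mvPolynomial {R : Type u} [CommRing R] {ι : Type}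
    [Finite ι] (p : Ideal (MvPolynomial ι R)) [hp : p.IsPrime]
    (h : IsRegularLocalRing (Localization.AtPrime (p.comap (C : R →+* MvPolynomial ι R)))) :
    IsRegularLocalRing (Localization.AtPrime p) := by
  induction ι using Finite.induction_empty_option with
  | of_equiv e H =>
    refine isRegularLocalRing_localization_of_ringEquiv (renameEquiv R e).toRingEquiv p
      (H _ (isRegularLocalRing_localization_congr ?_ h))
    ext r
    simp
  | h_empty =>
    refine isRegularLocalRing_localization_of_ringEquiv (isEmptyRingEquiv R PEmpty).symm p
      (isRegularLocalRing_localization_congr ?_ h)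
    ext r
    change _ ↔ (isEmptyRingEquiv R PEmpty).symm r ∈ p
    rw [Ideal.mem_comap]
    rfl
  | h_option IH =>
    refine isRegularLocalRing_localization_of_ringEquiv
      (optionEquivLeft R _).toRingEquiv.symm p
      (isRegularLocalRing_localization_polynomial _ (IH _
        (isRegularLocalRing_localization_congr ?_ h)))
    ext r
    simp

end RegularPolynomial

/-- A regular local ring, essentially of finite type over a regular local ring, has a
presentation. -/
theorem exists_presentation {R A : Type u} [CommRing R] [CommRing A] [IsRegularLocalRing R]
    [IsRegularLocalRing A] (φ : R →+* A) [IsLocalHom φ] {n : ℕ} {a : Fin n → A}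
    (ha : EssentiallyGenerates φ a) : Nonempty (Presentation φ) := by
  -- `M` is the point of affine space at which Spec A is embedded. Its local ring `T` is regular and
  -- T → A is surjective, so the kernel is generated by elements with only Koszul syzygies. Such
  -- syzygies have coefficients in the kernel, so these generators form a basis of the conormal
  -- module.
  let M : Ideal (MvPolynomial (Fin n) R) := (maximalIdeal A).comap (eval₂Hom φ a)
  have hM : M.IsPrime := inferInstance
  have hreg : IsRegularLocalRing (Localization.AtPrime M) := by
    refine isRegularLocalRing_localization_mvPolynomial M ?_
    have h1 : (maximalIdeal R).IsPrime := inferInstance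
    have h2 : maximalIdeal R = M.comap (C : R →+* MvPolynomial (Fin n) R) := by
      ext r
      simp [M]
    refine isRegularLocalRing_localization_congr h2 ?_
    exact .of_ringEquiv (IsLocalization.atUnits R (maximalIdeal R).primeCompl
      (S := Localization.AtPrime (maximalIdeal R)) (fun x ↦ by simpa using! fun a ↦ a)).toRingEquiv
  obtain ⟨T, _, _, _, _⟩ : ∃ (T : Type u) (_ : CommRing T) (_ : IsRegularLocalRing T)
      (_ : Algebra (MvPolynomial (Fin n) R) T), IsLocalization.AtPrime T M :=
    ⟨Localization.AtPrime M, inferInstance, hreg, inferInstance, inferInstance⟩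
  have hunit : ∀ y : M.primeCompl, IsUnit (eval₂Hom φ a y) := by
    intro y
    have := y.2
    by_contra h
    exact this h
  let ev : T →+* A := IsLocalization.lift (M := M.primeCompl) hunit
  have hev : ∀ p, ev (algebraMap _ T p) = eval₂ φ a p := fun p => IsLocalization.lift_eq hunit p
  have hevsurj : Function.Surjective ev := by
    intro z
    obtain ⟨p, q, hq, h⟩ := ha z
    have hq' : q ∈ M.primeCompl := fun h => h hq
    refine ⟨IsLocalization.mk' T p ⟨q, hq'⟩, ?_⟩
    have h1 := congrArg ev (IsLocalization.mk'_spec T p ⟨q, hq'⟩)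
    rw [map_mul, hev, hev, ← h] at h1
    exact hq.mul_right_cancel h1
  have hquot : IsRegularLocalRing (T ⧸ RingHom.ker ev) :=
    .of_ringEquiv (RingHom.quotientKerEquivOfSurjective hevsurj).symm
  obtain ⟨c, f, hspan, hsyz⟩ := exists_hasKoszulSyzygies (RingHom.ker ev)
  choose F s hFs using fun j => IsLocalization.exists_mk'_eq M.primeCompl (f j)
  have hF : ∀ j, algebraMap _ T (F j) = algebraMap _ T (s j : MvPolynomial (Fin n) R) * f j := by
    intro j
    rw [← hFs j, mul_comm, IsLocalization.mk'_spec]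
  have hfker : ∀ j, ev (f j) = 0 := fun j => by
    rw [← RingHom.mem_ker, ← hspan]
    exact Ideal.subset_span ⟨j, rfl⟩
  have hsunit : ∀ j, IsUnit (algebraMap _ T (s j : MvPolynomial (Fin n) R)) := fun j =>
    IsLocalization.map_units T (s j)
  have hmap : (relations φ a).map (algebraMap _ T) ≤ RingHom.ker ev := by
    refine Ideal.map_le_iff_le_comap.2 fun p hp => ?_
    rw [Ideal.mem_comap, RingHom.mem_ker, hev]
    exact hp
  refine ⟨⟨n, c, a, F, ha, ⟨fun j => ?_, fun g hg => ?_, fun d hd j => ?_⟩⟩⟩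
  · rw [mem_relations, ← hev, hF, map_mul, hfker, mul_zero]
  · have h1 : algebraMap _ T g ∈ RingHom.ker ev := hmap (Ideal.mem_map_of_mem _ hg)
    have h2 : algebraMap _ T g ∈ (Ideal.span (Set.range F)).map (algebraMap _ T) := by
      rw [← hspan] at h1
      refine (Ideal.span_le.2 ?_ : Ideal.span (Set.range f) ≤ _) h1
      rintro _ ⟨j, rfl⟩
      obtain ⟨w, hw⟩ := hsunit j
      have : f j = ↑w⁻¹ * algebraMap _ T (F j) := by
        rw [hF, ← hw, Units.inv_mul_cancel_left]
      rw [this]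
      exact Ideal.mul_mem_left _ _ (Ideal.mem_map_of_mem _ (Ideal.subset_span ⟨j, rfl⟩))
    rw [IsLocalization.algebraMap_mem_map_algebraMap_iff M.primeCompl] at h2
    obtain ⟨q, hq, h⟩ := h2
    exact ⟨q, hunit ⟨q, hq⟩, Ideal.mem_sup_left h⟩
  · have h1 := Ideal.mem_map_of_mem (algebraMap _ T) hd
    rw [Ideal.map_pow, map_sum] at h1
    have h2 : ∑ j, algebraMap _ T (d j) * algebraMap _ T (s j : MvPolynomial (Fin n) R) * f j ∈
        RingHom.ker ev ^ 2 := by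
      refine Eq.mp (congrArg (· ∈ _) (Finset.sum_congr rfl fun j _ => ?_))
        (Ideal.pow_right_mono hmap 2 h1)
      rw [map_mul, hF, mul_assoc]
    rw [pow_two] at h2
    nth_rw 2 [← hspan] at h2
    obtain ⟨u, hu, hsum⟩ := (Submodule.mem_ideal_smul_span_iff_exists_sum _ _ _).1 h2
    rw [Finsupp.sum_fintype _ _ (by simp)] at hsum
    simp only [smul_eq_mul] at hsum
    -- Membership in the square of the kernel allows the coefficients to be corrected by elements `u
    -- j` of the kernel, which yields an exact relation between the `f j`.
    obtain ⟨b, hb⟩ := hsyz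
      (fun j => algebraMap _ T (d j) * algebraMap _ T (s j : MvPolynomial (Fin n) R) - u j) (by
        simp only [sub_mul, Finset.sum_sub_distrib, hsum, sub_self])
    have h3 := congrArg ev (hb j)
    rw [map_sub, map_mul, hev, hev, RingHom.mem_ker.1 (hu j), sub_zero, map_sum] at h3
    simp only [map_mul, hfker, mul_zero, Finset.sum_const_zero] at h3
    exact (hunit (s j)).mul_left_eq_zero.1 h3

end QuotientRamification

set_option linter.unusedSectionVars false

namespace QuotientRamification

/-! ### Lagrange interpolation at the conjugates of an element -/

section Lagrange

open Polynomial

variable {A B : Type u} [CommRing A] [CommRing B] [Algebra A B] {G : Type} [Group G] [Fintype G]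
  [MulSemiringAction G B]

open Classical in
variable (G) in
/-- The product of the differences `z - g z` for `g ≠ 1`. -/
noncomputable def conjDifferent (z : B) : B :=
  ∏ g ∈ Finset.univ.erase (1 : G), (z - g • z)

open Classical in
variable (G) in
/-- The Lagrange interpolation polynomial with value `g b * g (conjDifferent G z)` at `g z`. -/
noncomputable def lagrangePoly (z b : B) : B[X] :=
  ∑ g : G, C (g • b) * ∏ h ∈ Finset.univ.erase g, (X - C (h • z))

lemma eval_lagrangePoly (z b : B) : (lagrangePoly G z b).eval z = b * conjDifferent G z := by
  classical
  rw [lagrangePoly, eval_finsetSum, Finset.sum_eq_single (1 : G)]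
  · simp [conjDifferent, eval_prod]
  · intro g _ hg
    rw [eval_mul, eval_prod, Finset.prod_eq_zero (i := (1 : G)), mul_zero]
    · exact Finset.mem_erase.2 ⟨hg.symm, Finset.mem_univ _⟩
    · simp
  · simp

lemma smul_lagrangePoly (z b : B) (k : G) : k • lagrangePoly G z b = lagrangePoly G z b := by
  classical
  rw [lagrangePoly, Finset.smul_sum]
  refine Fintype.sum_equiv (Equiv.mulLeft k) _ _ fun g => ?_
  rw [smul_mul', smul_C, Finset.smul_prod', Equiv.coe_mulLeft, mul_smul]
  congr 1
  refine Finset.prod_equiv (Equiv.mulLeft k) (fun h => by simp) fun h _ => ?_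
  rw [smul_sub, smul_X, smul_C, Equiv.coe_mulLeft, mul_smul]

lemma degree_lagrangePoly_lt (z b : B) :
    (lagrangePoly G z b).degree < (Fintype.card G : WithBot ℕ) := by
  classical
  refine (degree_sum_le _ _).trans_lt ((Finset.sup_lt_iff (WithBot.bot_lt_coe _)).2 fun g _ => ?_)
  refine (degree_mul_le _ _).trans_lt ?_
  have h1 : (∏ h ∈ Finset.univ.erase g, (X - C (h • z))).degree ≤
      ((Fintype.card G - 1 : ℕ) : WithBot ℕ) := by
    refine (degree_prod_le _ _).trans ?_
    calc _ ≤ ∑ _h ∈ Finset.univ.erase g, (1 : WithBot ℕ) :=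
          Finset.sum_le_sum fun h _ => degree_X_sub_C_le _
      _ = _ := by
        rw [Finset.sum_const, Finset.card_erase_of_mem (Finset.mem_univ _), Finset.card_univ,
          nsmul_one]
  have hpos : 0 < Fintype.card G := Fintype.card_pos
  calc _ ≤ (0 : WithBot ℕ) + ((Fintype.card G - 1 : ℕ) : WithBot ℕ) :=
        add_le_add degree_C_le h1
    _ < _ := by
      rw [zero_add]
      exact_mod_cast Nat.sub_lt hpos one_pos

lemma derivative_charpoly (z : B) :
    derivative (MulSemiringAction.charpoly G z) = lagrangePoly G z 1 := by
  classical
  rw [MulSemiringAction.charpoly_eq, lagrangePoly, derivative_prod_finset]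
  simp

lemma exists_map_eq_of_smul_eq [Algebra.IsInvariant A B G] {F : B[X]} (hF : ∀ g : G, g • F = F) :
    ∃ P : A[X], P.map (algebraMap A B) = F ∧ P.degree = F.degree := by
  have h : F ∈ lifts (algebraMap A B) := (lifts_iff_coeff_lifts F).2 fun n =>
    Algebra.IsInvariant.isInvariant (G := G) _ fun g => by rw [← coeff_smul, hF g]
  exact exists_degree_eq_of_mem_lifts h

-- The derivative of ∏ (T - gz) is the interpolation polynomial of b = 1, so its value at `z` is
-- `conjDifferent G z`.
variable (A G) in
lemma exists_charpoly [Nontrivial B] [Algebra.IsInvariant A B G] (z : B) :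
    ∃ H : A[X], H.Monic ∧ H.natDegree = Fintype.card G ∧
      H.map (algebraMap A B) = MulSemiringAction.charpoly G z ∧
      H.eval₂ (algebraMap A B) z = 0 ∧
      H.derivative.eval₂ (algebraMap A B) z = conjDifferent G z := by
  obtain ⟨H, hH, hdeg, hmon⟩ := lifts_and_natDegree_eq_and_monic
    (Algebra.IsInvariant.charpoly_mem_lifts A B G z) (MulSemiringAction.monic_charpoly G z)
  refine ⟨H, hmon, ?_, hH, ?_, ?_⟩
  · rw [hdeg, MulSemiringAction.charpoly_eq, natDegree_finsetProd_X_sub_C_eq_card,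
      Finset.card_univ]
  · rw [← eval_map, hH, MulSemiringAction.eval_charpoly]
  · rw [← eval_map, ← derivative_map, hH, derivative_charpoly, eval_lagrangePoly, one_mul]

-- The interpolation polynomial is `G`-invariant and so descends to `A`. Thus the product of the
-- differences z - gz multiplies `B` into `A[z]`.
variable (A G) in
lemma exists_lagrange [Algebra.IsInvariant A B G] (z b : B) :
    ∃ F : A[X], F.degree < (Fintype.card G : WithBot ℕ) ∧
      F.eval₂ (algebraMap A B) z = b * conjDifferent G z := by
  obtain ⟨F, hF, h⟩ := exists_map_eq_of_smul_eq (A := A) (smul_lagrangePoly (G := G) z b)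
  exact ⟨F, h ▸ degree_lagrangePoly_lt z b, by rw [← eval_map, hF, eval_lagrangePoly]⟩

/-- A polynomial over `A` vanishing at `z` vanishes at all conjugates. These are pairwise distinct,
hence too many for its degree. -/
lemma eq_zero_of_eval₂_eq_zero [IsDomain B] [SMulCommClass G A B]
    (hinj : Function.Injective (algebraMap A B)) {z : B} (hz : ∀ g : G, g • z = z → g = 1)
    {F : A[X]} (hF : F.degree < (Fintype.card G : WithBot ℕ))
    (h : F.eval₂ (algebraMap A B) z = 0) : F = 0 := by
  by_contra hne
  have hne' : F.map (algebraMap A B) ≠ 0 := (Polynomial.map_ne_zero_iff hinj).2 hne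
  refine hne' (eq_zero_of_natDegree_lt_card_of_eval_eq_zero _ (f := fun g : G => g • z) ?_ ?_ ?_)
  · intro g g' hgg
    have : (g⁻¹ * g') • z = z := by
      rw [mul_smul, inv_smul_eq_iff]
      exact hgg.symm
    exact (inv_mul_eq_one.1 (hz _ this))
  · intro g
    have hF' : g • F.map (algebraMap A B) = F.map (algebraMap A B) := by
      ext n
      rw [coeff_smul, coeff_map, smul_algebraMap]
    rw [← hF', smul_eval_smul, eval_map, h, smul_zero]
  · rw [natDegree_lt_iff_degree_lt hne']
    exact degree_map_le.trans_lt hF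

end Lagrange

end QuotientRamification

set_option linter.unusedSectionVars false

namespace QuotientRamification

open Polynomial IsLocalRing

/-! ### Descent of discrete valuation rings -/

section Dvr

variable {A B : Type u} [CommRing A] [CommRing B] [IsDomain A] [IsDomain B] [IsLocalRing A]
  [IsDiscreteValuationRing B] {i : A →+* B} [IsLocalHom i]

/-- A local ring which is the intersection of its fraction field with a discrete valuation ring
which dominates it is a discrete valuation ring. -/
theorem isDiscreteValuationRing_of_dvd (hinj : Function.Injective i)
    (hdvd : ∀ a b : A, i a ∣ i b → a ∣ b) (hA : ∃ a ∈ maximalIdeal A, a ≠ 0) :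
    IsDiscreteValuationRing A := by
  classical
  have hex : ∃ n : ℕ, ∃ a ∈ maximalIdeal A, a ≠ 0 ∧
      IsDiscreteValuationRing.addVal B (i a) = n := by
    obtain ⟨a, ha, ha0⟩ := hA
    obtain ⟨n, hn⟩ := ENat.ne_top_iff_exists.1
      (mt IsDiscreteValuationRing.addVal_eq_top_iff.1 ((map_ne_zero_iff i hinj).2 ha0))
    exact ⟨n, a, ha, ha0, hn.symm⟩
  -- An element of least valuation divides every element of the maximal ideal, hence generates it.
  obtain ⟨π, hπ, hπ0, hπn⟩ := Nat.find_spec hex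
  have hdiv : ∀ a ∈ maximalIdeal A, π ∣ a := by
    intro a ha
    by_cases ha0 : a = 0
    · exact ha0 ▸ dvd_zero π
    refine hdvd _ _ (IsDiscreteValuationRing.addVal_le_iff_dvd.1 ?_)
    obtain ⟨n, hn⟩ := ENat.ne_top_iff_exists.1
      (mt IsDiscreteValuationRing.addVal_eq_top_iff.1 ((map_ne_zero_iff i hinj).2 ha0))
    rw [hπn, ← hn]
    exact_mod_cast Nat.find_min' hex ⟨a, ha, ha0, hn.symm⟩
  have hspan : maximalIdeal A = Ideal.span {π} := le_antisymm
    (fun a ha => Ideal.mem_span_singleton.2 (hdiv a ha))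
    ((Ideal.span_singleton_le_iff_mem _).2 hπ)
  have hπpos : 1 ≤ Nat.find hex := by
    by_contra h
    have h0 : Nat.find hex = 0 := by omega
    rw [h0, Nat.cast_zero, IsDiscreteValuationRing.addVal_eq_zero_iff] at hπn
    exact hπ ((isUnit_map_iff i π).1 hπn)
  refine IsDiscreteValuationRing.ofHasUnitMulPowIrreducibleFactorization
    ⟨π, IsDiscreteValuationRing.irreducible_of_span_eq_maximalIdeal π hπ0 hspan, fun {x} hx => ?_⟩
  obtain ⟨n, hn⟩ := ENat.ne_top_iff_exists.1
    (mt IsDiscreteValuationRing.addVal_eq_top_iff.1 ((map_ne_zero_iff i hinj).2 hx))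
  induction n using Nat.strong_induction_on generalizing x with
  | _ n ih =>
    by_cases hu : IsUnit x
    · exact ⟨0, by simpa using (associated_one_iff_isUnit.2 hu).symm⟩
    obtain ⟨y, rfl⟩ := hdiv x hu
    have hy : y ≠ 0 := right_ne_zero_of_mul hx
    obtain ⟨m, hm⟩ := ENat.ne_top_iff_exists.1
      (mt IsDiscreteValuationRing.addVal_eq_top_iff.1 ((map_ne_zero_iff i hinj).2 hy))
    rw [map_mul, IsDiscreteValuationRing.addVal_mul, hπn, ← hm] at hn
    obtain ⟨k, hk⟩ := ih m (by norm_cast at hn; omega) hy hm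
    exact ⟨k + 1, by rw [pow_succ']; exact hk.mul_left π⟩

end Dvr

/-! ### Local rings of a quotient by a finite group -/

section LocalCover

variable {A₀ B₀ A B : Type u} [CommRing A₀] [CommRing B₀] [CommRing A] [CommRing B]
  [Algebra A₀ B₀]

/-- The local ring `B` of `B₀` dominates the local ring `A` of `A₀`, for an extension of domains
`B₀` of `A₀`. -/
structure IsLocalCover (k : A₀ →+* A) (j : B₀ →+* B) (i : A →+* B) : Prop where
  comp : ∀ a, i (k a) = j (algebraMap A₀ B₀ a)
  injective : Function.Injective j
  injective_algebraMap : Function.Injective (algebraMap A₀ B₀)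
  frac_left : ∀ x : A, ∃ a s, IsUnit (k s) ∧ x * k s = k a
  frac_right : ∀ y : B, ∃ b s, IsUnit (j s) ∧ y * j s = j b
  isLocalHom : IsLocalHom i

namespace IsLocalCover

variable {k : A₀ →+* A} {j : B₀ →+* B} {i : A →+* B} (h : IsLocalCover k j i)
include h

lemma injective_left : Function.Injective k := by
  intro a b hab
  exact h.injective_algebraMap (h.injective (by rw [← h.comp, ← h.comp, hab]))

lemma injective_map : Function.Injective i := by
  rw [injective_iff_map_eq_zero]
  intro x hx
  obtain ⟨a, s, hs, hxa⟩ := h.frac_left x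
  have h1 := congrArg i hxa
  rw [map_mul, hx, zero_mul, h.comp] at h1
  have h2 : a = 0 := h.injective_algebraMap (h.injective (by rw [← h1, map_zero, map_zero]))
  rw [h2, map_zero] at hxa
  exact hs.mul_left_eq_zero.1 hxa

lemma isUnit_iff (a : A₀) : IsUnit (k a) ↔ IsUnit (j (algebraMap A₀ B₀ a)) := by
  have := h.isLocalHom
  rw [← h.comp]
  exact (isUnit_map_iff i _).symm

lemma exists_polynomial (F : A[X]) :
    ∃ s, IsUnit (k s) ∧ ∃ F₀ : A₀[X], F₀.map k = C (k s) * F := by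
  induction F using Polynomial.induction_on' with
  | add p q hp hq =>
    obtain ⟨s, hs, P, hP⟩ := hp
    obtain ⟨t, ht, Q, hQ⟩ := hq
    refine ⟨s * t, by rw [map_mul]; exact hs.mul ht, C t * P + C s * Q, ?_⟩
    simp only [Polynomial.map_add, Polynomial.map_mul, map_C, hP, hQ, map_mul]
    ring
  | monomial n z =>
    obtain ⟨a, s, hs, hz⟩ := h.frac_left z
    exact ⟨s, hs, monomial n a, by rw [map_monomial, C_mul_monomial, mul_comm, hz]⟩

lemma eval₂_map (F : A₀[X]) (z : B₀) :
    (F.map k).eval₂ i (j z) = j (F.eval₂ (algebraMap A₀ B₀) z) := by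
  rw [Polynomial.eval₂_map, hom_eval₂]
  congr 1
  exact RingHom.ext h.comp

section Group

variable {G : Type} [Group G] [Fintype G] [MulSemiringAction G B₀] [SMulCommClass G A₀ B₀]

lemma eq_zero_of_eval₂_eq_zero [IsDomain B₀] {z : B₀} (hz : ∀ g : G, g • z = z → g = 1) {F : A[X]}
    (hF : F.degree < (Fintype.card G : WithBot ℕ)) (hFz : F.eval₂ i (j z) = 0) : F = 0 := by
  obtain ⟨s, hs, F₀, hF₀⟩ := h.exists_polynomial F
  have h1 : F₀.degree < (Fintype.card G : WithBot ℕ) := by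
    rw [← degree_map_eq_of_injective h.injective_left, hF₀]
    refine (degree_mul_le _ _).trans_lt ((add_le_add_left degree_C_le _).trans_lt ?_)
    rwa [zero_add]
  have h2 : F₀ = 0 := by
    refine QuotientRamification.eq_zero_of_eval₂_eq_zero h.injective_algebraMap hz h1 ?_
    refine h.injective ?_
    rw [map_zero, ← h.eval₂_map, hF₀, eval₂_mul, hFz, mul_zero]
  rw [h2, Polynomial.map_zero] at hF₀
  exact (hs.map C).mul_right_eq_zero.1 hF₀.symm

lemma dvd_of_eval₂_eq_zero [IsDomain B₀] {z : B₀} (hz : ∀ g : G, g • z = z → g = 1) {H : A[X]}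
    (hH : H.Monic) (hdeg : H.natDegree = Fintype.card G) (hHz : H.eval₂ i (j z) = 0) (F : A[X])
    (hFz : F.eval₂ i (j z) = 0) : H ∣ F := by
  nontriviality A
  rw [← modByMonic_eq_zero_iff_dvd hH]
  refine h.eq_zero_of_eval₂_eq_zero hz ?_ ?_
  · rw [← hdeg, ← degree_eq_natDegree hH.ne_zero]
    exact degree_modByMonic_lt _ hH
  · rw [modByMonic_eq_sub_mul_div _ H, eval₂_sub, eval₂_mul, hFz, hHz, zero_mul, sub_zero]

/-- If `B` is a localization of `A[z]`, then `A` is the intersection of `B` and the fraction field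
of `A`. -/
lemma dvd_of_map_dvd [IsDomain B₀] [IsLocalRing A] [IsLocalRing B] {z : B₀}
    (hz : ∀ g : G, g • z = z → g = 1)
    {H : A[X]} (hH : H.Monic) (hdeg : H.natDegree = Fintype.card G) (hHz : H.eval₂ i (j z) = 0)
    (hgen : ∀ b : B, ∃ P Q : A[X], IsUnit (Q.eval₂ i (j z)) ∧
      b * Q.eval₂ i (j z) = P.eval₂ i (j z)) (a b : A) (hab : i a ∣ i b) : a ∣ b := by
  have := h.isLocalHom
  obtain ⟨c, hc⟩ := hab
  obtain ⟨P, Q, hQ, hPQ⟩ := hgen c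
  have hmod : ∀ F : A[X], (F %ₘ H).eval₂ i (j z) = F.eval₂ i (j z) := fun F => by
    rw [modByMonic_eq_sub_mul_div _ H, eval₂_sub, eval₂_mul, hHz, zero_mul, sub_zero]
  have hdegmod : ∀ F : A[X], (F %ₘ H).degree < (Fintype.card G : WithBot ℕ) := fun F => by
    rw [← hdeg, ← degree_eq_natDegree hH.ne_zero]
    exact degree_modByMonic_lt _ hH
  -- From b·Q(z) = a·P(z), the remainders modulo `H` satisfy the same equation coefficientwise.
  -- Since Q(z) is a unit, its remainder has a unit coefficient, and that coefficient gives a ∣ b.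
  have hzero : C b * (Q %ₘ H) - C a * (P %ₘ H) = 0 := by
    refine h.eq_zero_of_eval₂_eq_zero hz ?_ ?_
    · refine (degree_sub_le _ _).trans_lt (max_lt ?_ ?_) <;>
      · refine (degree_mul_le _ _).trans_lt ((add_le_add_left degree_C_le _).trans_lt ?_)
        rw [zero_add]
        exact hdegmod _
    · rw [eval₂_sub, eval₂_mul, eval₂_mul, eval₂_C, eval₂_C, hmod, hmod, ← hPQ, hc]
      ring
  have hex : ∃ n, IsUnit ((Q %ₘ H).coeff n) := by
    by_contra! hcon
    rw [← hmod, eval₂_eq_sum] at hQ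
    refine (mem_maximalIdeal _).1 (Ideal.sum_mem _ fun n _ => Ideal.mul_mem_right _ _ ?_) hQ
    rw [mem_maximalIdeal, map_mem_nonunits_iff]
    exact hcon n
  obtain ⟨n, u, hu⟩ := hex
  have h1 := congrArg (fun F => F.coeff n) hzero
  simp only [coeff_sub, coeff_C_mul, coeff_zero, ← hu, sub_eq_zero] at h1
  exact ⟨(P %ₘ H).coeff n * ↑u⁻¹, by rw [← mul_assoc, ← h1, Units.mul_inv_cancel_right]⟩

/-- Consider the prime of `B₀` below the maximal ideal of `B`. If `G` stabilizes it, then, every g ≠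
1 being a generator, an element moved modulo this prime by one group element is moved by all g ≠ 1.
Otherwise no g ≠ 1 stabilizes it. Then there are `w g` outside the prime with g·(w g) inside, and
their product `z` lies outside while all its other conjugates lie inside. -/
lemma exists_isUnit_sub_smul [IsLocalRing B] {p : ℕ} [Fact p.Prime] (hcard : Nat.card G = p)
    (hmove : ∃ (g : G) (b : B₀), IsUnit (j (g • b - b))) :
    ∃ z : B₀, ∀ g : G, g ≠ 1 → IsUnit (j (z - g • z)) := by
  obtain ⟨g₀, b₀, hgb⟩ := hmove
  by_cases hst : ∀ (g : G) (b : B₀), ¬ IsUnit (j b) → ¬ IsUnit (j (g • b))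
  · refine ⟨b₀, fun g hg => ?_⟩
    by_contra hcon
    obtain ⟨n, hn⟩ := mem_powers_of_prime_card hcard hg (g' := g₀)
    have hpow : ∀ n : ℕ, ¬ IsUnit (j (g ^ n • b₀ - b₀)) := by
      intro n
      induction n with
      | zero => simp
      | succ n ih =>
        have h1 : g ^ (n + 1) • b₀ - b₀ = (g ^ n • b₀ - b₀) - g ^ n • (b₀ - g • b₀) := by
          rw [smul_sub, smul_smul, pow_succ]
          ring
        have h2 := hst (g ^ n) _ hcon
        rw [h1, map_sub]
        exact (maximalIdeal B).sub_mem ih h2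
    have := hpow n
    rw [show g ^ n = g₀ from hn] at this
    exact this hgb
  · push Not at hst
    obtain ⟨g₁, b₁, hb₁, hgb₁⟩ := hst
    have hex : ∀ g : G, g ≠ 1 → ∃ z, IsUnit (j z) ∧ ¬ IsUnit (j (g • z)) := by
      intro g hg
      by_contra! hcon
      have hinv : ∀ b, ¬ IsUnit (j b) → ¬ IsUnit (j (g⁻¹ • b)) := fun b hb hb' =>
        hb (by simpa using hcon _ hb')
      have hpow : ∀ (n : ℕ) (b), ¬ IsUnit (j b) → ¬ IsUnit (j (g⁻¹ ^ n • b)) := by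
        intro n
        induction n with
        | zero => simp
        | succ n ih =>
          intro b hb
          rw [pow_succ, mul_smul]
          exact ih _ (hinv b hb)
      obtain ⟨n, hn⟩ := mem_powers_of_prime_card hcard (inv_ne_one.2 hg) (g' := g₁)
      have := hpow n b₁ hb₁
      rw [show g⁻¹ ^ n = g₁ from hn] at this
      exact this hgb₁
    classical
    choose! w hw hw' using hex
    refine ⟨∏ g ∈ Finset.univ.erase (1 : G), w g, fun g hg => ?_⟩
    have h1 : IsUnit (j (∏ g ∈ Finset.univ.erase (1 : G), w g)) := by
      rw [map_prod, IsUnit.prod_iff]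
      exact fun g hg => hw g (Finset.ne_of_mem_erase hg)
    have h2 : ¬ IsUnit (j (g • ∏ g ∈ Finset.univ.erase (1 : G), w g)) := by
      rw [Finset.smul_prod', map_prod, IsUnit.prod_iff]
      exact fun h => hw' g hg (h g (Finset.mem_erase.2 ⟨hg, Finset.mem_univ _⟩))
    rw [map_sub]
    by_contra hcon
    refine (?_ : ¬ IsUnit _) h1
    have := (maximalIdeal B).add_mem hcon h2
    rwa [sub_add_cancel] at this

/-! ### The unramified case -/

section Unramified

variable [IsDomain B₀] [Algebra.IsInvariant A₀ B₀ G] [IsLocalRing B] {z : B₀}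
  (hz : ∀ g : G, g ≠ 1 → IsUnit (j (z - g • z)))
include hz

lemma eq_one_of_smul_eq (g : G) (hg : g • z = z) : g = 1 := by
  by_contra hne
  have := hz g hne
  rw [hg, sub_self, map_zero] at this
  exact not_isUnit_zero this

lemma isUnit_conjDifferent : IsUnit (j (conjDifferent G z)) := by
  classical
  rw [conjDifferent, map_prod, IsUnit.prod_iff]
  exact fun g hg => hz g (Finset.ne_of_mem_erase hg)

/-- Interpolating numerator and denominator of `b` introduces the same factor `conjDifferent G z`,
which cancels and is a unit here. -/
lemma exists_eval₂_eq (b : B) : ∃ P Q : A[X], IsUnit (Q.eval₂ i (j z)) ∧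
      b * Q.eval₂ i (j z) = P.eval₂ i (j z) := by
  obtain ⟨b₁, b₂, hb₂, hb⟩ := h.frac_right b
  obtain ⟨P, -, hP⟩ := exists_lagrange A₀ G z b₁
  obtain ⟨Q, -, hQ⟩ := exists_lagrange A₀ G z b₂
  refine ⟨P.map k, Q.map k, ?_, ?_⟩
  · rw [h.eval₂_map, hQ, map_mul]
    exact hb₂.mul (isUnit_conjDifferent h hz)
  · rw [h.eval₂_map, h.eval₂_map, hP, hQ, map_mul, map_mul, ← hb]
    ring

/-- `B` is unramified over `A` if the conjugates of `z` are distinct in the residue field. -/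
theorem map_maximalIdeal_eq [IsLocalRing A] : (maximalIdeal A).map i = maximalIdeal B := by
  have := h.isLocalHom
  have hle : (maximalIdeal A).map i ≤ maximalIdeal B :=
    Ideal.map_le_iff_le_comap.2 fun x hx => by
      rw [Ideal.mem_comap, mem_maximalIdeal, map_mem_nonunits_iff]
      exact hx
  have hpoly : ∀ F : A[X], F.map (residue A) = 0 → F.eval₂ i (j z) ∈ (maximalIdeal A).map i := by
    intro F hF
    rw [eval₂_eq_sum]
    refine Ideal.sum_mem _ fun n _ => Ideal.mul_mem_right _ _ (Ideal.mem_map_of_mem _ ?_)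
    rw [← residue_eq_zero_iff, ← coeff_map, hF, coeff_zero]
  obtain ⟨H₀, hmon, -, -, hHz, hHder⟩ := exists_charpoly A₀ G z
  let H := H₀.map k
  have hHz' : H.eval₂ i (j z) = 0 := by rw [h.eval₂_map, hHz, map_zero]
  have hHder' : H.derivative.eval₂ i (j z) = j (conjDifferent G z) := by
    rw [derivative_map, h.eval₂_map, hHder]
  let : Algebra (ResidueField A) (ResidueField B) := (ResidueField.map i).toAlgebra
  let zbar : ResidueField B := residue B (j z)
  have hres : ∀ F : A[X], aeval zbar (F.map (residue A)) = residue B (F.eval₂ i (j z)) := by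
    intro F
    rw [aeval_def, Polynomial.eval₂_map, hom_eval₂]
    rfl
  have hint : IsIntegral (ResidueField A) zbar :=
    ⟨H.map (residue A), (hmon.map k).map _, by rw [← aeval_def, hres, hHz', map_zero]⟩
  -- `M` lifts the minimal polynomial of the residue class of `z`, so H = MQ modulo 𝔪_A. As H'(z) is
  -- a unit and M(z) is not, differentiation shows that Q(z) is a unit, whence M(z) ∈ 𝔪_A B.
  obtain ⟨M, hM⟩ := Polynomial.map_surjective (residue A) residue_surjective
    (minpoly (ResidueField A) zbar)
  have hdvd : ∀ F : A[X], residue B (F.eval₂ i (j z)) = 0 →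
      ∃ Q : A[X], (F - M * Q).map (residue A) = 0 := by
    intro F hF
    rw [← hres] at hF
    obtain ⟨Q, hQ⟩ := minpoly.dvd _ _ hF
    obtain ⟨Q, rfl⟩ := Polynomial.map_surjective (residue A) residue_surjective Q
    exact ⟨Q, by rw [Polynomial.map_sub, Polynomial.map_mul, hM, hQ, sub_self]⟩
  have hMz : M.eval₂ i (j z) ∈ maximalIdeal B := by
    rw [← residue_eq_zero_iff, ← hres, hM, minpoly.aeval]
  have hMz' : M.eval₂ i (j z) ∈ (maximalIdeal A).map i := by
    obtain ⟨Q, hQ⟩ := hdvd H (by rw [hHz', map_zero])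
    have h1 := hpoly _ hQ
    have h2 := hpoly (derivative (H - M * Q)) (by rw [← derivative_map, hQ, derivative_zero])
    have h3 : IsUnit (Q.eval₂ i (j z)) := by
      by_contra hcon
      have h4 := hle h2
      rw [derivative_sub, eval₂_sub, derivative_mul, eval₂_add, eval₂_mul, eval₂_mul, hHder'] at h4
      have h5 := (maximalIdeal B).add_mem h4 ((maximalIdeal B).add_mem
        ((maximalIdeal B).mul_mem_left (M.derivative.eval₂ i (j z)) hcon)
        ((maximalIdeal B).mul_mem_right (Q.derivative.eval₂ i (j z)) hMz))
      rw [sub_add_cancel] at h5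
      exact h5 (isUnit_conjDifferent h hz)
    rw [eval₂_sub, eval₂_mul, hHz', zero_sub, neg_mem_iff] at h1
    exact (Ideal.mul_unit_mem_iff_mem _ h3).1 h1
  refine le_antisymm hle fun b hb => ?_
  obtain ⟨P, Q, hQ, hPQ⟩ := exists_eval₂_eq h hz b
  rw [← Ideal.mul_unit_mem_iff_mem _ hQ, hPQ]
  obtain ⟨N, hN⟩ := hdvd P (by
    rw [residue_eq_zero_iff, ← hPQ]
    exact Ideal.mul_mem_right _ _ hb)
  have h1 := hpoly _ hN
  rw [eval₂_sub, eval₂_mul] at h1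
  have := add_mem h1 (Ideal.mul_mem_right (N.eval₂ i (j z)) _ hMz')
  rwa [sub_add_cancel] at this

end Unramified

end Group

end IsLocalCover

end LocalCover

end QuotientRamification

set_option linter.unusedSectionVars false

/-! ### The fiercely ramified case: residue fields -/

namespace QuotientRamification

open Polynomial IsLocalRing
open IsDiscreteValuationRing (addVal)

namespace IsLocalCover

variable {A₀ B₀ A B : Type u} [CommRing A₀] [CommRing B₀] [CommRing A] [CommRing B]
  [Algebra A₀ B₀] {k : A₀ →+* A} {j : B₀ →+* B} {i : A →+* B} (h : IsLocalCover k j i)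
  {G : Type} [Group G] [Fintype G] [MulSemiringAction G B₀] [SMulCommClass G A₀ B₀]
  [Algebra.IsInvariant A₀ B₀ G] [IsDomain A] [IsDomain B₀] [IsDomain B] [IsLocalRing A]
  [IsDiscreteValuationRing B]

/-- The inertia group of the local ring `B` is `G`, the equation of its closed point is `x`, and
the action of `G` on `x` is trivial modulo `x²` whereas the action of `G` is nontrivial modulo
`x²`. -/
structure IsFierce (j : B₀ →+* B) (G : Type) [Group G] [MulSemiringAction G B₀] (x : B₀) :
    Prop where
  irreducible : Irreducible (j x)
  inert : ∀ (g : G) (b : B₀), ¬ IsUnit (j (g • b - b))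
  smul_eq : ∀ g : G, ∃ v, g • x = x * (1 + x * v)
  move : ∃ (g : G) (b : B₀), ¬ j x ^ 2 ∣ j (g • b - b)

section

variable {x : B₀} (hx : IsFierce j G x)
include h hx

omit h in
lemma IsFierce.isUnit_smul_iff (g : G) (b : B₀) : IsUnit (j (g • b)) ↔ IsUnit (j b) := by
  have h1 : ∀ (g : G) (b : B₀), IsUnit (j (g • b)) → IsUnit (j b) := by
    intro g b hb
    by_contra hcon
    have := (maximalIdeal B).add_mem (hx.inert g b) hcon
    rw [← map_add, sub_add_cancel] at this
    exact this hb
  refine ⟨h1 g b, fun hb => h1 g⁻¹ _ ?_⟩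
  rwa [inv_smul_smul]

omit h in
lemma IsFierce.dvd_iff (b : B) : j x ∣ b ↔ ¬ IsUnit b := by
  rw [← Ideal.mem_span_singleton, ← hx.irreducible.maximalIdeal_eq]
  rfl

lemma exists_mul_eq_of_dvd {c b : B₀} (hc : j c ∣ j b) : ∃ d s, IsUnit (j s) ∧ b * s = c * d := by
  obtain ⟨y, hy⟩ := hc
  obtain ⟨d, s, hs, hds⟩ := h.frac_right y
  refine ⟨d, s, hs, h.injective ?_⟩
  rw [map_mul, map_mul, hy, ← hds, mul_assoc]

lemma sq_dvd_smul (g : G) {b : B₀} (hb : j x ^ 2 ∣ j b) : j x ^ 2 ∣ j (g • b) := by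
  rw [← map_pow] at hb
  obtain ⟨d, s, hs, hds⟩ := exists_mul_eq_of_dvd h hx hb
  obtain ⟨v, hv⟩ := hx.smul_eq g
  have h1 := congrArg (fun b => j (g • b)) hds
  simp only [smul_mul', smul_pow', hv, map_mul, map_pow] at h1
  rw [← ((hx.isUnit_smul_iff g s).2 hs).dvd_mul_right, h1]
  exact ⟨(j (1 + x * v)) ^ 2 * j (g • d), by ring⟩

/-- Up to a denominator b = xd, and g(xd) - xd = x(gd - d) + x²v·gd, where gd - d is divisible by x
because the action on residue classes is trivial. -/
lemma sq_dvd_smul_sub (g : G) {b : B₀} (hb : ¬ IsUnit (j b)) : j x ^ 2 ∣ j (g • b - b) := by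
  obtain ⟨d, s, hs, hds⟩ := exists_mul_eq_of_dvd h hx ((hx.dvd_iff _).2 hb)
  obtain ⟨v, hv⟩ := hx.smul_eq g
  have h1 := congrArg (fun b => g • b) hds
  simp only [smul_mul', hv] at h1
  have h2 : (g • b - b) * (s * g • s) =
      x * ((g • d - d) * s - d * (g • s - s) + x * (v * (g • d) * s)) := by
    linear_combination s * h1 - (g • s) * hds
  have h3 : j x ∣ j ((g • d - d) * s - d * (g • s - s) + x * (v * (g • d) * s)) := by
    rw [map_add, map_sub, map_mul, map_mul, map_mul]
    exact dvd_add (dvd_sub (((hx.dvd_iff _).2 (hx.inert g d)).mul_right _)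
      (((hx.dvd_iff _).2 (hx.inert g s)).mul_left _)) (dvd_mul_right _ _)
  have h4 := congrArg j h2
  rw [map_mul, map_mul] at h4
  rw [← (hs.mul ((hx.isUnit_smul_iff g s).2 hs)).dvd_mul_right, h4, map_mul, pow_two]
  exact mul_dvd_mul_left _ h3

variable {p : ℕ} [Fact p.Prime] (hcard : Nat.card G = p)
include hcard

/-- Every g ≠ 1 generates `G` and the multiples of x² are stable under `G`, so an element fixed
modulo x² by one g ≠ 1 is fixed by all of `G`. -/
lemma exists_not_sq_dvd : ∃ z : B₀, ∀ g : G, g ≠ 1 → ¬ j x ^ 2 ∣ j (z - g • z) := by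
  obtain ⟨g₀, z, hz⟩ := hx.move
  refine ⟨z, fun g hg hcon => ?_⟩
  obtain ⟨n, hn⟩ := mem_powers_of_prime_card hcard hg (g' := g₀)
  have hpow : ∀ n : ℕ, j x ^ 2 ∣ j (g ^ n • z - z) := by
    intro n
    induction n with
    | zero => simp
    | succ n ih =>
      have h1 : g ^ (n + 1) • z - z = (g ^ n • z - z) - g ^ n • (z - g • z) := by
        rw [smul_sub, smul_smul, pow_succ]
        ring
      rw [h1, map_sub]
      exact dvd_sub ih (sq_dvd_smul h hx _ hcon)
  have := hpow n
  rw [show g ^ n = g₀ from hn] at this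
  exact hz this

variable {z : B₀} (hz : ∀ g : G, g ≠ 1 → ¬ j x ^ 2 ∣ j (z - g • z))
include hz

lemma associated_sub_smul (g : G) (hg : g ≠ 1) : Associated (j (z - g • z)) (j x) := by
  have h1 : j x ∣ j (z - g • z) := by
    rw [hx.dvd_iff, ← neg_sub, map_neg, IsUnit.neg_iff]
    exact hx.inert g z
  obtain ⟨y, hy⟩ := h1
  have h2 : IsUnit y := by
    by_contra hcon
    refine hz g hg ?_
    rw [hy, pow_two]
    exact mul_dvd_mul_left _ ((hx.dvd_iff _).2 hcon)
  rw [hy]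
  exact associated_mul_unit_left _ _ h2

/-- Each of the p - 1 factors z - gz has valuation exactly one. -/
lemma associated_conjDifferent : Associated (j (conjDifferent G z)) (j x ^ (p - 1)) := by
  classical
  have : j x ^ (p - 1) = ∏ g ∈ Finset.univ.erase (1 : G), j x := by
    rw [Finset.prod_const, Finset.card_erase_of_mem (Finset.mem_univ _), Finset.card_univ,
      ← Nat.card_eq_fintype_card, hcard]
  rw [this, conjDifferent, map_prod]
  exact Associated.prod _ _ _ fun g hg =>
    associated_sub_smul h hx hcard hz g (Finset.ne_of_mem_erase hg)

lemma eq_one_of_smul_eq_self (g : G) (hg : g • z = z) : g = 1 := by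
  by_contra hne
  refine hz g hne ?_
  rw [hg, sub_self, map_zero]
  exact dvd_zero _

/-- The residue class of `z` does not lie in the residue field of `A`. -/
lemma isUnit_sub_map (a : A) : IsUnit (j z - i a) := by
  by_contra hcon
  obtain ⟨g, hg⟩ : ∃ g : G, g ≠ 1 := by
    have : Nontrivial G := Finite.one_lt_card_iff_nontrivial.1
      (hcard ▸ (Fact.out : p.Prime).one_lt)
    exact exists_ne 1
  obtain ⟨b, s, hs, hbs⟩ := h.frac_left a
  have h1 : (j z - i a) * j (algebraMap A₀ B₀ s) =
      j (z * algebraMap A₀ B₀ s - algebraMap A₀ B₀ b) := by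
    rw [map_sub, map_mul, ← h.comp b, ← hbs, map_mul, h.comp s]
    ring
  have h2 : ¬ IsUnit (j (z * algebraMap A₀ B₀ s - algebraMap A₀ B₀ b)) := by
    rw [← h1]
    exact fun hu => hcon (isUnit_of_mul_isUnit_left hu)
  -- `b` and `s` come from the invariants, so if `z` were congruent to b/s, then (gz - z)s would be
  -- divisible by x².
  have h3 := sq_dvd_smul_sub h hx g h2
  rw [smul_sub, smul_mul', smul_algebraMap, smul_algebraMap, sub_sub_sub_cancel_right,
    ← sub_mul, map_mul, ((h.isUnit_iff s).1 hs).dvd_mul_right] at h3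
  refine hz g hg ?_
  rwa [← neg_sub, map_neg, dvd_neg]

end

section Dvd

variable (A₀ G) in
lemma exists_norm (b : B₀) : ∃ a : A₀, algebraMap A₀ B₀ a = ∏ g : G, g • b :=
  Algebra.IsInvariant.isInvariant (G := G) _ fun g => by rw [Finset.smul_prod_perm]

-- The norm of `b` is such an element.
variable (G) in
include h G in
lemma exists_mem_maximalIdeal_ne_zero {b : B₀} (hb : ¬ IsUnit (j b)) (hb0 : b ≠ 0) :
    ∃ a ∈ IsLocalRing.maximalIdeal A, a ≠ 0 := by
  obtain ⟨n, hn⟩ := exists_norm A₀ G b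
  refine ⟨k n, ?_, ?_⟩
  · rw [mem_maximalIdeal, mem_nonunits_iff, h.isUnit_iff, hn, map_prod, IsUnit.prod_iff]
    intro hu
    have := hu 1 (Finset.mem_univ _)
    rw [one_smul] at this
    exact hb this
  · rw [Ne, map_eq_zero_iff k h.injective_left, ← map_eq_zero_iff _ h.injective_algebraMap, hn,
      Finset.prod_eq_zero_iff]
    rintro ⟨g, -, hg⟩
    rw [smul_eq_zero_iff_eq] at hg
    exact hb0 hg

variable {x : B₀} (hx : IsFierce j G x)
include h hx

/-- The denominator `w` of the quotient can be replaced by its norm, which is still a unit because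
the conjugates of a unit are units. Then the numerator is an element of `B₀` which is also a
quotient of invariants, hence invariant, and it lies in `A₀`. -/
lemma dvd_of_map_dvd_of_isFierce (a b : A) (hab : i a ∣ i b) : a ∣ b := by
  classical
  obtain ⟨c, hc⟩ := hab
  obtain ⟨a₁, s, hs, ha⟩ := h.frac_left a
  obtain ⟨b₁, t, ht, hb⟩ := h.frac_left b
  obtain ⟨c₁, w, hw, hc₁⟩ := h.frac_right c
  obtain ⟨n, hn⟩ := exists_norm A₀ G w
  have hprod : ∏ g : G, g • w = w * ∏ g ∈ Finset.univ.erase (1 : G), g • w := by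
    rw [← Finset.mul_prod_erase _ _ (Finset.mem_univ (1 : G)), one_smul]
  have hnu : IsUnit (k n) := by
    rw [h.isUnit_iff, hn, map_prod, IsUnit.prod_iff]
    exact fun g _ => (hx.isUnit_smul_iff g w).2 hw
  by_cases ha₁ : a₁ = 0
  · rw [ha₁, map_zero] at ha
    have ha0 : a = 0 := hs.mul_left_eq_zero.1 ha
    rw [ha0, map_zero, zero_mul] at hc
    have hb0 : b = 0 := h.injective_map (by rw [hc, map_zero])
    rw [hb0]
    exact dvd_zero a
  let e : B₀ := algebraMap A₀ B₀ t * (c₁ * ∏ g ∈ Finset.univ.erase (1 : G), g • w)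
  have he : algebraMap A₀ B₀ a₁ * e = algebraMap A₀ B₀ (b₁ * s * n) := by
    refine h.injective ?_
    have h1 := congrArg i ha
    have h2 := congrArg i hb
    rw [map_mul, h.comp, h.comp] at h1 h2
    simp only [e, map_mul, hn, hprod]
    rw [← h1, ← h2, ← hc₁, hc]
    ring
  obtain ⟨e₀, he₀⟩ := Algebra.IsInvariant.isInvariant (A := A₀) (G := G) e fun g => by
    have h1 := congrArg (fun y => g • y) he
    simp only [smul_mul', smul_algebraMap] at h1
    rw [← he] at h1
    refine mul_left_cancel₀ ?_ h1
    rwa [Ne, map_eq_zero_iff _ h.injective_algebraMap]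
  have h1 : a₁ * e₀ = b₁ * s * n := h.injective_algebraMap (by rw [map_mul, he₀, he])
  have h2 := congrArg k h1
  simp only [map_mul, ← ha, ← hb] at h2
  have h3 : b * (k t * k s * k n) = a * (k s * k e₀) := by linear_combination -h2
  exact ((ht.mul hs).mul hnu).dvd_mul_right.1 ⟨_, h3⟩

theorem isDiscreteValuationRing_of_isFierce : IsDiscreteValuationRing A :=
  have := h.isLocalHom
  isDiscreteValuationRing_of_dvd h.injective_map (dvd_of_map_dvd_of_isFierce h hx)
    (exists_mem_maximalIdeal_ne_zero h G hx.irreducible.not_isUnit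
      (by rintro rfl; exact hx.irreducible.ne_zero (map_zero j)))

end Dvd

section Residue

variable [Algebra (ResidueField A) (ResidueField B)]
  (hres : ∀ a : A, algebraMap (ResidueField A) (ResidueField B) (residue A a) = residue B (i a))
  {x : B₀} (hx : IsFierce j G x) {p : ℕ} [Fact p.Prime] (hcard : Nat.card G = p)
include h hres hx hcard

/-- All conjugates of an element have the same residue class, so its norm reduces to the p-th power.
-/
lemma pow_mem_range (b : ResidueField B) :
    b ^ p ∈ (algebraMap (ResidueField A) (ResidueField B)).range := by
  have key : ∀ b : B₀, ∃ a : A₀, algebraMap _ (ResidueField B) (residue A (k a)) =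
      residue B (j b) ^ p := by
    intro b
    obtain ⟨a, ha⟩ := exists_norm A₀ G b
    refine ⟨a, ?_⟩
    rw [hres, h.comp, ha, map_prod, map_prod, ← hcard, Nat.card_eq_fintype_card,
      ← Finset.card_univ, ← Finset.prod_const]
    refine Finset.prod_congr rfl fun g _ => ?_
    rw [← sub_eq_zero, ← map_sub, ← map_sub, residue_eq_zero_iff]
    exact hx.inert g b
  obtain ⟨b, rfl⟩ := residue_surjective b
  obtain ⟨b₁, s, hs, hb⟩ := h.frac_right b
  obtain ⟨a, ha⟩ := key b₁
  obtain ⟨c, hc⟩ := key s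
  refine ⟨residue A (k a) / residue A (k c), ?_⟩
  have hs' : residue B (j s) ≠ 0 := (residue_ne_zero_iff_isUnit _).2 hs
  rw [map_div₀, ha, hc, ← hb, map_mul, mul_pow, mul_div_cancel_right₀ _ (pow_ne_zero _ hs')]

variable {z : B₀} (hz : ∀ g : G, g ≠ 1 → ¬ j x ^ 2 ∣ j (z - g • z))
include hz

lemma residue_notMem_range :
    residue B (j z) ∉ (algebraMap (ResidueField A) (ResidueField B)).range := by
  rintro ⟨a, ha⟩
  obtain ⟨a, rfl⟩ := residue_surjective a
  rw [hres, ← sub_eq_zero, ← map_sub, residue_eq_zero_iff, ← neg_mem_iff, neg_sub] at ha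
  exact ha (isUnit_sub_map h hx hcard hz a)

/-- The trace of `z` reduces to p times the class of `z`. If p were nonzero in the residue field,
this class would come from `A`. -/
lemma charP_residueField : CharP (ResidueField A) p := by
  have h0 : (p : ResidueField A) = 0 := by
    by_contra hne
    obtain ⟨t, ht⟩ := Algebra.IsInvariant.isInvariant (A := A₀) (G := G) (∑ g : G, g • z)
      fun g => by
        rw [Finset.smul_sum]
        exact Fintype.sum_equiv (Equiv.mulLeft g) _ _ fun k => by
          rw [Equiv.coe_mulLeft, mul_smul]
    refine residue_notMem_range h hres hx hcard hz ⟨residue A (k t) / p, ?_⟩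
    have hne' : (p : ResidueField B) ≠ 0 := by
      rw [← map_natCast (algebraMap (ResidueField A) (ResidueField B))]
      exact (_root_.map_ne_zero _).2 hne
    rw [map_div₀, map_natCast, hres, h.comp, ht, map_sum, map_sum, div_eq_iff hne']
    have : ∀ g : G, residue B (j (g • z)) = residue B (j z) := fun g => by
      rw [← sub_eq_zero, ← map_sub, ← map_sub, residue_eq_zero_iff]
      exact hx.inert g z
    simp only [this, Finset.sum_const, Finset.card_univ, ← Nat.card_eq_fintype_card, hcard,
      nsmul_eq_mul, mul_comm]
  exact (CharP.charP_iff_prime_eq_zero Fact.out).2 h0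

/-- In characteristic p the class of `z` is the only p-th root of `a`, and it does not come from
`A`. So X^p - a has no root in the residue field of `A`, which makes it irreducible. -/
lemma exists_minpoly : ∃ a : ResidueField A,
    minpoly (ResidueField A) (residue B (j z)) = X ^ p - C a := by
  have hp : p.Prime := Fact.out
  have := charP_residueField h hres hx hcard hz
  have : CharP (ResidueField B) p :=
    charP_of_injective_algebraMap (algebraMap (ResidueField A) (ResidueField B)).injective p
  obtain ⟨a, ha⟩ := pow_mem_range h hres hx hcard (residue B (j z))
  refine ⟨a, (minpoly.eq_of_irreducible_of_monic ?_ ?_ (monic_X_pow_sub_C a hp.ne_zero)).symm⟩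
  · refine (X_pow_sub_C_irreducible_iff_of_prime hp).2 fun b hb => ?_
    refine residue_notMem_range h hres hx hcard hz ⟨b, ?_⟩
    rw [← hb, map_pow] at ha
    exact frobenius_inj _ p ha
  · rw [map_sub, map_pow, aeval_X, aeval_C, ha, sub_self]

/-- The class of `z` has degree p over the residue field of `A`, so no nonzero polynomial of smaller
degree vanishes at it. -/
lemma isUnit_eval₂ {F : A[X]} (hF : F.degree < (p : WithBot ℕ)) (hF' : F.map (residue A) ≠ 0) :
    IsUnit (F.eval₂ i (j z)) := by
  obtain ⟨a, ha⟩ := exists_minpoly h hres hx hcard hz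
  by_contra hcon
  have h1 : aeval (residue B (j z)) (F.map (residue A)) = 0 := by
    rw [aeval_def, Polynomial.eval₂_map]
    have : (algebraMap (ResidueField A) (ResidueField B)).comp (residue A) = (residue B).comp i :=
      RingHom.ext hres
    rw [this, ← hom_eval₂, residue_eq_zero_iff]
    exact hcon
  have h2 := minpoly.degree_le_of_ne_zero _ _ hF' h1
  rw [ha, degree_X_pow_sub_C (Fact.out : p.Prime).pos] at h2
  exact absurd (h2.trans degree_map_le) hF.not_ge

end Residue

end IsLocalCover

end QuotientRamification

set_option linter.unusedSectionVars false

/-! ### The fiercely ramified case: ramification index one and generation by `z` -/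

namespace QuotientRamification

open Polynomial IsLocalRing
open IsDiscreteValuationRing (addVal)

lemma exists_eq_C_pow_mul {A : Type u} [CommRing A] [IsDomain A] [IsDiscreteValuationRing A]
    {π : A} (hπ : Irreducible π) {F : A[X]} (hF : F ≠ 0) :
    ∃ (n : ℕ) (F' : A[X]), F = C (π ^ n) * F' ∧ F'.map (residue A) ≠ 0 ∧
      F'.degree = F.degree := by
  obtain ⟨m, hm⟩ : ∃ m, F.coeff m ≠ 0 := by
    by_contra! hcon
    exact hF (Polynomial.ext hcon)
  obtain ⟨v, hv⟩ := ENat.ne_top_iff_exists.1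
    (mt IsDiscreteValuationRing.addVal_eq_top_iff.1 hm)
  induction v generalizing F with
  | zero =>
    refine ⟨0, F, by simp, fun h => ?_, rfl⟩
    have h1 := congrArg (fun F => F.coeff m) h
    simp only [coeff_map, coeff_zero, residue_eq_zero_iff] at h1
    exact h1 (IsDiscreteValuationRing.addVal_eq_zero_iff.1 hv.symm)
  | succ v ih =>
    by_cases hF' : F.map (residue A) = 0
    · have hdvd : C π ∣ F := by
        rw [C_dvd_iff_dvd_coeff]
        intro n
        rw [← Ideal.mem_span_singleton, ← hπ.maximalIdeal_eq, ← residue_eq_zero_iff, ← coeff_map,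
          hF', coeff_zero]
      obtain ⟨F₁, rfl⟩ := hdvd
      rw [coeff_C_mul] at hm hv
      rw [IsDiscreteValuationRing.addVal_mul, IsDiscreteValuationRing.addVal_uniformizer hπ] at hv
      have hv' : (v : ℕ∞) = addVal A (F₁.coeff m) := by
        obtain ⟨w, hw⟩ := ENat.ne_top_iff_exists.1
          (mt IsDiscreteValuationRing.addVal_eq_top_iff.1 (right_ne_zero_of_mul hm))
        rw [← hw] at hv ⊢
        norm_cast at hv ⊢
        omega
      obtain ⟨n, F', h1, h2, h3⟩ := ih (right_ne_zero_of_mul hF) (right_ne_zero_of_mul hm) hv'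
      refine ⟨n + 1, F', ?_, h2, ?_⟩
      · rw [h1, ← mul_assoc, ← C_mul, pow_succ']
      · rw [h3, degree_C_mul hπ.ne_zero]
    · exact ⟨0, F, by simp, hF', rfl⟩

namespace IsLocalCover

variable {A₀ B₀ A B : Type u} [CommRing A₀] [CommRing B₀] [CommRing A] [CommRing B]
  [Algebra A₀ B₀] {k : A₀ →+* A} {j : B₀ →+* B} {i : A →+* B} (h : IsLocalCover k j i)
  {G : Type} [Group G] [Fintype G] [MulSemiringAction G B₀] [SMulCommClass G A₀ B₀]
  [Algebra.IsInvariant A₀ B₀ G] [IsDomain A] [IsDomain B₀] [IsDomain B]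
  [IsDiscreteValuationRing A] [IsDiscreteValuationRing B]
  [Algebra (ResidueField A) (ResidueField B)]
  (hres : ∀ a : A, algebraMap (ResidueField A) (ResidueField B) (residue A a) = residue B (i a))
  {x : B₀} (hx : IsFierce j G x) {p : ℕ} [Fact p.Prime] (hcard : Nat.card G = p)
  {z : B₀} (hz : ∀ g : G, g ≠ 1 → ¬ j x ^ 2 ∣ j (z - g • z))
include h hres hx hcard hz

lemma addVal_eval₂ {π : A} (hπ : Irreducible π) {F : A[X]} (hF : F ≠ 0)
    (hdeg : F.degree < (p : WithBot ℕ)) :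
    ∃ (n : ℕ) (F' : A[X]), F = C (π ^ n) * F' ∧ IsUnit (F'.eval₂ i (j z)) ∧
      addVal B (F.eval₂ i (j z)) = n • addVal B (i π) := by
  obtain ⟨n, F', h1, h2, h3⟩ := exists_eq_C_pow_mul hπ hF
  have h4 := isUnit_eval₂ h hres hx hcard hz (h3 ▸ hdeg) h2
  refine ⟨n, F', h1, h4, ?_⟩
  rw [h1, eval₂_mul, eval₂_C, map_pow, IsDiscreteValuationRing.addVal_mul,
    IsDiscreteValuationRing.addVal_pow, IsDiscreteValuationRing.addVal_eq_zero_iff.2 h4, add_zero]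

lemma addVal_lagrange (b : B₀) : ∃ F : A[X], F.degree < (p : WithBot ℕ) ∧
    F.eval₂ i (j z) = j b * j (conjDifferent G z) ∧
    addVal B (F.eval₂ i (j z)) = addVal B (j b) + (p - 1 : ℕ) := by
  obtain ⟨F₀, hdeg, hF₀⟩ := exists_lagrange A₀ G z b
  have h1 : addVal B (j (conjDifferent G z)) = (p - 1 : ℕ) := by
    rw [(IsDiscreteValuationRing.addVal_eq_iff_associated _ _).2
      (associated_conjDifferent h hx hcard hz), IsDiscreteValuationRing.addVal_pow,
      IsDiscreteValuationRing.addVal_uniformizer hx.irreducible, nsmul_one]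
  have h2 : (F₀.map k).eval₂ i (j z) = j b * j (conjDifferent G z) := by
    rw [h.eval₂_map, hF₀, map_mul]
  refine ⟨F₀.map k, ?_, h2, ?_⟩
  · rw [← hcard, Nat.card_eq_fintype_card]
    exact degree_map_le.trans_lt hdeg
  · rw [h2, IsDiscreteValuationRing.addVal_mul, h1]

/-- The ramification index of `B` over `A` is one. -/
theorem irreducible_map {π : A} (hπ : Irreducible π) : Irreducible (i π) := by
  have hp : p.Prime := Fact.out
  obtain ⟨e, he⟩ := ENat.ne_top_iff_exists.1 (mt IsDiscreteValuationRing.addVal_eq_top_iff.1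
    ((map_ne_zero_iff i h.injective_map).2 hπ.ne_zero))
  -- The interpolation polynomial of `b` has degree < p, so its value at `z`, of valuation v(b) + p
  -- - 1, has valuation a multiple of `e`. The elements 1 and `x` give two consecutive multiples of
  -- `e`.
  have key : ∀ (b : B₀) (m : ℕ), addVal B (j b) = m → e ∣ m + (p - 1) := by
    intro b m hb
    obtain ⟨F, hdeg, -, hv⟩ := addVal_lagrange h hres hx hcard hz b
    have hF : F ≠ 0 := by
      rintro rfl
      rw [eval₂_zero, IsDiscreteValuationRing.addVal_zero, hb] at hv
      exact absurd hv (by exact_mod_cast ENat.top_ne_natCast _)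
    obtain ⟨n, -, -, -, hn⟩ := addVal_eval₂ h hres hx hcard hz hπ hF hdeg
    rw [hv, hb, ← he, nsmul_eq_mul] at hn
    exact ⟨n, by rw [mul_comm]; exact_mod_cast hn⟩
  have h1 := key 1 0 (by rw [map_one, IsDiscreteValuationRing.addVal_one]; rfl)
  have h2 := key x 1 (by rw [IsDiscreteValuationRing.addVal_uniformizer hx.irreducible]; rfl)
  have h3 : e = 1 := by
    have := (Nat.dvd_sub h2 h1)
    rw [add_comm 0, add_comm 1, Nat.add_sub_add_left] at this
    exact Nat.dvd_one.1 this
  rw [h3, Nat.cast_one, ← IsDiscreteValuationRing.addVal_uniformizer hx.irreducible] at he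
  exact ((IsDiscreteValuationRing.addVal_eq_iff_associated _ _).1
    (by rw [← he])).irreducible hx.irreducible

theorem map_maximalIdeal_eq_of_isFierce :
    (IsLocalRing.maximalIdeal A).map i = IsLocalRing.maximalIdeal B := by
  obtain ⟨π, hπ⟩ := IsDiscreteValuationRing.exists_irreducible A
  rw [hπ.maximalIdeal_eq, Ideal.map_span, Set.image_singleton,
    (irreducible_map h hres hx hcard hz hπ).maximalIdeal_eq]

/-- The value at `z` of the interpolation polynomial of `b` has valuation at least p - 1. As π stays
a uniformizer in `B`, this valuation is the exponent of π in the content, and π^(p-1) can be divided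
out. Numerator and denominator of an element then carry the same remaining factor. -/
lemma exists_eval₂_eq_of_isFierce (b : B) : ∃ P Q : A[X], IsUnit (Q.eval₂ i (j z)) ∧
      b * Q.eval₂ i (j z) = P.eval₂ i (j z) := by
  obtain ⟨π, hπ⟩ := IsDiscreteValuationRing.exists_irreducible A
  have hπ' := irreducible_map h hres hx hcard hz hπ
  have key : ∀ b : B₀, ∃ F : A[X], i π ^ (p - 1) * F.eval₂ i (j z) =
      j b * j (conjDifferent G z) ∧ (IsUnit (j b) → IsUnit (F.eval₂ i (j z))) := by
    intro b
    obtain ⟨F, hdeg, hF, hv⟩ := addVal_lagrange h hres hx hcard hz b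
    by_cases hF0 : F = 0
    · rw [hF0, eval₂_zero] at hF
      refine ⟨0, by rw [← hF, eval₂_zero, mul_zero], fun hb => ?_⟩
      rw [hF0, eval₂_zero, IsDiscreteValuationRing.addVal_zero,
        IsDiscreteValuationRing.addVal_eq_zero_iff.2 hb, zero_add] at hv
      exact absurd hv (by exact_mod_cast ENat.top_ne_natCast _)
    obtain ⟨n, F', h1, h2, hn⟩ := addVal_eval₂ h hres hx hcard hz hπ hF0 hdeg
    rw [hv, IsDiscreteValuationRing.addVal_uniformizer hπ', nsmul_one] at hn
    have hle : p - 1 ≤ n := by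
      have : ((p - 1 : ℕ) : ℕ∞) ≤ n := hn ▸ le_add_self
      exact_mod_cast this
    obtain ⟨m, rfl⟩ := Nat.exists_eq_add_of_le hle
    refine ⟨C (π ^ m) * F', ?_, fun hb => ?_⟩
    · rw [← hF, h1, eval₂_mul, eval₂_mul, eval₂_C, eval₂_C, map_pow, map_pow, pow_add]
      ring
    · rw [IsDiscreteValuationRing.addVal_eq_zero_iff.2 hb, zero_add] at hn
      have hm : m = 0 := by
        norm_cast at hn
        omega
      rw [hm, pow_zero, C_1, one_mul]
      exact h2
  obtain ⟨b₁, s, hs, hb⟩ := h.frac_right b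
  obtain ⟨P, hP, -⟩ := key b₁
  obtain ⟨Q, hQ, hQu⟩ := key s
  refine ⟨P, Q, hQu hs, mul_left_cancel₀ (pow_ne_zero (p - 1) hπ'.ne_zero) ?_⟩
  rw [hP, ← hb, mul_left_comm, hQ]
  ring

theorem isPurelyInseparable_residueField :
    IsPurelyInseparable (ResidueField A) (ResidueField B) := by
  have := charP_residueField h hres hx hcard hz
  have := ExpChar.prime (R := ResidueField A) (q := p) Fact.out
  rw [isPurelyInseparable_iff_pow_mem (ResidueField A) p]
  exact fun b => ⟨1, by rw [pow_one]; exact pow_mem_range h hres hx hcard b⟩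

theorem finrank_residueField : Module.finrank (ResidueField A) (ResidueField B) = p := by
  have hp : p.Prime := Fact.out
  obtain ⟨a, ha⟩ := exists_minpoly h hres hx hcard hz
  have hint : IsIntegral (ResidueField A) (residue B (j z)) := by
    refine minpoly.ne_zero_iff.1 ?_
    rw [ha]
    exact X_pow_sub_C_ne_zero hp.pos a
  have htop : IntermediateField.adjoin (ResidueField A) {residue B (j z)} = ⊤ := by
    have haev : ∀ F : A[X], residue B (F.eval₂ i (j z)) ∈
        IntermediateField.adjoin (ResidueField A) {residue B (j z)} := by
      intro F
      have : residue B (F.eval₂ i (j z)) = aeval (residue B (j z)) (F.map (residue A)) := by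
        rw [aeval_def, Polynomial.eval₂_map, hom_eval₂]
        congr 1
        exact (RingHom.ext hres).symm
      rw [this]
      exact IntermediateField.algebra_adjoin_le_adjoin _ _
        (aeval_mem_adjoin_singleton (ResidueField A) _)
    rw [eq_top_iff]
    intro b _
    obtain ⟨b, rfl⟩ := residue_surjective b
    obtain ⟨P, Q, hQ, hb⟩ := exists_eval₂_eq_of_isFierce h hres hx hcard hz b
    have hQ' := (residue_ne_zero_iff_isUnit _).2 hQ
    have : residue B b = residue B (P.eval₂ i (j z)) / residue B (Q.eval₂ i (j z)) := by
      rw [eq_div_iff hQ', ← map_mul, hb]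
    rw [this]
    exact div_mem (haev P) (haev Q)
  rw [← IntermediateField.finrank_top', ← htop, IntermediateField.adjoin.finrank hint, ha,
    natDegree_X_pow_sub_C]

end IsLocalCover

end QuotientRamification

set_option linter.unusedSectionVars false

/-! ### Generators of the local extension and their different -/

namespace QuotientRamification

open Polynomial IsLocalRing

/-- The ring `B` is a localization of the subring generated over `A` by the root `z` of `H`, and
`H` generates the ideal of relations of `z`. The different of `B` over `A` is generated by `d`. -/
structure IsGenerator {A B : Type u} [CommRing A] [CommRing B] (i : A →+* B) (z : B) (H : A[X])
    (d : B) : Prop where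
  root : H.eval₂ i z = 0
  dvd : ∀ F : A[X], F.eval₂ i z = 0 → H ∣ F
  gen : ∀ b : B, ∃ P Q : A[X], IsUnit (Q.eval₂ i z) ∧ b * Q.eval₂ i z = P.eval₂ i z
  associated : Associated (H.derivative.eval₂ i z) d

namespace IsLocalCover

variable {A₀ B₀ A B : Type u} [CommRing A₀] [CommRing B₀] [CommRing A] [CommRing B]
  [Algebra A₀ B₀] {k : A₀ →+* A} {j : B₀ →+* B} {i : A →+* B} (h : IsLocalCover k j i)
  {G : Type} [Group G] [Fintype G] [MulSemiringAction G B₀] [SMulCommClass G A₀ B₀]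
  [Algebra.IsInvariant A₀ B₀ G] [IsDomain A] [IsDomain B₀]
  {p : ℕ} [Fact p.Prime] (hcard : Nat.card G = p)
include h hcard

lemma exists_isGenerator_of_isUnit [IsLocalRing A] [IsLocalRing B]
    (hmove : ∃ (g : G) (b : B₀), IsUnit (j (g • b - b))) :
    (maximalIdeal A).map i = maximalIdeal B ∧ (∀ a b : A, i a ∣ i b → a ∣ b) ∧
      ∃ z H, IsGenerator i z H 1 := by
  obtain ⟨z, hz⟩ := h.exists_isUnit_sub_smul hcard hmove
  obtain ⟨H, hmon, hdeg, -, hHz, hHder⟩ := exists_charpoly A₀ G z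
  have h1 : (H.map k).eval₂ i (j z) = 0 := by rw [h.eval₂_map, hHz, map_zero]
  have h2 : (H.map k).natDegree = Fintype.card G := by rw [hmon.natDegree_map, hdeg]
  have h3 := eq_one_of_smul_eq h hz
  refine ⟨h.map_maximalIdeal_eq hz, h.dvd_of_map_dvd h3 (hmon.map k) h2 h1
    (h.exists_eval₂_eq hz), j z, H.map k, h1, h.dvd_of_eval₂_eq_zero h3 (hmon.map k) h2 h1,
    h.exists_eval₂_eq hz, ?_⟩
  rw [derivative_map, h.eval₂_map, hHder, associated_one_iff_isUnit]
  exact h.isUnit_conjDifferent hz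

theorem exists_isGenerator_of_unramified [IsLocalRing A] [IsDomain B] [IsDiscreteValuationRing B]
    (hmove : ∃ (g : G) (b : B₀), IsUnit (j (g • b - b))) :
    IsDiscreteValuationRing A ∧ (maximalIdeal A).map i = maximalIdeal B ∧
      ∃ z H, IsGenerator i z H 1 := by
  obtain ⟨h1, h2, h3⟩ := h.exists_isGenerator_of_isUnit hcard hmove
  have := h.isLocalHom
  refine ⟨isDiscreteValuationRing_of_dvd h.injective_map h2 ?_, h1, h3⟩
  obtain ⟨π, hπ⟩ := IsDiscreteValuationRing.exists_irreducible B
  -- The numerator of a uniformizer of `B` has a norm which is a nonzero nonunit of `A`.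
  obtain ⟨b, s, hs, hb⟩ := h.frac_right π
  refine h.exists_mem_maximalIdeal_ne_zero G (b := b) ?_ ?_
  · rw [← hb]
    exact fun hu => hπ.not_isUnit (isUnit_of_mul_isUnit_left hu)
  · rintro rfl
    rw [map_zero, hs.mul_left_eq_zero] at hb
    exact hπ.ne_zero hb

theorem exists_isGenerator_of_isFierce [IsLocalRing A] [IsDomain B] [IsDiscreteValuationRing B]
    [Algebra (ResidueField A) (ResidueField B)]
    (hres : ∀ a : A, algebraMap (ResidueField A) (ResidueField B) (residue A a) = residue B (i a))
    {x : B₀} (hx : IsFierce j G x) :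
    IsDiscreteValuationRing A ∧ (maximalIdeal A).map i = maximalIdeal B ∧
      IsPurelyInseparable (ResidueField A) (ResidueField B) ∧
      Module.finrank (ResidueField A) (ResidueField B) = p ∧
      ∃ z H, IsGenerator i z H (j x ^ (p - 1)) := by
  have hdvr := h.isDiscreteValuationRing_of_isFierce hx
  obtain ⟨z, hz⟩ := h.exists_not_sq_dvd hx hcard
  obtain ⟨H, hmon, hdeg, -, hHz, hHder⟩ := exists_charpoly A₀ G z
  have h1 : (H.map k).eval₂ i (j z) = 0 := by rw [h.eval₂_map, hHz, map_zero]
  have h2 : (H.map k).natDegree = Fintype.card G := by rw [hmon.natDegree_map, hdeg]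
  have h3 := h.eq_one_of_smul_eq_self hx hcard hz
  refine ⟨hdvr, h.map_maximalIdeal_eq_of_isFierce hres hx hcard hz,
    h.isPurelyInseparable_residueField hres hx hcard hz,
    h.finrank_residueField hres hx hcard hz, j z, H.map k, h1,
    h.dvd_of_eval₂_eq_zero h3 (hmon.map k) h2 h1,
    h.exists_eval₂_eq_of_isFierce hres hx hcard hz, ?_⟩
  rw [derivative_map, h.eval₂_map, hHder]
  exact h.associated_conjDifferent hx hcard hz

end IsLocalCover

/-- The extension of function fields of a cyclic quotient of prime degree is finite and
separable. -/
theorem IsLocalCover.finiteDimensional_and_isSeparable {A₀ B₀ K L : Type u} [CommRing A₀]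
    [CommRing B₀] [Field K] [Field L] [Algebra A₀ B₀] [Algebra K L] {k : A₀ →+* K} {j : B₀ →+* L}
    (h : IsLocalCover k j (algebraMap K L)) {G : Type} [Group G] [Fintype G]
    [MulSemiringAction G B₀] [SMulCommClass G A₀ B₀] [Algebra.IsInvariant A₀ B₀ G] [IsDomain B₀]
    {p : ℕ} [Fact p.Prime] (hcard : Nat.card G = p) :
    FiniteDimensional K L ∧ Algebra.IsSeparable K L := by
  -- `L` is a field, so units are the nonzero elements: either some element is moved and the
  -- unramified case provides a separable generator, or the action is trivial and K → L is
  -- surjective.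
  by_cases hmove : ∃ (g : G) (b : B₀), IsUnit (j (g • b - b))
  · obtain ⟨-, -, z, H, hH⟩ := h.exists_isGenerator_of_isUnit hcard hmove
    have hroot : aeval z H = 0 := hH.root
    have hne : H ≠ 0 := by
      rintro rfl
      have := hH.associated
      rw [derivative_zero, eval₂_zero] at this
      exact one_ne_zero ((associated_zero_iff_eq_zero _).1 this.symm)
    have hint : IsIntegral K z := (isAlgebraic_iff_isIntegral.1 ⟨H, hne, hroot⟩)
    have hsep : IsSeparable K z := by
      rw [IsSeparable, Polynomial.separable_iff_derivative_ne_zero (minpoly.irreducible hint)]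
      intro hder
      obtain ⟨Q, hQ⟩ := minpoly.dvd K z hroot
      have h1 : H.derivative.eval₂ (algebraMap K L) z = 0 := by
        change aeval z H.derivative = 0
        rw [hQ, derivative_mul, hder, zero_mul, zero_add, map_mul, minpoly.aeval, zero_mul]
      have := hH.associated
      rw [h1] at this
      exact one_ne_zero ((associated_zero_iff_eq_zero _).1 this.symm)
    have htop : IntermediateField.adjoin K {z} = ⊤ := by
      rw [eq_top_iff]
      intro b _
      obtain ⟨P, Q, hQ, hb⟩ := hH.gen b
      have haev : ∀ F : K[X], F.eval₂ (algebraMap K L) z ∈ IntermediateField.adjoin K {z} :=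
        fun F => IntermediateField.algebra_adjoin_le_adjoin _ _ (aeval_mem_adjoin_singleton K _)
      rw [eq_div_of_mul_eq hQ.ne_zero hb]
      exact div_mem (haev P) (haev Q)
    have hfin : FiniteDimensional K (IntermediateField.adjoin K {z}) :=
      IntermediateField.adjoin.finiteDimensional hint
    have hs : Algebra.IsSeparable K (IntermediateField.adjoin K {z}) :=
      (IntermediateField.isSeparable_adjoin_simple_iff_isSeparable K L).2 hsep
    rw [htop] at hfin hs
    exact ⟨Module.Finite.equiv IntermediateField.topEquiv.toLinearEquiv,
      Algebra.IsSeparable.of_algHom K _ (IntermediateField.topEquiv (F := K) (E := L)).symm.toAlgHom⟩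
  · push Not at hmove
    have hfix : ∀ (g : G) (b : B₀), g • b = b := by
      intro g b
      have := hmove g b
      rw [isUnit_iff_ne_zero, not_not, map_eq_zero_iff j h.injective, sub_eq_zero] at this
      exact this
    have hsurj : Function.Surjective (algebraMap K L) := by
      intro y
      obtain ⟨b, s, hs, hb⟩ := h.frac_right y
      obtain ⟨a, rfl⟩ := Algebra.IsInvariant.isInvariant (A := A₀) (G := G) b fun g => hfix g b
      obtain ⟨c, rfl⟩ := Algebra.IsInvariant.isInvariant (A := A₀) (G := G) s fun g => hfix g s
      refine ⟨k a / k c, ?_⟩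
      rw [map_div₀, h.comp, h.comp, div_eq_iff hs.ne_zero, hb]
    refine ⟨Module.Finite.of_surjective (Algebra.linearMap K L) hsurj, ⟨fun y => ?_⟩⟩
    obtain ⟨a, rfl⟩ := hsurj y
    exact isSeparable_algebraMap a

end QuotientRamification

/-! ### The group action on sections and the topology of the quotient -/

namespace QuotientRamification

open AlgebraicGeometry CategoryTheory

lemma appLE_congr_hom {U X : Scheme.{u}} {φ ψ : U ⟶ X} (h : φ = ψ) {V : X.Opens} {W : U.Opens}
    (e : W ≤ φ ⁻¹ᵁ V) (e' : W ≤ ψ ⁻¹ᵁ V) : φ.appLE V W e = ψ.appLE V W e' := by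
  subst h
  rfl

/-- The inverse of the automorphism by which the group element `g` acts. -/
noncomputable def actInv {G : Type} [Group G] {U : Scheme.{u}} (ρ : G →* Aut U) (g : G) : U ⟶ U :=
  Iso.inv (X := U) (Y := U) (ρ g)

section

variable {G : Type} [Group G] {U : Scheme.{u}} (ρ : G →* Aut U)

lemma actInv_one : actInv ρ 1 = 𝟙 U := by
  rw [actInv, map_one]
  rfl

/-- The product in `Aut U` is composition of maps, so inverses compose in diagrammatic order and
pullback along them is a left action. -/
lemma actInv_mul (g g' : G) : actInv ρ (g * g') = actInv ρ g ≫ actInv ρ g' := by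
  rw [actInv, map_mul]
  rfl

lemma actInv_inv (g : G) : actInv ρ g⁻¹ = (ρ g).hom := by
  rw [actInv, map_inv]
  rfl

lemma actInv_eq (g : G) : actInv ρ g = (ρ g⁻¹).hom := by
  rw [← actInv_inv, inv_inv]

end

namespace IsQuotient

variable {G : Type} [Group G] {U X : Scheme.{u}} {ρ : G →* Aut U} {f : U ⟶ X}
  (hf : IsQuotient ρ f)
include hf

lemma actInv_comp (g : G) : actInv ρ g ≫ f = f := by
  rw [actInv_eq, hf.invariant]

lemma preimage_le (g : G) (V : X.Opens) : f ⁻¹ᵁ V ≤ actInv ρ g ⁻¹ᵁ (f ⁻¹ᵁ V) := by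
  rw [← Scheme.Hom.comp_preimage, hf.actInv_comp]

/-- The action of the group on the sections of `O_U` over the inverse image of an open subset
of the quotient. -/
@[reducible]
noncomputable def sectionAction (V : X.Opens) : MulSemiringAction G Γ(U, f ⁻¹ᵁ V) where
  smul g b := (actInv ρ g).appLE _ _ (hf.preimage_le g V) b
  one_smul b := by
    change (actInv ρ 1).appLE _ _ _ b = b
    rw [appLE_congr_hom (actInv_one ρ) _ (W := f ⁻¹ᵁ V) (V := f ⁻¹ᵁ V) le_rfl]
    have h : (𝟙 U : U ⟶ U).appLE (f ⁻¹ᵁ V) (f ⁻¹ᵁ V) le_rfl = 𝟙 _ :=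
      (Scheme.Hom.appLE_eq_app (𝟙 U)).trans (Scheme.Hom.id_app _)
    rw [h, CommRingCat.id_apply]
  mul_smul g g' b := by
    change (actInv ρ (g * g')).appLE _ _ _ b =
      (actInv ρ g).appLE _ _ _ ((actInv ρ g').appLE _ _ _ b)
    simp only [actInv_mul]
    rw [← CommRingCat.comp_apply, Scheme.Hom.appLE_comp_appLE]
  smul_zero g := map_zero _
  smul_add g := map_add _
  smul_one g := map_one _
  smul_mul g := map_mul _

lemma smul_def (V : X.Opens) (g : G) (b : Γ(U, f ⁻¹ᵁ V)) :
    letI := hf.sectionAction V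
    g • b = (actInv ρ g).appLE _ _ (hf.preimage_le g V) b := rfl

lemma smul_app (V : X.Opens) (g : G) (a : Γ(X, V)) :
    letI := hf.sectionAction V
    g • f.app V a = f.app V a := by
  have h : f ⁻¹ᵁ V ≤ (actInv ρ g ≫ f) ⁻¹ᵁ V := by rw [hf.actInv_comp]
  have h1 := congr($(Scheme.Hom.comp_appLE (actInv ρ g) f V _ h) a)
  rw [appLE_congr_hom (hf.actInv_comp g) h le_rfl, Scheme.Hom.appLE_eq_app] at h1
  exact h1.symm

lemma smulCommClass (V : X.Opens) :
    letI := hf.sectionAction V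
    letI := (f.app V).hom.toAlgebra
    SMulCommClass G Γ(X, V) Γ(U, f ⁻¹ᵁ V) := by
  let := hf.sectionAction V
  let := (f.app V).hom.toAlgebra
  refine ⟨fun g a b => ?_⟩
  rw [Algebra.smul_def, Algebra.smul_def, smul_mul']
  congr 1
  exact hf.smul_app V g a

lemma appLE_hom_eq (V : X.Opens) (g : G) (b : Γ(U, f ⁻¹ᵁ V))
    (h : f ⁻¹ᵁ V ≤ (ρ g).hom ⁻¹ᵁ (f ⁻¹ᵁ V)) :
    letI := hf.sectionAction V
    (ρ g).hom.appLE _ _ h b = g⁻¹ • b := by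
  rw [hf.smul_def]
  simp only [actInv_inv]

lemma app_injective (V : X.Opens) : Function.Injective (f.app V) := by
  let := hf.sectionAction V
  intro a a' haa
  refine (hf.existsUnique_section V (f.app V a) fun g h => ?_).unique rfl haa.symm
  rw [hf.appLE_hom_eq, hf.smul_app]

lemma isInvariant (V : X.Opens) :
    letI := hf.sectionAction V
    letI := (f.app V).hom.toAlgebra
    Algebra.IsInvariant Γ(X, V) Γ(U, f ⁻¹ᵁ V) G := by
  let := hf.sectionAction V
  let := (f.app V).hom.toAlgebra
  refine ⟨fun b hb => ?_⟩
  obtain ⟨a, ha, -⟩ := hf.existsUnique_section V b fun g h => by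
    rw [hf.appLE_hom_eq, hb]
  exact ⟨a, ha⟩

lemma app_isIntegral [Finite G] (V : X.Opens) : (f.app V).hom.IsIntegral := by
  let := hf.sectionAction V
  let := (f.app V).hom.toAlgebra
  have := hf.smulCommClass V
  have := hf.isInvariant V
  have := Algebra.IsInvariant.isIntegral Γ(X, V) Γ(U, f ⁻¹ᵁ V) G
  exact this.isIntegral

lemma isIntegralHom [Finite G] : IsIntegralHom f := by
  have := hf.isAffineHom
  exact ⟨fun V _ => hf.app_isIntegral V⟩

lemma isAffineOpen_preimage {V : X.Opens} (hV : IsAffineOpen V) : IsAffineOpen (f ⁻¹ᵁ V) :=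
  have := hf.isAffineHom
  hV.preimage f

/-- `f` is integral, hence closed. Over the complement `V` of its image the sections of O_U are
zero, and those of O_X inject into them, so `V` is empty. -/
lemma surjective [Finite G] : Function.Surjective f := by
  have := hf.isIntegralHom
  let V : X.Opens := ⟨(Set.range f)ᶜ, f.isClosedMap.isClosed_range.isOpen_compl⟩
  have hV : f ⁻¹ᵁ V = ⊥ := by
    ext y
    exact ⟨fun hy => hy ⟨y, rfl⟩, fun hy => hy.elim⟩
  have h1 : (1 : Γ(X, V)) = 0 := by
    refine hf.app_injective V ?_
    have : Subsingleton Γ(U, f ⁻¹ᵁ V) := by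
      rw [hV]
      infer_instance
    exact Subsingleton.elim _ _
  have h2 : V = ⊥ := by
    rw [← X.basicOpen_of_isUnit (isUnit_one (M := Γ(X, V))), h1, Scheme.basicOpen_zero]
  intro x
  by_contra hx
  have : x ∈ V := hx
  rw [h2] at this
  exact this

lemma isIntegral [Finite G] [IsIntegral U] : IsIntegral X := by
  have hne : Nonempty X := ⟨f (Classical.arbitrary U)⟩
  refine ⟨hne, fun V hV => ?_⟩
  have : Nonempty (f ⁻¹ᵁ V) := by
    obtain ⟨x, hx⟩ := hV
    obtain ⟨y, rfl⟩ := hf.surjective x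
    exact ⟨⟨y, hx⟩⟩
  exact (hf.app_injective V).isDomain (f.app V).hom

end IsQuotient

end QuotientRamification

/-! ### Finiteness of the quotient over the base -/

namespace QuotientRamification

open AlgebraicGeometry CategoryTheory

/-- The Artin–Tate lemma, for ring homomorphisms. -/
lemma finiteType_of_comp_of_isIntegral {R A B : Type u} [CommRing R] [CommRing A] [CommRing B]
    [IsNoetherianRing R] (φ : R →+* A) (i : A →+* B) (h : (i.comp φ).FiniteType)
    (hi : i.IsIntegral) (hinj : Function.Injective i) : φ.FiniteType := by
  algebraize [φ, i, i.comp φ]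
  have hfin : i.Finite := hi.to_finite (RingHom.FiniteType.of_comp_finiteType h)
  exact ⟨fg_of_fg_of_fg R A B h.1 hfin.1 hinj⟩

namespace IsQuotient

variable {G : Type} [Group G] [Finite G] {U X S : Scheme.{u}} {ρ : G →* Aut U} {f : U ⟶ X}
  (hf : IsQuotient ρ f)
include hf

theorem locallyOfFiniteType [IsLocallyNoetherian S] (π : X ⟶ S) [LocallyOfFiniteType (f ≫ π)] :
    LocallyOfFiniteType π := by
  refine ⟨fun {W} hW {V} hV e => ?_⟩
  have : IsNoetherianRing Γ(S, W) := IsLocallyNoetherian.component_noetherian ⟨W, hW⟩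
  have hV' := hf.isAffineOpen_preimage hV
  have h := (f ≫ π).finiteType_appLE hW hV' (fun y hy => e hy)
  refine finiteType_of_comp_of_isIntegral _ (f.app V).hom ?_ (hf.app_isIntegral V)
    (hf.app_injective V)
  rw [← CommRingCat.hom_comp, Scheme.Hom.app_eq_appLE, Scheme.Hom.appLE_comp_appLE]
  exact h

end IsQuotient

end QuotientRamification

/-! ### Stalks and codimension under the quotient morphism -/

namespace QuotientRamification

open AlgebraicGeometry CategoryTheory

lemma exists_mul_germ_eq {X : Scheme.{u}} {V : X.Opens} (hV : IsAffineOpen V) (x : X) (hx : x ∈ V)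
    (s : X.presheaf.stalk x) :
    ∃ a t : Γ(X, V), IsUnit ((X.presheaf.germ V x hx).hom t) ∧
      s * (X.presheaf.germ V x hx).hom t = (X.presheaf.germ V x hx).hom a := by
  let := X.presheaf.algebra_section_stalk ⟨x, hx⟩
  have := hV.isLocalization_stalk ⟨x, hx⟩
  obtain ⟨⟨a, t⟩, h⟩ :=
    IsLocalization.surj (hV.primeIdealOf ⟨x, hx⟩).asIdeal.primeCompl s
  exact ⟨a, t, IsLocalization.map_units (X.presheaf.stalk x) t, h⟩

namespace IsQuotient

variable {G : Type} [Group G] {U X : Scheme.{u}} {ρ : G →* Aut U} {f : U ⟶ X}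
  (hf : IsQuotient ρ f)
include hf

lemma isLocalCover [IsIntegral U] {V : X.Opens} (hV : IsAffineOpen V) (y : U) (hy : f y ∈ V) :
    letI := (f.app V).hom.toAlgebra
    IsLocalCover (X.presheaf.germ V (f y) hy).hom (U.presheaf.germ (f ⁻¹ᵁ V) y hy).hom
      (f.stalkMap y).hom := by
  let := (f.app V).hom.toAlgebra
  exact
    { comp := fun a => Scheme.Hom.germ_stalkMap_apply f V y hy a
      injective := germ_injective_of_isIntegral U y hy
      injective_algebraMap := hf.app_injective V
      frac_left := exists_mul_germ_eq hV _ hy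
      frac_right := exists_mul_germ_eq (hf.isAffineOpen_preimage hV) _ hy
      isLocalHom := inferInstance }

lemma map_genericPoint [Finite G] [IsIntegral U] [IsIntegral X] :
    f (genericPoint U) = genericPoint X := by
  refine ((genericPoint_spec U).image f.continuous).eq ?_
  rw [Set.image_univ, hf.surjective.range_eq, closure_univ]
  exact genericPoint_spec X

/-- This is incomparability for integral extensions. In the specialization order the generic point
is the largest element, so `Order.coheight` is the codimension, and strict monotonicity bounds the
codimension of `y` by that of `f y`. -/
lemma strictMono [Finite G] : StrictMono f := by
  intro y y' hlt
  have hsp : y' ⤳ y := hlt.le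
  refine lt_of_le_not_ge (hsp.map f.continuous) fun hge => hlt.ne ?_
  have heq : f y' = f y := ((hsp.map f.continuous).antisymm hge).eq
  obtain ⟨V, hV, hyV, -⟩ := exists_isAffineOpen_mem_and_subset (U := ⊤) (x := f y) trivial
  have hW := hf.isAffineOpen_preimage hV
  have hy' : y' ∈ f ⁻¹ᵁ V := by
    rw [Scheme.Hom.mem_preimage, heq]
    exact hyV
  have hy : y ∈ f ⁻¹ᵁ V := hyV
  let := (f.app V).hom.toAlgebra
  have : Algebra.IsIntegral Γ(X, V) Γ(U, f ⁻¹ᵁ V) := ⟨hf.app_isIntegral V⟩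
  let q := hW.primeIdealOf ⟨y, hy⟩
  let q' := hW.primeIdealOf ⟨y', hy'⟩
  have hle : q'.asIdeal ≤ q.asIdeal := by
    intro b hb
    simp only [q, q', IsAffineOpen.primeIdealOf_eq_map_closedPoint] at hb ⊢
    change ¬ IsUnit ((U.presheaf.germ (f ⁻¹ᵁ V) y' hy').hom b) at hb
    change ¬ IsUnit ((U.presheaf.germ (f ⁻¹ᵁ V) y hy).hom b)
    refine fun hu => hb ?_
    have := hu.map (U.presheaf.stalkSpecializes hsp).hom
    rwa [← CommRingCat.comp_apply, TopCat.Presheaf.germ_stalkSpecializes] at this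
  have hcomap : ∀ z (hz : z ∈ f ⁻¹ᵁ V), (hW.primeIdealOf ⟨z, hz⟩).comap (f.app V).hom =
      hV.primeIdealOf ⟨f z, hz⟩ := by
    intro z hz
    have := IsAffineOpen.comap_primeIdealOf_appLE V hV (f ⁻¹ᵁ V) hW le_rfl hz
    rwa [Scheme.Hom.appLE_eq_app] at this
  have hq : q' = q := by
    by_contra hne
    have hlt' : q'.asIdeal < q.asIdeal := lt_of_le_of_ne hle fun h => hne (PrimeSpectrum.ext h)
    have h1 := Ideal.IsIntegral.comap_lt_comap (R := Γ(X, V)) hlt'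
    have h2 : q'.comap (f.app V).hom = q.comap (f.app V).hom := by
      refine (hcomap y' hy').trans (.trans ?_ (hcomap y hy).symm)
      congr 1
      exact Subtype.ext heq
    exact h1.ne congr(PrimeSpectrum.asIdeal $h2)
  have h3 := congrArg hW.fromSpec hq
  rw [hW.fromSpec_primeIdealOf, hW.fromSpec_primeIdealOf] at h3
  exact h3.symm

lemma coheight_eq_one [Finite G] [IsIntegral U] [IsIntegral X] {y : U}
    (hy : Order.coheight (f y) = 1) : Order.coheight y = 1 := by
  refine le_antisymm
    ((Order.coheight_le_coheight_apply_of_strictMono f hf.strictMono y).trans hy.le) ?_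
  rw [Order.one_le_iff_ne_zero, Order.coheight_ne_zero]
  intro hmax
  have h1 : y = genericPoint U :=
    (Specializes.antisymm (hmax (le_top (a := y))) (genericPoint_specializes y)).eq
  rw [h1, hf.map_genericPoint] at hy
  have h2 : Order.coheight (genericPoint X) = 0 := Order.coheight_eq_zero.2 isMax_top
  rw [h2] at hy
  exact zero_ne_one hy

end IsQuotient

end QuotientRamification

/-! ### From the fixed point scheme to the action on local rings -/

namespace QuotientRamification

open AlgebraicGeometry CategoryTheory IsLocalRing

lemma isDiscreteValuationRing_of_isRegularLocalRing {R : Type u} [CommRing R]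
    [IsRegularLocalRing R] [IsDomain R] (h : ringKrullDim R = 1) : IsDiscreteValuationRing R := by
  have h1 := (IsRegularLocalRing.iff_finrank_cotangentSpace R).1 inferInstance
  rw [h] at h1
  exact finrank_CotangentSpace_eq_one_iff.1 (by exact_mod_cast h1)

lemma isDiscreteValuationRing_stalk {U : Scheme.{u}} [IsIntegral U] [IsRegularScheme U] {y : U}
    (hy : Order.coheight y = 1) : IsDiscreteValuationRing (U.presheaf.stalk y) := by
  have := IsRegularScheme.isRegularLocalRing_stalk y
  refine isDiscreteValuationRing_of_isRegularLocalRing ?_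
  rw [ringKrullDim_stalk_eq_coheight, hy]
  rfl

lemma appTop_comp_fromSpecStalk_eq_zero_iff {U : Scheme.{u}} (y : U) {C : CommRingCat.{u}}
    (c : U.presheaf.stalk y ⟶ C) (x : Γ(U, ⊤)) :
    (Spec.map c ≫ U.fromSpecStalk y).appTop x = 0 ↔ c (U.presheaf.germ ⊤ y trivial x) = 0 := by
  have h1 : (U.fromSpecStalk y).appTop =
      U.presheaf.germ ⊤ y trivial ≫ (Scheme.ΓSpecIso (U.presheaf.stalk y)).inv := by
    refine Scheme.fromSpecStalk_appTop.trans ?_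
    congr 1
  have h2 : (Spec.map c ≫ U.fromSpecStalk y).appTop =
      (U.presheaf.germ ⊤ y trivial ≫ c) ≫ (Scheme.ΓSpecIso C).inv := by
    rw [Scheme.Hom.comp_appTop, h1, Category.assoc, Category.assoc,
      Scheme.ΓSpecIso_inv_naturality]
  rw [h2]
  exact map_eq_zero_iff (Scheme.ΓSpecIso C).inv.hom
    (Scheme.ΓSpecIso C).symm.commRingCatIsoToRingEquiv.injective

namespace IsQuotient

variable {G : Type} [Group G] {U X : Scheme.{u}} {ρ : G →* Aut U} {f : U ⟶ X}
  (hf : IsQuotient ρ f)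
include hf

lemma comp_actInv_eq_iff {V : X.Opens} (hV : IsAffineOpen V) (y : U) (hy : y ∈ f ⁻¹ᵁ V)
    {C : CommRingCat.{u}} (c : U.presheaf.stalk y ⟶ C) (g : G) :
    letI := hf.sectionAction V
    (Spec.map c ≫ U.fromSpecStalk y) ≫ actInv ρ g = Spec.map c ≫ U.fromSpecStalk y ↔
      ∀ b : Γ(U, f ⁻¹ᵁ V), c (U.presheaf.germ _ y hy (g • b)) = c (U.presheaf.germ _ y hy b) := by
  have hW := hf.isAffineOpen_preimage hV
  rw [← hW.fromSpecStalk_eq_fromSpecStalk hy, IsAffineOpen.fromSpecStalk, ← Spec.map_comp_assoc,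
    Category.assoc, ← hW.SpecMap_appLE_fromSpec _ hW (hf.preimage_le g V), ← Spec.map_comp_assoc,
    cancel_mono, Spec.map_inj]
  constructor
  · intro h b
    exact congr($h b)
  · intro h
    ext b
    exact h b

/-- The functorial description of the fixed scheme is tested on Spec(O_{U,y}/I). The case I = 𝔪
decides whether the action on residue classes is trivial, and I = (x²) shows that the action is not
trivial to second order. -/
lemma forall_germ_smul_sub_mem_iff {V : X.Opens} (hV : IsAffineOpen V) (y : U)
    (hy : y ∈ f ⁻¹ᵁ V) {x : Γ(U, ⊤)} {O : U.Opens} (hO : FixedSchemeEqZeroScheme ρ x O)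
    (hyO : y ∈ O) (I : Ideal (U.presheaf.stalk y)) :
    letI := hf.sectionAction V
    (∀ (g : G) (b : Γ(U, f ⁻¹ᵁ V)), (U.presheaf.germ _ y hy).hom (g • b - b) ∈ I) ↔
      (U.presheaf.germ ⊤ y trivial).hom x ∈ I := by
  let := hf.sectionAction V
  let c : U.presheaf.stalk y ⟶ CommRingCat.of (U.presheaf.stalk y ⧸ I) :=
    CommRingCat.ofHom (Ideal.Quotient.mk I)
  -- The image consists of generizations of `y`, which lie in every open set containing `y`.
  have hrange : Set.range (Spec.map c ≫ U.fromSpecStalk y) ⊆ (O : Set U) := by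
    rintro _ ⟨z, rfl⟩
    have h1 : U.fromSpecStalk y (Spec.map c z) ∈ Set.range (U.fromSpecStalk y) := ⟨_, rfl⟩
    rw [Scheme.range_fromSpecStalk] at h1
    exact Specializes.mem_open h1 O.isOpen hyO
  have h1 := hO _ (Spec.map c ≫ U.fromSpecStalk y) hrange
  rw [appTop_comp_fromSpecStalk_eq_zero_iff] at h1
  refine Iff.trans ?_ (h1.trans Ideal.Quotient.eq_zero_iff_mem)
  have h2 : (∀ g : G, (Spec.map c ≫ U.fromSpecStalk y) ≫ (ρ g).hom =
      Spec.map c ≫ U.fromSpecStalk y) ↔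
      ∀ g : G, (Spec.map c ≫ U.fromSpecStalk y) ≫ actInv ρ g =
        Spec.map c ≫ U.fromSpecStalk y := by
    refine ⟨fun h g => ?_, fun h g => ?_⟩
    · rw [actInv_eq, h]
    · rw [← actInv_inv, h]
  rw [h2]
  refine forall_congr' fun g => ?_
  rw [hf.comp_actInv_eq_iff hV y hy c g]
  refine forall_congr' fun b => ?_
  rw [map_sub, ← Ideal.Quotient.eq]
  rfl

lemma smul_map (V : X.Opens) (g : G) (x : Γ(U, ⊤)) :
    letI := hf.sectionAction V
    g • U.presheaf.map (homOfLE le_top).op x =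
      U.presheaf.map (homOfLE (le_top : f ⁻¹ᵁ V ≤ ⊤)).op ((actInv ρ g).appTop x) := by
  rw [hf.smul_def, ← CommRingCat.comp_apply, ← CommRingCat.comp_apply, Scheme.Hom.map_appLE]
  rfl

variable [IsIntegral U]

-- The quotient of the local ring by `x` is regular, hence a domain.
omit hf in
lemma prime_germ {x : Γ(U, ⊤)} (hx0 : x ≠ 0) (hx : ZeroSchemeIsRegular x) {y : U}
    (hy : y ∈ U.zeroLocus {x}) : Prime ((U.presheaf.germ ⊤ y trivial).hom x) := by
  have := hx y hy
  have := isDomain_of_isRegularLocalRing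
    (R := U.presheaf.stalk y ⧸ Ideal.span {(U.presheaf.germ ⊤ y trivial).hom x})
  rw [← Ideal.span_singleton_prime, ← Ideal.Quotient.isDomain_iff_prime]
  · exact this
  · exact (map_ne_zero_iff _ (germ_injective_of_isIntegral U (U := ⊤) y trivial)).2 hx0

omit hf in
lemma mem_zeroLocus_singleton_iff {U : Scheme.{u}} (x : Γ(U, ⊤)) (y : U) :
    y ∈ U.zeroLocus {x} ↔ ¬ IsUnit ((U.presheaf.germ ⊤ y trivial).hom x) := by
  rw [Scheme.mem_zeroLocus_iff]
  simp only [Set.mem_singleton_iff, forall_eq]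
  exact not_congr (Scheme.mem_basicOpen_top U x y)

lemma isFierce {V : X.Opens} (hV : IsAffineOpen V) (y : U) (hy : y ∈ f ⁻¹ᵁ V)
    {x : Γ(U, ⊤)} (hx0 : x ≠ 0) (hx : ZeroSchemeIsRegular x) {O : U.Opens}
    (hO : FixedSchemeEqZeroScheme ρ x O) (hyO : y ∈ O)
    (hI : ∀ g : G, ∃ v, (actInv ρ g).appTop x = x * (1 + x * v)) (hyx : y ∈ U.zeroLocus {x}) :
    letI := hf.sectionAction V
    IsLocalCover.IsFierce (U.presheaf.germ _ y hy).hom G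
      (U.presheaf.map (homOfLE (le_top : f ⁻¹ᵁ V ≤ ⊤)).op x) := by
  let := hf.sectionAction V
  have hres : (U.presheaf.germ _ y hy).hom (U.presheaf.map (homOfLE le_top).op x) =
      (U.presheaf.germ ⊤ y trivial).hom x := U.presheaf.germ_res_apply _ _ _ _
  have hirr := (prime_germ hx0 hx hyx).irreducible
  refine ⟨?_, ?_, ?_, ?_⟩
  · rw [hres]
    exact hirr
  · exact (hf.forall_germ_smul_sub_mem_iff hV y hy hO hyO (maximalIdeal _)).2
      ((mem_zeroLocus_singleton_iff x y).1 hyx)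
  · intro g
    obtain ⟨v, hv⟩ := hI g
    refine ⟨U.presheaf.map (homOfLE le_top).op v, ?_⟩
    rw [hf.smul_map, hv, map_mul, map_add, map_one, map_mul]
  -- If the action were trivial modulo x², then x would lie in (x²).
  · by_contra! hcon
    have h1 := (hf.forall_germ_smul_sub_mem_iff hV y hy hO hyO
      (Ideal.span {(U.presheaf.germ ⊤ y trivial).hom x ^ 2})).1 fun g b => by
        rw [Ideal.mem_span_singleton, ← hres]
        exact hcon g b
    rw [Ideal.mem_span_singleton, pow_two] at h1
    exact hirr.not_isUnit (isUnit_of_mul_isUnit_left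
      (isUnit_of_dvd_one ((mul_dvd_mul_iff_left hirr.ne_zero).1 (by rwa [mul_one]))))

end IsQuotient

end QuotientRamification

/-! ### The quotient morphism at points of codimension one -/

namespace QuotientRamification

open AlgebraicGeometry CategoryTheory IsLocalRing

lemma ramificationIndex_eq_one {U X : Scheme.{u}} {f : U ⟶ X} {y : U}
    (h : (maximalIdeal (X.presheaf.stalk (f y))).map (f.stalkMap y).hom =
      maximalIdeal (U.presheaf.stalk y)) : ramificationIndex f y = 1 := by
  have h1 : IsSimpleModule (U.presheaf.stalk y)
      (U.presheaf.stalk y ⧸ maximalIdeal (U.presheaf.stalk y)) :=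
    isSimpleModule_iff_isCoatom.2 (maximalIdeal.isMaximal _).out
  rw [ramificationIndex, h, Module.length_eq_one_iff.2 h1]
  rfl

namespace IsQuotient

variable {G : Type} [Group G] [Fintype G] {U X : Scheme.{u}} {ρ : G →* Aut U} {f : U ⟶ X}
  (hf : IsQuotient ρ f) [IsIntegral U] [IsIntegral X] [IsRegularScheme U] {p : ℕ} [Fact p.Prime]
  (hcard : Nat.card G = p) {x : Γ(U, ⊤)} (hx0 : x ≠ 0) (hx : ZeroSchemeIsRegular x) {O : U.Opens}
  (hO : FixedSchemeEqZeroScheme ρ x O) (hI : ∀ g : G, ∃ v, (actInv ρ g).appTop x = x * (1 + x * v))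
  {y : U} (hy : Order.coheight y = 1) (hyO : y ∈ O)
include hf hcard hx0 hx hO hI hy hyO

/-- Off `E₁` the germ of `x` is a unit, so the single expression x^(p-1) for the different covers
both the unramified and the fierce case. -/
theorem exists_isGenerator : IsDiscreteValuationRing (X.presheaf.stalk (f y)) ∧
    (maximalIdeal (X.presheaf.stalk (f y))).map (f.stalkMap y).hom =
      maximalIdeal (U.presheaf.stalk y) ∧
    ∃ z H, IsGenerator (f.stalkMap y).hom z H
      ((U.presheaf.germ ⊤ y trivial).hom x ^ (p - 1)) := by
  obtain ⟨V, hV, hyV, -⟩ := exists_isAffineOpen_mem_and_subset (U := ⊤) (x := f y) trivial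
  let := hf.sectionAction V
  let := (f.app V).hom.toAlgebra
  have := hf.smulCommClass V
  have := hf.isInvariant V
  have : Nonempty (f ⁻¹ᵁ V) := ⟨⟨y, hyV⟩⟩
  have h := hf.isLocalCover hV y hyV
  have := isDiscreteValuationRing_stalk hy
  by_cases hyx : y ∈ U.zeroLocus {x}
  · let := (ResidueField.map (f.stalkMap y).hom).toAlgebra
    have hx' := hf.isFierce hV y hyV hx0 hx hO hyO hI hyx
    obtain ⟨h1, h2, -, -, h3⟩ := h.exists_isGenerator_of_isFierce hcard (fun a => rfl) hx'
    refine ⟨h1, h2, ?_⟩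
    rwa [show (U.presheaf.germ (f ⁻¹ᵁ V) y hyV).hom (U.presheaf.map (homOfLE le_top).op x) =
      (U.presheaf.germ ⊤ y trivial).hom x from U.presheaf.germ_res_apply _ _ _ _] at h3
  · rw [mem_zeroLocus_singleton_iff, not_not] at hyx
    have hmove : ∃ (g : G) (b : Γ(U, f ⁻¹ᵁ V)),
        IsUnit ((U.presheaf.germ (f ⁻¹ᵁ V) y hyV).hom (g • b - b)) := by
      by_contra! hcon
      exact (hf.forall_germ_smul_sub_mem_iff hV y hyV hO hyO (maximalIdeal _)).1 hcon hyx
    obtain ⟨h1, h2, z, H, h3⟩ := h.exists_isGenerator_of_unramified hcard hmove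
    exact ⟨h1, h2, z, H, h3.root, h3.dvd, h3.gen,
      h3.associated.trans (associated_one_iff_isUnit.2 (hyx.pow _)).symm⟩

theorem isFiercelyRamifiedAt (hyx : y ∈ U.zeroLocus {x}) : IsFiercelyRamifiedAt p f y := by
  obtain ⟨V, hV, hyV, -⟩ := exists_isAffineOpen_mem_and_subset (U := ⊤) (x := f y) trivial
  let := hf.sectionAction V
  let := (f.app V).hom.toAlgebra
  have := hf.smulCommClass V
  have := hf.isInvariant V
  have : Nonempty (f ⁻¹ᵁ V) := ⟨⟨y, hyV⟩⟩
  have h := hf.isLocalCover hV y hyV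
  have := isDiscreteValuationRing_stalk hy
  let : Algebra (ResidueField (X.presheaf.stalk (f y))) (ResidueField (U.presheaf.stalk y)) :=
    (f.residueFieldMap y).hom.toAlgebra
  have hx' := hf.isFierce hV y hyV hx0 hx hO hyO hI hyx
  obtain ⟨-, h2, h3, h4, -⟩ := h.exists_isGenerator_of_isFierce hcard (fun a => rfl) hx'
  exact ⟨ramificationIndex_eq_one h2, h3, h4⟩

end IsQuotient

end QuotientRamification

/-! ### Orders of vanishing and their pullback -/

namespace QuotientRamification

open AlgebraicGeometry CategoryTheory IsLocalRing

section Ord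

variable {X : Scheme.{u}} [IsIntegral X] [IsLocallyNoetherian X] {x : X}

omit [IsLocallyNoetherian X] in
lemma algebraMap_stalk_ne_zero {a : X.presheaf.stalk x} (ha : a ≠ 0) :
    algebraMap (X.presheaf.stalk x) X.functionField a ≠ 0 :=
  (map_ne_zero_iff _ (IsFractionRing.injective _ _)).2 ha

lemma ord_algebraMap_of_isUnit {a : X.presheaf.stalk x} (ha : IsUnit a) :
    X.ord (algebraMap (X.presheaf.stalk x) X.functionField a) x = 0 := by
  by_cases hx : Order.coheight x = 1
  · have : Ring.KrullDimLE 1 (X.presheaf.stalk x) := krullDimLE_of_coheight_le hx.le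
    rw [Scheme.ord_eq_iff hx (algebraMap_stalk_ne_zero ha.ne_zero)]
    exact Ring.ordFrac_of_isUnit ha
  · exact Scheme.ord_eq_zero_of_coheight_neq_one hx _

lemma ord_algebraMap_of_irreducible (hx : Order.coheight x = 1)
    [IsDiscreteValuationRing (X.presheaf.stalk x)] {a : X.presheaf.stalk x} (ha : Irreducible a) :
    X.ord (algebraMap (X.presheaf.stalk x) X.functionField a) x = 1 := by
  rw [Scheme.ord_eq_iff hx (algebraMap_stalk_ne_zero ha.ne_zero)]
  exact Ring.ordFrac_irreducible ha

lemma ord_algebraMap_of_associated {a b : X.presheaf.stalk x} (hb : b ≠ 0)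
    (hab : Associated a b) :
    X.ord (algebraMap (X.presheaf.stalk x) X.functionField a) x =
      X.ord (algebraMap (X.presheaf.stalk x) X.functionField b) x := by
  obtain ⟨c, rfl⟩ := hab
  rw [map_mul, Scheme.ord_mul (algebraMap_stalk_ne_zero (left_ne_zero_of_mul hb))
    (algebraMap_stalk_ne_zero c.ne_zero), ord_algebraMap_of_isUnit c.isUnit, add_zero]

lemma ord_pow {a : X.functionField} (ha : a ≠ 0) (n : ℕ) : X.ord (a ^ n) x = n * X.ord a x := by
  induction n with
  | zero =>
    have := ord_algebraMap_of_isUnit (x := x) isUnit_one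
    rw [map_one] at this
    simpa using this
  | succ n ih =>
    rw [pow_succ, Scheme.ord_mul (pow_ne_zero _ ha) ha, ih]
    push_cast
    ring

lemma ord_algebraMap_of_associated_pow (hx : Order.coheight x = 1)
    [IsDiscreteValuationRing (X.presheaf.stalk x)] {a ϖ : X.presheaf.stalk x} (hϖ : Irreducible ϖ)
    {n : ℕ} (ha : Associated a (ϖ ^ n)) :
    X.ord (algebraMap (X.presheaf.stalk x) X.functionField a) x = n := by
  rw [ord_algebraMap_of_associated (pow_ne_zero _ hϖ.ne_zero) ha, map_pow,
    ord_pow (algebraMap_stalk_ne_zero hϖ.ne_zero), ord_algebraMap_of_irreducible hx hϖ, mul_one]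

end Ord

section FunctionFieldMap

variable {U X : Scheme.{u}} [IsIntegral U] [IsIntegral X] (f : U ⟶ X)
  (hf : f (genericPoint U) ⤳ genericPoint X)

/-- The map of function fields of a dominant morphism. -/
noncomputable def functionFieldMap : X.functionField →+* U.functionField :=
  (f.stalkMap (genericPoint U)).hom.comp (X.presheaf.stalkSpecializes hf).hom

lemma functionFieldMap_algebraMap (y : U) (a : X.presheaf.stalk (f y)) :
    functionFieldMap f hf (algebraMap (X.presheaf.stalk (f y)) X.functionField a) =
      algebraMap (U.presheaf.stalk y) U.functionField ((f.stalkMap y).hom a) := by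
  have h := Scheme.Hom.stalkSpecializes_stalkMap f _ _ (genericPoint_specializes y)
  have h1 : X.presheaf.stalkSpecializes (genericPoint_specializes (f y)) ≫
      X.presheaf.stalkSpecializes hf =
      X.presheaf.stalkSpecializes ((genericPoint_specializes y).map f.continuous) :=
    X.presheaf.stalkSpecializes_comp _ _
  rw [← h1, Category.assoc] at h
  exact congr($h a)

variable [IsLocallyNoetherian U] [IsLocallyNoetherian X]

/-- A uniformizer at `f y` stays a uniformizer at `y`, so orders do not change under pullback. -/
lemma ord_functionFieldMap {y : U} (hy : Order.coheight y = 1)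
    (hfy : Order.coheight (f y) = 1) [IsDiscreteValuationRing (U.presheaf.stalk y)]
    [IsDiscreteValuationRing (X.presheaf.stalk (f y))]
    (hm : (maximalIdeal (X.presheaf.stalk (f y))).map (f.stalkMap y).hom =
      maximalIdeal (U.presheaf.stalk y)) {a : X.functionField} (ha : a ≠ 0) :
    U.ord (functionFieldMap f hf a) y = X.ord a (f y) := by
  obtain ⟨ϖ, hϖ⟩ := IsDiscreteValuationRing.exists_irreducible (X.presheaf.stalk (f y))
  have hϖ' : Irreducible ((f.stalkMap y).hom ϖ) := by
    rw [hϖ.maximalIdeal_eq, Ideal.map_span, Set.image_singleton] at hm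
    exact IsDiscreteValuationRing.irreducible_of_span_eq_maximalIdeal _ (by
      intro h0
      rw [h0, Ideal.span_singleton_eq_bot.2 rfl] at hm
      exact IsDiscreteValuationRing.not_a_field _ hm.symm) hm.symm
  have key : ∀ b : X.presheaf.stalk (f y), b ≠ 0 →
      functionFieldMap f hf (algebraMap (X.presheaf.stalk (f y)) X.functionField b) ≠ 0 ∧
      U.ord (functionFieldMap f hf (algebraMap (X.presheaf.stalk (f y)) X.functionField b)) y =
        X.ord (algebraMap (X.presheaf.stalk (f y)) X.functionField b) (f y) := by
    intro b hb
    obtain ⟨n, hn⟩ := IsDiscreteValuationRing.associated_pow_irreducible hb hϖ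
    have hn' := hn.map (f.stalkMap y).hom
    rw [map_pow] at hn'
    rw [functionFieldMap_algebraMap, ord_algebraMap_of_associated_pow hfy hϖ hn,
      ord_algebraMap_of_associated_pow hy hϖ' hn']
    exact ⟨algebraMap_stalk_ne_zero
      (hn'.ne_zero_iff.2 (pow_ne_zero _ hϖ'.ne_zero)), rfl⟩
  obtain ⟨b, c, hc, rfl⟩ := IsFractionRing.div_surjective (A := X.presheaf.stalk (f y)) a
  have hc0 := nonZeroDivisors.ne_zero hc
  have hb0 : b ≠ 0 := by
    rintro rfl
    rw [map_zero, zero_div] at ha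
    exact ha rfl
  obtain ⟨hb1, hb2⟩ := key b hb0
  obtain ⟨hc1, hc2⟩ := key c hc0
  have h1 := Scheme.ord_mul (x := f y) ha (algebraMap_stalk_ne_zero hc0)
  have h2 := Scheme.ord_mul (x := y) ((_root_.map_ne_zero (functionFieldMap f hf)).2 ha) hc1
  rw [← map_mul] at h2
  rw [div_mul_cancel₀ _ (algebraMap_stalk_ne_zero hc0)] at h1 h2
  linarith

end FunctionFieldMap

end QuotientRamification

/-! ### The divisors E₁ and F₁ -/

namespace QuotientRamification

open AlgebraicGeometry CategoryTheory IsLocalRing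

section

variable {U : Scheme.{u}} [IsIntegral U] [IsRegularScheme U] {x : Γ(U, ⊤)} (hx0 : x ≠ 0)
  (hx : ZeroSchemeIsRegular x)
include hx0 hx

lemma ord_germ_eq_reducedDivisor {y : U} (hy : Order.coheight y = 1) :
    U.ord (algebraMap (U.presheaf.stalk y) U.functionField
      ((U.presheaf.germ ⊤ y trivial).hom x)) y = reducedDivisor (U.zeroLocus {x}) y := by
  have := isDiscreteValuationRing_stalk hy
  by_cases hyx : y ∈ U.zeroLocus {x}
  · rw [ord_algebraMap_of_irreducible hy (IsQuotient.prime_germ hx0 hx hyx).irreducible,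
      reducedDivisor, if_pos ⟨hy, hyx⟩]
  · rw [reducedDivisor, if_neg fun h => hyx h.2]
    rw [IsQuotient.mem_zeroLocus_singleton_iff, not_not] at hyx
    exact ord_algebraMap_of_isUnit hyx

end

namespace IsQuotient

variable {G : Type} [Group G] [Fintype G] {U X : Scheme.{u}} {ρ : G →* Aut U} {f : U ⟶ X}
  (hf : IsQuotient ρ f) [IsIntegral U] {x : Γ(U, ⊤)}
  (hI : ∀ g : G, ∃ v, (actInv ρ g).appTop x = x * (1 + x * v))
include hf hI

/-- The function `x` has a norm, and the norm has the same divisor as a power of `x`. -/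
lemma exists_associated_pow : ∃ t : Γ(X, ⊤), Associated (f.appTop t) (x ^ Nat.card G) := by
  have : Nonempty (f ⁻¹ᵁ ⊤) := ⟨⟨Classical.arbitrary U, trivial⟩⟩
  let := hf.sectionAction ⊤
  let := (f.app ⊤).hom.toAlgebra
  have := hf.smulCommClass ⊤
  have := hf.isInvariant ⊤
  let x' : Γ(U, f ⁻¹ᵁ ⊤) := x
  obtain ⟨t, ht⟩ := IsLocalCover.exists_norm Γ(X, ⊤) G x'
  refine ⟨t, ?_⟩
  have hdvd : ∀ g : G, x' ∣ g • x' := by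
    intro g
    obtain ⟨v, hv⟩ := hI g
    have h1 : (actInv ρ g).appLE (f ⁻¹ᵁ ⊤) (f ⁻¹ᵁ ⊤) (hf.preimage_le g ⊤) =
      (actInv ρ g).appTop := Scheme.Hom.appLE_eq_app (actInv ρ g)
    exact ⟨((1 + x * v : Γ(U, ⊤)) : Γ(U, f ⁻¹ᵁ ⊤)), congr($h1 x).trans hv⟩
  have hass : ∀ g : G, Associated (g • x') x' := by
    intro g
    refine associated_of_dvd_dvd ?_ (hdvd g)
    obtain ⟨c, hc⟩ := hdvd g⁻¹
    exact ⟨g • c, by rw [← smul_mul', ← hc, smul_inv_smul]⟩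
  have h1 : Associated (∏ g : G, g • x') (∏ _g : G, x') :=
    Associated.prod _ _ _ fun g _ => hass g
  rw [← ht, Finset.prod_const, Finset.card_univ, ← Nat.card_eq_fintype_card] at h1
  exact h1

omit hf [IsIntegral U] hI in
lemma mem_zeroLocus_iff {t : Γ(X, ⊤)} (ht : Associated (f.appTop t) (x ^ Nat.card G)) (y : U) :
    y ∈ U.zeroLocus {x} ↔ f y ∈ X.zeroLocus {t} := by
  have h1 := ht.map (U.presheaf.germ ⊤ y trivial).hom
  rw [mem_zeroLocus_singleton_iff, mem_zeroLocus_singleton_iff, not_iff_not,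
    ← isUnit_map_iff (f.stalkMap y).hom]
  have h2 : (f.stalkMap y).hom ((X.presheaf.germ ⊤ (f y) trivial).hom t) =
      (U.presheaf.germ ⊤ y trivial).hom (f.appTop t) :=
    Scheme.Hom.germ_stalkMap_apply f ⊤ y trivial t
  rw [h2, h1.isUnit_iff, map_pow, isUnit_pow_iff Nat.card_pos.ne']

/-- `E₁` is the full preimage of the zero locus of the norm of `x`. -/
lemma mem_image_zeroLocus_iff (y : U) :
    f y ∈ f '' U.zeroLocus {x} ↔ y ∈ U.zeroLocus {x} := by
  refine ⟨?_, fun h => ⟨y, h, rfl⟩⟩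
  rintro ⟨y', hy', hyy⟩
  obtain ⟨t, ht⟩ := hf.exists_associated_pow hI
  rw [mem_zeroLocus_iff ht] at hy' ⊢
  rwa [← hyy]

variable [IsIntegral X] [IsRegularScheme U] {p : ℕ} [Fact p.Prime]
  (hcard : Nat.card G = p) (hx0 : x ≠ 0) (hx : ZeroSchemeIsRegular x)
  {O : U.Opens} (hO : FixedSchemeEqZeroScheme ρ x O) (hyO : ∀ y : U, Order.coheight y = 1 → y ∈ O)
include hcard hx0 hx hO hyO

lemma coheight_apply_eq_one {y : U} (hy : Order.coheight y = 1) : Order.coheight (f y) = 1 := by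
  obtain ⟨h1, -⟩ := hf.exists_isGenerator hcard hx0 hx hO hI hy (hyO y hy)
  have h2 := IsDiscreteValuationRing.ringKrullDim_eq_one (X.presheaf.stalk (f y))
  rw [ringKrullDim_stalk_eq_coheight] at h2
  exact_mod_cast h2

lemma pullbackDivisor_apply (D : X → ℤ) {y : U} (hy : Order.coheight y = 1) :
    pullbackDivisor f D y = D (f y) := by
  obtain ⟨-, h2, -⟩ := hf.exists_isGenerator hcard hx0 hx hO hI hy (hyO y hy)
  rw [pullbackDivisor, if_pos hy, ramificationIndex_eq_one h2, Nat.cast_one, one_mul]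

theorem pullbackDivisor_reducedDivisor :
    pullbackDivisor f (reducedDivisor (f '' U.zeroLocus {x})) =
      reducedDivisor (U.zeroLocus {x}) := by
  funext y
  by_cases hy : Order.coheight y = 1
  · have hfy := hf.coheight_apply_eq_one hI hcard hx0 hx hO hyO hy
    have hmem := hf.mem_image_zeroLocus_iff hI y
    rw [hf.pullbackDivisor_apply hI hcard hx0 hx hO hyO _ hy, reducedDivisor, reducedDivisor]
    by_cases hyx : y ∈ U.zeroLocus {x}
    · rw [if_pos ⟨hfy, hmem.2 hyx⟩, if_pos ⟨hy, hyx⟩]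
    · rw [if_neg fun h => hyx (hmem.1 h.2), if_neg fun h => hyx h.2]
  · rw [pullbackDivisor, if_neg hy, reducedDivisor, if_neg fun h => hy h.1]

/-- The norm `t` of `x` is a global equation of p·F₁. Orders on the quotient are computed on `U`,
where `t` becomes x^p up to a unit. -/
theorem isQCartier [IsLocallyNoetherian X] : IsQCartier (reducedDivisor (f '' U.zeroLocus {x})) := by
  obtain ⟨t, ht⟩ := hf.exists_associated_pow hI
  have hgen : f (genericPoint U) ⤳ genericPoint X := by rw [hf.map_genericPoint]
  have hxp : x ^ Nat.card G ≠ 0 := pow_ne_zero _ hx0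
  have ht0 : t ≠ 0 := by
    rintro rfl
    rw [map_zero] at ht
    exact hxp ((associated_zero_iff_eq_zero _).1 ht.symm)
  have : Nonempty (⊤ : X.Opens) := ⟨⟨Classical.arbitrary X, trivial⟩⟩
  have hg : X.germToFunctionField ⊤ t ≠ 0 :=
    (map_ne_zero_iff _ (X.germToFunctionField_injective ⊤)).2 ht0
  refine ⟨p, (Fact.out : p.Prime).pos, fun x' => ⟨⊤, trivial, X.germToFunctionField ⊤ t, hg, ?_⟩⟩
  intro x' _ hx'
  obtain ⟨y, rfl⟩ := hf.surjective x'
  have hy := hf.coheight_eq_one hx'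
  obtain ⟨h1, h2, -⟩ := hf.exists_isGenerator hcard hx0 hx hO hI hy (hyO y hy)
  have := isDiscreteValuationRing_stalk hy
  have hgy : (U.presheaf.germ ⊤ y trivial).hom x ≠ 0 :=
    (map_ne_zero_iff _ (germ_injective_of_isIntegral U (U := ⊤) y trivial)).2 hx0
  have h3 : (f.stalkMap y).hom ((X.presheaf.germ ⊤ (f y) trivial).hom t) =
      (U.presheaf.germ ⊤ y trivial).hom (f.appTop t) :=
    Scheme.Hom.germ_stalkMap_apply f ⊤ y trivial t
  have h4 := ht.map (U.presheaf.germ ⊤ y trivial).hom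
  rw [map_pow] at h4
  rw [← ord_functionFieldMap f hgen hy hx' h2 hg,
    ← X.algebraMap_germ_eq_germToFunctionField (x := f y) (U := ⊤) trivial t,
    functionFieldMap_algebraMap]
  erw [h3]
  rw [ord_algebraMap_of_associated (pow_ne_zero _ hgy) h4, map_pow,
    ord_pow (algebraMap_stalk_ne_zero hgy), ord_germ_eq_reducedDivisor hx0 hx hy, hcard,
    ← hf.pullbackDivisor_reducedDivisor hI hcard hx0 hx hO hyO,
    hf.pullbackDivisor_apply hI hcard hx0 hx hO hyO _ hy]

end IsQuotient

end QuotientRamification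

/-! ### Comparing local generators of the canonical sheaves of both schemes -/

namespace QuotientRamification

open MvPolynomial

lemma IsConormalFrame.isSeparableFrame_extend {R K L : Type u} [CommRing R] [Field K] [Field L]
    [Algebra K L] [FiniteDimensional K L] [Algebra.IsSeparable K L] {φK : R →+* K} {φL : R →+* L}
    (hφ : ∀ r, algebraMap K L (φK r) = φL r) {ι κ : Type} [Fintype κ] {a : ι → K}
    {f : κ → MvPolynomial ι R} (hf : IsConormalFrame φK a f) (ha : EssentiallyGenerates φK a) :
    IsSeparableFrame φL (fun i => algebraMap K L (a i)) f :=
  ⟨K, inferInstance, inferInstance, φK, a, inferInstance, inferInstance, hφ, fun _ => rfl, ha, hf⟩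

/-- A rational canonical form on the source of an extension of local rings generated by one root
`z` of a polynomial `H` is compared with a local generator of the canonical module: the order of
the pullback of a form differs from the order of the form by the order of `H'(z)`. -/
theorem exists_presentation_isRatio {R₀ R A B K L : Type u} [CommRing R₀] [CommRing R] [CommRing A]
    [CommRing B] [Field K] [Field L] [Algebra R₀ R] (M : Submonoid R₀) [IsLocalization M R]
    [Algebra K L] [FiniteDimensional K L] [Algebra.IsSeparable K L] {φA : R₀ →+* A} {i : A →+* B}
    {φB : R₀ →+* B} {jA : A →+* K} {jB : B →+* L} {φK : R →+* K} {φL : R →+* L}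
    (hφB : φB = i.comp φA) (hjA : Function.Injective jA) (hjB : Function.Injective jB)
    (hfracA : ∀ z, ∃ x y, y ≠ 0 ∧ z * jA y = jA x) (hfracB : ∀ z, ∃ x y, y ≠ 0 ∧ z * jB y = jB x)
    (hcomm : ∀ x, algebraMap K L (jA x) = jB (i x))
    (hφK : ∀ r, φK (algebraMap R₀ R r) = jA (φA r)) (hφL : ∀ r, algebraMap K L (φK r) = φL r)
    (P : Presentation φA) {z : B} {H : Polynomial A} {d : B} (hH : IsGenerator i z H d)
    (hd : d ≠ 0)
    {ι κ ι' κ' : Type} [Fintype ι] [DecidableEq ι] [Fintype κ] [DecidableEq κ] [Fintype ι']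
    [DecidableEq ι'] [Fintype κ'] [DecidableEq κ'] {a : ι → K} {f : κ → MvPolynomial ι R}
    (hf : IsConormalFrame φK a f) (ha : EssentiallyGenerates φK a) {b : ι' → L}
    {g : κ' → MvPolynomial ι' R} (hg : IsConormalFrame φL b g) (hb : EssentiallyGenerates φL b)
    {r : K} (hr : IsRatio φK a f (fun k => jA (P.coord k))
      (fun k => map (algebraMap R₀ R) (P.rel k)) r)
    {s : L} (hs : IsRatio φL (fun k => algebraMap K L (a k)) f b g s) :
    ∃ (Q : Presentation φB) (t : L) (e : B),
      IsRatio φL b g (fun k => jB (Q.coord k)) (fun k => map (algebraMap R₀ R) (Q.rel k)) t ∧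
      Associated e d ∧ EqUpToSign (s * t) (algebraMap K L r * jB e) := by
  subst hφB
  have hder : H.derivative.eval₂ i z ≠ 0 := hH.associated.ne_zero_iff.2 hd
  have hφ' : ∀ r, φL (algebraMap R₀ R r) = jB (i (φA r)) := fun r => by
    rw [← hφL, hφK, hcomm]
  obtain ⟨Q, w, r', hw, hr', hsign⟩ := Presentation.exists_adjoin hjA hjB hfracA hfracB hcomm P
    hH.root hH.dvd hder hH.gen hφ'
  have F1 : IsSeparableFrame φL (fun k => algebraMap K L (a k)) f :=
    hf.isSeparableFrame_extend hφL ha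
  have F2 : IsSeparableFrame φL (fun k => jB (i (P.coord k)))
      (fun k => map (algebraMap R₀ R) (P.rel k)) := by
    have := (P.isConormalFrame.localize M hjA hφK).isSeparableFrame_extend hφL
      (P.essentiallyGenerates.localize hjA hfracA hφK)
    simpa only [hcomm] using this
  have G3 : EssentiallyGenerates φL fun k => jB (Q.coord k) :=
    Q.essentiallyGenerates.localize hjB hfracB hφ'
  have F3 : IsSeparableFrame φL (fun k => jB (Q.coord k))
      (fun k => map (algebraMap R₀ R) (Q.rel k)) :=
    (Q.isConormalFrame.localize M hjB hφ').isSeparableFrame G3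
  have F4 : IsSeparableFrame φL b g := hg.isSeparableFrame hb
  have h12 : IsRatio φL (fun k => algebraMap K L (a k)) f (fun k => jB (i (P.coord k)))
      (fun k => map (algebraMap R₀ R) (P.rel k)) (algebraMap K L r) := by
    have := hr.map (θ := RingHom.id R) (algebraMap K L).injective (fun r => (hφL r).symm)
    simpa only [MvPolynomial.map_id, hcomm, RingHom.id_apply] using this
  -- Both sides compute the ratio `m` of [da/f] to the generator given by `Q`: it is s·t through
  -- [db/g], and r·e through the generator given by `P`.
  obtain ⟨m, hm⟩ := F1.exists_isRatio F3 G3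
  obtain ⟨t, ht⟩ := F4.exists_isRatio F3 G3
  refine ⟨Q, t, i w * H.derivative.eval₂ i z, ht, ?_, ?_⟩
  · exact ((associated_isUnit_mul_left_iff (hw.map i)).2 (.refl _)).trans hH.associated
  · exact ((hs.eqUpToSign_mul F1 F4 F3 G3 ht hm).symm.trans
      (h12.eqUpToSign_mul F1 F2 F3 G3 hr' hm)).trans (EqUpToSign.rfl'.mul hsign)

end QuotientRamification

/-! ### Local rings at generizations, and presentations of stalks -/

namespace QuotientRamification

open AlgebraicGeometry CategoryTheory IsLocalRing

section Stalk

/-- The local ring at a generization is a localization of the local ring. -/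
lemma isLocalization_stalkSpecializes {S : Scheme.{u}} {s s' : S} (h : s' ⤳ s) :
    letI := (S.presheaf.stalkSpecializes h).hom.toAlgebra
    ∃ M : Submonoid (S.presheaf.stalk s), IsLocalization M (S.presheaf.stalk s') := by
  let := (S.presheaf.stalkSpecializes h).hom.toAlgebra
  obtain ⟨W, hW, hs, -⟩ := exists_isAffineOpen_mem_and_subset (U := ⊤) (x := s) trivial
  have hs' : s' ∈ W := h.mem_open W.isOpen hs
  let := S.presheaf.algebra_section_stalk ⟨s, hs⟩
  let := S.presheaf.algebra_section_stalk ⟨s', hs'⟩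
  have h1 := hW.isLocalization_stalk ⟨s, hs⟩
  have h2 := hW.isLocalization_stalk ⟨s', hs'⟩
  have hgerm : S.presheaf.germ W s hs ≫ S.presheaf.stalkSpecializes h =
      S.presheaf.germ W s' hs' := S.presheaf.germ_stalkSpecializes hs h
  have : IsScalarTower Γ(S, W) (S.presheaf.stalk s) (S.presheaf.stalk s') :=
    IsScalarTower.of_algebraMap_eq fun a => congr($hgerm a).symm
  refine ⟨_, IsLocalization.isLocalization_of_submonoid_le (S.presheaf.stalk s)
    (S.presheaf.stalk s') (hW.primeIdealOf ⟨s, hs⟩).asIdeal.primeCompl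
    (hW.primeIdealOf ⟨s', hs'⟩).asIdeal.primeCompl ?_⟩
  intro a ha
  have ha' : IsUnit ((S.presheaf.germ W s hs).hom a) :=
    IsLocalization.map_units (S.presheaf.stalk s)
      (⟨a, ha⟩ : (hW.primeIdealOf ⟨s, hs⟩).asIdeal.primeCompl)
  have ha'' := ha'.map (S.presheaf.stalkSpecializes h).hom
  rw [IsAffineOpen.primeIdealOf_eq_map_closedPoint]
  refine not_not.2 (?_ : IsUnit ((S.presheaf.germ W s' hs').hom a))
  rw [← hgerm]
  exact ha''

variable {X : Scheme.{u}} [IsIntegral X] {x x' : X} (h : x' ⤳ x)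

lemma stalkSpecializes_injective : Function.Injective (X.presheaf.stalkSpecializes h).hom := by
  have h1 : X.presheaf.stalkSpecializes h ≫
      X.presheaf.stalkSpecializes (genericPoint_specializes x') =
      X.presheaf.stalkSpecializes (genericPoint_specializes x) :=
    X.presheaf.stalkSpecializes_comp _ _
  have h2 : Function.Injective (X.presheaf.stalkSpecializes (genericPoint_specializes x)).hom :=
    IsFractionRing.injective (X.presheaf.stalk x) X.functionField
  rw [← h1] at h2
  exact Function.Injective.of_comp h2

omit [IsIntegral X] in
lemma exists_mul_stalkSpecializes (z : X.presheaf.stalk x') :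
    ∃ a b, b ≠ 0 ∧ z * (X.presheaf.stalkSpecializes h).hom b =
      (X.presheaf.stalkSpecializes h).hom a := by
  let := (X.presheaf.stalkSpecializes h).hom.toAlgebra
  obtain ⟨M, hM⟩ := isLocalization_stalkSpecializes h
  obtain ⟨⟨a, b⟩, hab⟩ := IsLocalization.surj M z
  refine ⟨a, b, ?_, hab⟩
  intro h0
  have := IsLocalization.map_units (X.presheaf.stalk x') b
  rw [h0, map_zero] at this
  exact not_isUnit_zero this

lemma isField_stalk (hx : x' = genericPoint X) : IsField (X.presheaf.stalk x') := by
  subst hx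
  exact (inferInstance : Field X.functionField).toIsField

end Stalk

lemma exists_essentiallyGenerates {Z S : Scheme.{u}} (π : Z ⟶ S) [LocallyOfFiniteType π] (z : Z) :
    ∃ (n : ℕ) (a : Fin n → Z.presheaf.stalk z),
      EssentiallyGenerates (π.stalkMap z).hom a := by
  obtain ⟨W, hW, hzW, -⟩ := exists_isAffineOpen_mem_and_subset (U := ⊤) (x := π z) trivial
  obtain ⟨V, hV, hzV, hVW⟩ := exists_isAffineOpen_mem_and_subset (U := π ⁻¹ᵁ W) (x := z) hzW
  replace hVW : V ≤ π ⁻¹ᵁ W := hVW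
  have hft := π.finiteType_appLE hW hV hVW
  algebraize [(π.appLE W V hVW).hom]
  obtain ⟨n, F, hF⟩ := Algebra.FiniteType.iff_quotient_mvPolynomial''.1 hft
  have hgerm : S.presheaf.germ W (π z) hzW ≫ π.stalkMap z =
      π.appLE W V hVW ≫ Z.presheaf.germ V z hzV := by
    change _ = (π.app W ≫ Z.presheaf.map (homOfLE hVW).op) ≫ _
    rw [Scheme.Hom.germ_stalkMap, Category.assoc, Z.presheaf.germ_res]
  refine ⟨n, fun k => (Z.presheaf.germ V z hzV).hom (F (.X k)), fun s => ?_⟩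
  have heval : ∀ q : MvPolynomial (Fin n) Γ(S, W),
      MvPolynomial.eval₂ (π.stalkMap z).hom (fun k => (Z.presheaf.germ V z hzV).hom (F (.X k)))
        (MvPolynomial.map (S.presheaf.germ W (π z) hzW).hom q) =
      (Z.presheaf.germ V z hzV).hom (F q) := by
    intro q
    rw [MvPolynomial.eval₂_map]
    have h1 : (π.stalkMap z).hom.comp (S.presheaf.germ W (π z) hzW).hom =
        (Z.presheaf.germ V z hzV).hom.comp (algebraMap Γ(S, W) Γ(Z, V)) :=
      congrArg CommRingCat.Hom.hom hgerm
    have h2 : F q = MvPolynomial.aeval (fun k => F (.X k)) q :=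
      congr($(MvPolynomial.aeval_unique F) q)
    rw [h1, h2, MvPolynomial.aeval_def, MvPolynomial.hom_eval₂]
  obtain ⟨a, t, ht, hat⟩ := exists_mul_germ_eq hV z hzV s
  obtain ⟨P, rfl⟩ := hF a
  obtain ⟨Q, rfl⟩ := hF t
  refine ⟨MvPolynomial.map (S.presheaf.germ W (π z) hzW).hom P,
    MvPolynomial.map (S.presheaf.germ W (π z) hzW).hom Q, ?_, ?_⟩
  · rw [heval]
    exact ht
  · rw [heval, heval]
    exact hat

theorem nonempty_presentation {Z S : Scheme.{u}} [IsRegularScheme S] (π : Z ⟶ S)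
    [LocallyOfFiniteType π] (z : Z) [IsRegularLocalRing (Z.presheaf.stalk z)] :
    Nonempty (Presentation (π.stalkMap z).hom) := by
  have := IsRegularScheme.isRegularLocalRing_stalk (π z)
  obtain ⟨n, a, ha⟩ := exists_essentiallyGenerates π z
  exact exists_presentation _ ha

end QuotientRamification

/-! ### Existence of canonical forms and of their divisors -/

namespace QuotientRamification

open AlgebraicGeometry CategoryTheory IsLocalRing

section

variable {X S : Scheme.{u}} [IsIntegral X] (π : X ⟶ S) {x x' : X} (h : x' ⤳ x)

omit [IsIntegral X] in
lemma stalkMap_stalkSpecializes (r : S.presheaf.stalk (π x)) :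
    (π.stalkMap x').hom ((S.presheaf.stalkSpecializes (h.map π.continuous)).hom r) =
      (X.presheaf.stalkSpecializes h).hom ((π.stalkMap x).hom r) :=
  Scheme.Hom.stalkSpecializes_stalkMap_apply π x' x h r

lemma Presentation.isConormalFrame_stalkSpecializes (P : Presentation (π.stalkMap x).hom) :
    IsConormalFrame (π.stalkMap x').hom
      (fun i => (X.presheaf.stalkSpecializes h).hom (P.coord i))
      (fun j => MvPolynomial.map (S.presheaf.stalkSpecializes (h.map π.continuous)).hom
        (P.rel j)) := by
  let := (S.presheaf.stalkSpecializes (h.map π.continuous)).hom.toAlgebra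
  obtain ⟨M, hM⟩ := isLocalization_stalkSpecializes (h.map π.continuous)
  exact P.isConormalFrame.localize M (stalkSpecializes_injective h)
    (stalkMap_stalkSpecializes π h)

lemma Presentation.essentiallyGenerates_stalkSpecializes (hx' : IsField (X.presheaf.stalk x'))
    (P : Presentation (π.stalkMap x).hom) :
    EssentiallyGenerates (π.stalkMap x').hom
      (fun i => (X.presheaf.stalkSpecializes h).hom (P.coord i)) := by
  let := hx'.toField
  let := (S.presheaf.stalkSpecializes (h.map π.continuous)).hom.toAlgebra
  exact P.essentiallyGenerates.localize (stalkSpecializes_injective h)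
    (exists_mul_stalkSpecializes h) (stalkMap_stalkSpecializes π h)

end

section

variable {X S : Scheme.{u}} [IsIntegral X] [IsRegularScheme S] (π : X ⟶ S)
  [LocallyOfFiniteType π]

theorem nonempty_presentation_genericPoint :
    Nonempty (Presentation (π.stalkMap (genericPoint X)).hom) := by
  have : IsRegularLocalRing (X.presheaf.stalk (genericPoint X)) :=
    inferInstanceAs (IsRegularLocalRing X.functionField)
  exact nonempty_presentation π _

theorem nonempty_canonicalForm : Nonempty (CanonicalForm π) :=
  (nonempty_presentation_genericPoint π).map fun P => ⟨1, one_ne_zero, P⟩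

variable {π} [IsLocallyNoetherian X]

theorem CanonicalForm.exists_hasOrder (η : CanonicalForm π) (x : X)
    [IsRegularLocalRing (X.presheaf.stalk x)] : ∃ m, η.HasOrder x m := by
  obtain ⟨P⟩ := nonempty_presentation π x
  have hF := isField_stalk (X := X) rfl
  have h1 := P.isConormalFrame_stalkSpecializes π (genericPoint_specializes x)
  have h2 := P.essentiallyGenerates_stalkSpecializes π (genericPoint_specializes x) hF
  have h3 : IsSeparableFrame (L := X.functionField) (π.stalkMap (genericPoint X)).hom
      η.pres.coord η.pres.rel :=
    η.pres.isConormalFrame.isSeparableFrame (L := X.functionField) η.pres.essentiallyGenerates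
  obtain ⟨r, hr⟩ := h3.exists_isRatio (h1.isSeparableFrame (L := X.functionField) h2) h2
  exact ⟨_, P, r, hr, rfl⟩

theorem CanonicalForm.exists_hasDivisor (η : CanonicalForm π)
    (hreg : ∀ x : X, Order.coheight x = 1 → IsRegularLocalRing (X.presheaf.stalk x)) :
    ∃ D, η.HasDivisor D := by
  classical
  have h (x : X) : ∃ m, (Order.coheight x = 1 → η.HasOrder x m) ∧
      (Order.coheight x ≠ 1 → m = 0) := by
    by_cases hx : Order.coheight x = 1
    · have := hreg x hx
      obtain ⟨m, hm⟩ := η.exists_hasOrder x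
      exact ⟨m, fun _ => hm, fun h => absurd hx h⟩
    · exact ⟨0, fun h => absurd h hx, fun _ => rfl⟩
  choose D hD using h
  exact ⟨D, hD⟩

end

end QuotientRamification

/-! ### Pullback of canonical forms -/

namespace QuotientRamification

open AlgebraicGeometry CategoryTheory IsLocalRing

lemma ord_eq_of_eqUpToSign {X : Scheme.{u}} [IsIntegral X] [IsLocallyNoetherian X] {x : X}
    {a b : X.functionField} (h : EqUpToSign a b) : X.ord a x = X.ord b x := by
  rcases h with rfl | rfl
  · rfl
  by_cases hb : b = 0
  · rw [hb, neg_zero]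
  have h1 : X.ord (algebraMap (X.presheaf.stalk x) X.functionField (-1)) x = 0 :=
    ord_algebraMap_of_isUnit isUnit_one.neg
  rw [map_neg, map_one] at h1
  rw [← neg_one_mul, Scheme.ord_mul (neg_ne_zero.2 one_ne_zero) hb, h1, zero_add]

namespace IsQuotient

variable {G : Type} [Group G] [Fintype G] {U X S : Scheme.{u}} {ρ : G →* Aut U} {f : U ⟶ X}
  (hf : IsQuotient ρ f) [IsIntegral U] [IsIntegral X]
include hf

/-- The points `f (genericPoint U)` and `genericPoint X` are equal, but not by definition. The stalk
at the first is the source of the stalk map, so it serves as the model of the lower function field.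
-/
lemma isField_stalk_genericPoint : IsField (X.presheaf.stalk (f (genericPoint U))) :=
  isField_stalk hf.map_genericPoint

variable {p : ℕ} [Fact p.Prime] (hcard : Nat.card G = p)
include hcard

lemma finiteDimensional_and_isSeparable :
    letI := hf.isField_stalk_genericPoint.toField
    letI : Algebra (X.presheaf.stalk (f (genericPoint U))) U.functionField :=
      (f.stalkMap (genericPoint U)).hom.toAlgebra
    FiniteDimensional (X.presheaf.stalk (f (genericPoint U))) U.functionField ∧
      Algebra.IsSeparable (X.presheaf.stalk (f (genericPoint U))) U.functionField := by
  obtain ⟨V, hV, hyV, -⟩ :=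
    exists_isAffineOpen_mem_and_subset (U := ⊤) (x := f (genericPoint U)) trivial
  let := hf.sectionAction V
  let := (f.app V).hom.toAlgebra
  have := hf.smulCommClass V
  have := hf.isInvariant V
  have : Nonempty (f ⁻¹ᵁ V) := ⟨⟨genericPoint U, hyV⟩⟩
  let := hf.isField_stalk_genericPoint.toField
  let : Algebra (X.presheaf.stalk (f (genericPoint U))) U.functionField :=
      (f.stalkMap (genericPoint U)).hom.toAlgebra
  exact IsLocalCover.finiteDimensional_and_isSeparable
    (K := X.presheaf.stalk (f (genericPoint U))) (L := U.functionField)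
    (hf.isLocalCover hV _ hyV) hcard

theorem exists_isPullback [IsRegularScheme S] (π : X ⟶ S) [LocallyOfFiniteType (f ≫ π)]
    (η : CanonicalForm π) : ∃ η' : CanonicalForm (f ≫ π), η.IsPullback f η' := by
  let := hf.isField_stalk_genericPoint.toField
  let : Algebra (X.presheaf.stalk (f (genericPoint U))) U.functionField :=
      (f.stalkMap (genericPoint U)).hom.toAlgebra
  obtain ⟨_, _⟩ := hf.finiteDimensional_and_isSeparable hcard
  have hgen : f (genericPoint U) ⤳ genericPoint X := by rw [hf.map_genericPoint]
  have h1 := η.pres.isConormalFrame_stalkSpecializes π hgen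
  have h2 := η.pres.essentiallyGenerates_stalkSpecializes π hgen hf.isField_stalk_genericPoint
  have hφ : ∀ r, algebraMap (X.presheaf.stalk (f (genericPoint U))) U.functionField
      ((π.stalkMap (f (genericPoint U))).hom r) = ((f ≫ π).stalkMap (genericPoint U)).hom r :=
    fun r => congr($(Scheme.Hom.stalkMap_comp f π (genericPoint U)) r).symm
  have F1 := h1.isSeparableFrame_extend (L := U.functionField) hφ h2
  obtain ⟨P⟩ := nonempty_presentation_genericPoint (f ≫ π)
  have F2 : IsSeparableFrame (L := U.functionField) ((f ≫ π).stalkMap (genericPoint U)).hom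
      P.coord P.rel :=
    P.isConormalFrame.isSeparableFrame (L := U.functionField) P.essentiallyGenerates
  obtain ⟨r, hr⟩ := F1.exists_isRatio F2 P.essentiallyGenerates
  have hr0 := hr.ne_zero F1 F2 P.essentiallyGenerates
  refine ⟨⟨functionFieldMap f hgen η.coeff * r, mul_ne_zero ?_ hr0, P⟩, hgen,
    hgen.map π.continuous, r, hr, rfl⟩
  exact (_root_.map_ne_zero _).2 η.coeff_ne_zero

end IsQuotient

end QuotientRamification

/-! ### The formula for the canonical divisor -/

namespace QuotientRamification

open AlgebraicGeometry CategoryTheory IsLocalRing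

namespace IsQuotient

variable {G : Type} [Group G] [Fintype G] {U X S : Scheme.{u}} {ρ : G →* Aut U} {f : U ⟶ X}
  (hf : IsQuotient ρ f) [IsIntegral U] [IsIntegral X] [IsRegularScheme U]
  [IsLocallyNoetherian X] (π : X ⟶ S) {p : ℕ} [Fact p.Prime] (hcard : Nat.card G = p)
include hf hcard

theorem hasOrder_of_isPullback {y : U} (hy : Order.coheight y = 1)
    (hfy : Order.coheight (f y) = 1) [IsDiscreteValuationRing (X.presheaf.stalk (f y))]
    (hm : (maximalIdeal (X.presheaf.stalk (f y))).map (f.stalkMap y).hom =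
      maximalIdeal (U.presheaf.stalk y))
    {z : U.presheaf.stalk y} {H : Polynomial (X.presheaf.stalk (f y))} {d : U.presheaf.stalk y}
    (hH : IsGenerator (f.stalkMap y).hom z H d) (hd : d ≠ 0)
    {η : CanonicalForm π} {η' : CanonicalForm (f ≫ π)} (hη : η.IsPullback f η') {m : ℤ}
    (hord : η.HasOrder (f y) m) :
    η'.HasOrder y (m + U.ord (algebraMap (U.presheaf.stalk y) U.functionField d) y) := by
  have := isDiscreteValuationRing_stalk hy
  let := hf.isField_stalk_genericPoint.toField
  let : Algebra (X.presheaf.stalk (f (genericPoint U))) U.functionField :=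
      (f.stalkMap (genericPoint U)).hom.toAlgebra
  obtain ⟨_, _⟩ := hf.finiteDimensional_and_isSeparable hcard
  obtain ⟨hgen, hs, s, hs', hcoeff⟩ := hη
  obtain ⟨P, r, hr, hr'⟩ := hord
  have hsp : f (genericPoint U) ⤳ f y := (genericPoint_specializes y).map f.continuous
  have hspS : π (f (genericPoint U)) ⤳ π (f y) := hsp.map π.continuous
  let : Algebra (S.presheaf.stalk (π (f y))) (S.presheaf.stalk (π (f (genericPoint U)))) :=
    (S.presheaf.stalkSpecializes hspS).hom.toAlgebra
  obtain ⟨M, hM⟩ := isLocalization_stalkSpecializes hspS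
  have hφ : ∀ r, algebraMap (X.presheaf.stalk (f (genericPoint U))) U.functionField
      ((π.stalkMap (f (genericPoint U))).hom r) = ((f ≫ π).stalkMap (genericPoint U)).hom r :=
    fun r => congr($(Scheme.Hom.stalkMap_comp f π (genericPoint U)) r).symm
  have hφB : ((f ≫ π).stalkMap y).hom = (f.stalkMap y).hom.comp (π.stalkMap (f y)).hom :=
    congrArg CommRingCat.Hom.hom (Scheme.Hom.stalkMap_comp f π y)
  -- The ratio defining the order of η is moved from the function field of `X` to the stalk at `f
  -- (genericPoint U)`.
  have hr2 : IsRatio (π.stalkMap (f (genericPoint U))).hom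
      (fun i => (X.presheaf.stalkSpecializes hgen).hom (η.pres.coord i))
      (fun j => MvPolynomial.map (S.presheaf.stalkSpecializes hs).hom (η.pres.rel j))
      (fun i => (X.presheaf.stalkSpecializes hsp).hom (P.coord i))
      (fun j => MvPolynomial.map (S.presheaf.stalkSpecializes hspS).hom (P.rel j))
      ((X.presheaf.stalkSpecializes hgen).hom r) := by
    have h1 := hr.map (θ := (S.presheaf.stalkSpecializes hs).hom)
      (stalkSpecializes_injective hgen) (stalkMap_stalkSpecializes π hgen)
    have e1 : X.presheaf.stalkSpecializes (genericPoint_specializes (f y)) ≫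
        X.presheaf.stalkSpecializes hgen = X.presheaf.stalkSpecializes hsp :=
      X.presheaf.stalkSpecializes_comp _ _
    have e2 : S.presheaf.stalkSpecializes ((genericPoint_specializes (f y)).map π.continuous) ≫
        S.presheaf.stalkSpecializes hs = S.presheaf.stalkSpecializes hspS :=
      S.presheaf.stalkSpecializes_comp _ _
    have e1' : (fun i => (X.presheaf.stalkSpecializes hgen).hom
        (algebraMap (X.presheaf.stalk (f y)) X.functionField (P.coord i))) =
        fun i => (X.presheaf.stalkSpecializes hsp).hom (P.coord i) :=
      funext fun i => congr($e1 (P.coord i))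
    have e2' : (fun j => MvPolynomial.map (S.presheaf.stalkSpecializes hs).hom
        (MvPolynomial.map (S.presheaf.stalkSpecializes
          ((genericPoint_specializes (f y)).map π.continuous)).hom (P.rel j))) =
        fun j => MvPolynomial.map (S.presheaf.stalkSpecializes hspS).hom (P.rel j) := by
      funext j
      rw [MvPolynomial.map_map, ← e2]
      rfl
    rw [e1', e2'] at h1
    exact h1
  obtain ⟨Q, t, e, ht, he, hsign⟩ := exists_presentation_isRatio
    (K := X.presheaf.stalk (f (genericPoint U))) (L := U.functionField) M
    (jA := (X.presheaf.stalkSpecializes hsp).hom)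
    (jB := algebraMap (U.presheaf.stalk y) U.functionField) hφB (stalkSpecializes_injective hsp)
    (IsFractionRing.injective _ _) (exists_mul_stalkSpecializes hsp)
    (exists_mul_stalkSpecializes (genericPoint_specializes y))
    (fun a => Scheme.Hom.stalkSpecializes_stalkMap_apply f _ _ (genericPoint_specializes y) a)
    (stalkMap_stalkSpecializes π hsp) hφ P hH hd
    (η.pres.isConormalFrame_stalkSpecializes π hgen)
    (η.pres.essentiallyGenerates_stalkSpecializes π hgen hf.isField_stalk_genericPoint)
    η'.pres.isConormalFrame η'.pres.essentiallyGenerates hr2 hs'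
  refine ⟨Q, t, ht, ?_⟩
  have hP := P.essentiallyGenerates_stalkSpecializes π (genericPoint_specializes (f y))
    (isField_stalk rfl)
  have hr0 : r ≠ 0 := hr.ne_zero (L := X.functionField)
    (η.pres.isConormalFrame.isSeparableFrame (L := X.functionField) η.pres.essentiallyGenerates)
    ((P.isConormalFrame_stalkSpecializes π
      (genericPoint_specializes (f y))).isSeparableFrame (L := X.functionField) hP) hP
  have hcr : η.coeff * r ≠ 0 := mul_ne_zero η.coeff_ne_zero hr0
  have he0 : algebraMap (U.presheaf.stalk y) U.functionField e ≠ 0 :=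
    algebraMap_stalk_ne_zero (he.ne_zero_iff.2 hd)
  have hsign' : EqUpToSign (η'.coeff * t) (functionFieldMap f hgen (η.coeff * r) *
      algebraMap (U.presheaf.stalk y) U.functionField e) := by
    have h1 := (EqUpToSign.rfl' (x := functionFieldMap f hgen η.coeff)).mul hsign
    rw [← mul_assoc, ← mul_assoc] at h1
    rw [hcoeff, map_mul]
    exact h1
  rw [ord_eq_of_eqUpToSign hsign',
    Scheme.ord_mul ((_root_.map_ne_zero (functionFieldMap f hgen)).2 hcr) he0,
    ord_functionFieldMap f hgen hy hfy hm hcr, hr', ord_algebraMap_of_associated hd he]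

variable {x : Γ(U, ⊤)} (hx0 : x ≠ 0) (hx : ZeroSchemeIsRegular x)
  (hI : ∀ g : G, ∃ v, (actInv ρ g).appTop x = x * (1 + x * v)) {O : U.Opens}
  (hO : FixedSchemeEqZeroScheme ρ x O) (hyO : ∀ y : U, Order.coheight y = 1 → y ∈ O)
include hx0 hx hI hO hyO

theorem hasDivisor_of_isPullback {η : CanonicalForm π} {η' : CanonicalForm (f ≫ π)}
    (hη : η.IsPullback f η') {D : X → ℤ} (hD : η.HasDivisor D) :
    η'.HasDivisor (pullbackDivisor f D +
      ((p : ℤ) - 1) • reducedDivisor (U.zeroLocus {x})) := by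
  refine fun y => ⟨fun hy => ?_, fun hy => ?_⟩
  · obtain ⟨h1, h2, z, H, hH⟩ := hf.exists_isGenerator hcard hx0 hx hO hI hy (hyO y hy)
    have hfy := hf.coheight_apply_eq_one hI hcard hx0 hx hO hyO hy
    have hgy : (U.presheaf.germ ⊤ y trivial).hom x ≠ 0 :=
      (map_ne_zero_iff _ (germ_injective_of_isIntegral U (U := ⊤) y trivial)).2 hx0
    have h3 := hf.hasOrder_of_isPullback π hcard hy hfy h2 hH (pow_ne_zero _ hgy) hη
      ((hD (f y)).1 hfy)
    rw [map_pow, ord_pow (algebraMap_stalk_ne_zero hgy), ord_germ_eq_reducedDivisor hx0 hx hy,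
      Nat.cast_pred (Fact.out : p.Prime).pos] at h3
    rwa [Pi.add_apply, Pi.smul_apply, smul_eq_mul,
      hf.pullbackDivisor_apply hI hcard hx0 hx hO hyO D hy]
  · rw [Pi.add_apply, Pi.smul_apply, pullbackDivisor, if_neg hy, reducedDivisor,
      if_neg fun h => hy h.1, smul_zero, add_zero]

theorem exists_hasDivisor [IsRegularScheme S] [LocallyOfFiniteType (f ≫ π)]
    (η : CanonicalForm π) : ∃ D, η.HasDivisor D := by
  have := hf.locallyOfFiniteType π
  refine η.exists_hasDivisor fun x' hx' => ?_
  obtain ⟨y, rfl⟩ := hf.surjective x'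
  have hy := hf.coheight_eq_one hx'
  obtain ⟨h1, -⟩ := hf.exists_isGenerator hcard hx0 hx hO hI hy (hyO y hy)
  infer_instance

end IsQuotient

/-- If a generator of the group acts trivially on `x` modulo `x²`, so does the whole group. -/
lemma exists_appTop_eq_of_forall_mem_powers {G : Type} [Group G] {U : Scheme.{u}}
    {ρ : G →* Aut U} {σ : G} (hσ : ∀ g : G, g ∈ Submonoid.powers σ) {x v : Γ(U, ⊤)}
    (hv : (actInv ρ σ).appTop x - x = x ^ 2 * v) (g : G) :
    ∃ v, (actInv ρ g).appTop x = x * (1 + x * v) := by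
  obtain ⟨n, rfl⟩ := hσ g
  change ∃ v, (actInv ρ (σ ^ n)).appTop x = x * (1 + x * v)
  induction n with
  | zero =>
    refine ⟨0, ?_⟩
    rw [pow_zero, actInv_one, mul_zero, add_zero, mul_one, Scheme.Hom.id_appTop]
    rfl
  | succ n ih =>
    obtain ⟨w, hw⟩ := ih
    rw [pow_succ', actInv_mul, Scheme.Hom.comp_appTop, CommRingCat.comp_apply, hw, map_mul,
      map_add, map_one, map_mul]
    have hv' : (actInv ρ σ).appTop x = x * (1 + x * v) := by
      linear_combination hv
    rw [hv']
    exact ⟨v + (1 + x * v) ^ 2 * (actInv ρ σ).appTop w, by ring⟩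

end QuotientRamification

open AlgebraicGeometry CategoryTheory QuotientRamification in
theorem corollary6p2 (p : ℕ) [Fact p.Prime] {U X S : Scheme.{u}}
    [IsIntegral U] [IsRegularScheme U] [IsRegularScheme S]
    (πU : U ⟶ S) [LocallyOfFiniteType πU] [QuasiCompact πU]
    -- an action of the cyclic group of order `p` on `U` over `S`, and its quotient
    (ρ : Multiplicative (ZMod p) →* Aut U) (hρ : ∀ g, (ρ g).hom ≫ πU = πU)
    (f : U ⟶ X) (hf : IsQuotient ρ f) (πX : X ⟶ S) (hπ : f ≫ πX = πU)
    -- the regular divisor `E₁ = {x₁ = 0}`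
    (x₁ : Γ(U, ⊤)) (hx₁ : x₁ ≠ 0) (hE₁ : ZeroSchemeIsRegular x₁)
    -- the fixed point scheme is equal to `E₁` outside a closed subset of codimension at least two
    (hfix : ∃ O : U.Opens, (∀ y : U, Order.coheight y = 1 → y ∈ O) ∧
      FixedSchemeEqZeroScheme ρ x₁ O)
    -- `I(x₁) = σ(x₁) - x₁` is a multiple of `x₁²` (for example, `x₁²` times a unit)
    (hI : ∃ v : Γ(U, ⊤),
      actOnFunction (ρ (Multiplicative.ofAdd 1)) x₁ - x₁ = x₁ ^ 2 * v) :
    ∃ (_ : IsIntegral X) (_ : IsLocallyNoetherian X),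
      -- `f` is fiercely ramified along `E₁`
      (∀ y : U, Order.coheight y = 1 → y ∈ U.zeroLocus {x₁} → IsFiercelyRamifiedAt p f y) ∧
      -- the image `F₁` of `E₁` is `ℚ`-Cartier
      IsQCartier (reducedDivisor (f '' U.zeroLocus {x₁})) ∧
      -- `f^* F₁ = E₁`
      pullbackDivisor f (reducedDivisor (f '' U.zeroLocus {x₁})) =
        reducedDivisor (U.zeroLocus {x₁}) ∧
      -- `K_U = f^* K_X + (p - 1) E₁`
      Nonempty (CanonicalForm πX) ∧
      ∀ η : CanonicalForm πX,
        (∃ KX : X → ℤ, η.HasDivisor KX) ∧ (∃ η' : CanonicalForm πU, η.IsPullback f η') ∧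
        ∀ (KX : X → ℤ) (η' : CanonicalForm πU), η.HasDivisor KX → η.IsPullback f η' →
          η'.HasDivisor (pullbackDivisor f KX +
            ((p : ℤ) - 1) • reducedDivisor (U.zeroLocus {x₁})) := by
  subst hπ
  let σ : Multiplicative (ZMod p) := Multiplicative.ofAdd 1
  have hcard : Nat.card (Multiplicative (ZMod p)) = p := by
    rw [Nat.card_eq_fintype_card, Fintype.card_multiplicative, ZMod.card]
  have hσ : ∀ g : Multiplicative (ZMod p), g ∈ Submonoid.powers σ := fun g =>
    ⟨(Multiplicative.toAdd g).val, by
      change σ ^ (Multiplicative.toAdd g).val = g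
      rw [← ofAdd_nsmul, nsmul_one, ZMod.natCast_zmod_val, ofAdd_toAdd]⟩
  obtain ⟨v, hv⟩ := hI
  have hI' := exists_appTop_eq_of_forall_mem_powers (ρ := ρ) hσ (x := x₁) hv
  obtain ⟨O, hyO, hO⟩ := hfix
  have hX : IsIntegral X := hf.isIntegral
  have := hf.locallyOfFiniteType πX
  have hN : IsLocallyNoetherian X := LocallyOfFiniteType.isLocallyNoetherian πX
  exact ⟨hX, hN,
    fun y hy hyx => hf.isFiercelyRamifiedAt hcard hx₁ hE₁ hO hI' hy (hyO y hy) hyx,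
    hf.isQCartier hI' hcard hx₁ hE₁ hO hyO,
    hf.pullbackDivisor_reducedDivisor hI' hcard hx₁ hE₁ hO hyO,
    nonempty_canonicalForm πX,
    fun η => ⟨hf.exists_hasDivisor πX hcard hx₁ hE₁ hI' hO hyO η,
      hf.exists_isPullback hcard πX η,
      fun _ _ hD hη => hf.hasDivisor_of_isPullback πX hcard hx₁ hE₁ hI' hO hyO hη hD⟩⟩
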